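/- Let $\mathcal G$ be a second countable locally compact Hausdorff étale groupoid with unit space $\mathcal G^{(0)}$ and range and source maps $r,s$. For $x\in\mathcal G^{(0)}$ put $\mathcal G_x=s^{-1}(x)$ and $\mathcal G^x_x=r^{-1}(x)\cap s^{-1}(x)$. Let $C^*_r(\mathcal G)$ be the reduced groupoid $C^*$-algebra, i.e. the completion of the convolution $*$-algebra $C_c(\mathcal G)$ in the norm $\|f\|_r=\sup_{x\in\mathcal G^{(0)}}\|\pi_x(f)\|$, where $\pi_x(f)\xi(g)=\sum_{r(h)=r(g)}f(h)\,\xi(h^{-1}g)$ on $\ell^2(\mathcal G_x)$. Let $P:C^*_r(\mathcal G)\to C_0(\mathcal G^{(0)})$ be the canonical conditional expectation, the continuous extension of the restriction map $C_c(\mathcal G)\to C_c(\mathcal G^{(0)})$. A continuous homomorphism $c:\mathcal G\to\mathbb R$ defines a point-wise norm-continuous one-parameter group $\sigma^c=(\sigma^c_t)_{t\in\mathbb R}$ of automorphisms of $C^*_r(\mathcal G)$, determined by $\sigma^c_t(f)(g)=e^{itc(g)}f(g)$ for $f\in C_c(\mathcal G)$. A weight $\psi:A_+\to[0,\infty]$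 on a $C^*$-algebra $A$ is proper when it is non-zero, densely defined and lower semi-continuous. Put $\mathcal N_\psi=\{a\in A:\psi(a^*a)<\infty\}$ and denote also by $\psi$ the unique linear extension of $\psi$ to $\mathcal N_\psi^*\mathcal N_\psi=\operatorname{Span}\{a^*b: a,b\in\mathcal N_\psi\}$. For $\beta\in\mathbb R$, a $\beta$-KMS weight for a point-wise norm-continuous one-parameter group $\alpha=(\alpha_t)_{t\in\mathbb R}$ of automorphisms of $A$ is a proper weight $\psi$ with $\psi\circ\alpha_t=\psi$ for all $t\in\mathbb R$, such that for all $a,b\in\mathcal N_\psi\cap\mathcal N_\psi^*$ there is a bounded continuous function $F$ on the closed strip of all $z\in\mathbb C$ whose imaginary part lies between $0$ and $\beta$, holomorphic in the interior of the strip, with $F(t)=\psi(a\,\alpha_t(b))$ and $F(t+i\beta)=\psi(\alpha_t(b)\,a)$ for all $t\in\mathbb R$. **Theorem.** Let $c_0:\mathcal G\to\mathbb R$ and $c:\mathcal G\to\mathbb R$ be continuous homomorphisms and put $\ker c_0=\{g\in\mathcal G: c_0(g)=0\}$. Assume that $\mathcal G^x_x\cap\ker c_0=\{x\}$ for all $x\in\mathcal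 G^{(0)}$, and that $\ker c_0$ is open in $\mathcal G$. Let $\beta\in\mathbb R$ and let $\psi$ be a $\beta$-KMS weight for $\sigma^c$ on $C^*_r(\mathcal G)$ such that $\psi\circ\sigma^{c_0}_t=\psi$ for all $t\in\mathbb R$. Then there is a non-zero regular Borel measure $m$ on $\mathcal G^{(0)}$, finite on compact sets, such that $$\psi(a)=\int_{\mathcal G^{(0)}}P(a)\,dm\qquad\text{for all } a\in C^*_r(\mathcal G),\ a\ge 0 .$$ -/

import Mathlib

open Set Filter Topology MeasureTheory
open scoped ENNReal NNReal CompactlySupported ZeroAtInfty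

/-! ### Weights on C*-algebras and the KMS condition -/

section Weights

/-- A weight on a C*-algebra `A`: an additive and positively homogeneous map `A₊ → [0,∞]`. -/
structure CStarWeight (A : Type*) [NonUnitalCStarAlgebra A] [PartialOrder A]
    [StarOrderedRing A] where
  toFun : {a : A // 0 ≤ a} → ℝ≥0∞
  map_add' : ∀ a b : {a : A // 0 ≤ a}, toFun (a + b) = toFun a + toFun b
  map_smul' : ∀ (l : ℝ) (hl : 0 < l) (a : {a : A // 0 ≤ a}),
    toFun ⟨l • (a : A), smul_nonneg hl.le a.2⟩ = ENNReal.ofReal l * toFun a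

/-- A point-wise norm-continuous one-parameter group of automorphisms of a C*-algebra. -/
structure OneParameterGroup (A : Type*) [NonUnitalCStarAlgebra A] where
  toFun : ℝ → (A ≃⋆ₐ[ℂ] A)
  map_zero' : ∀ a, toFun 0 a = a
  map_add' : ∀ s t a, toFun (s + t) a = toFun s (toFun t a)
  continuous' : ∀ a, Continuous fun t => toFun t a

instance {A : Type*} [NonUnitalCStarAlgebra A] :
    CoeFun (OneParameterGroup A) (fun _ => ℝ → (A ≃⋆ₐ[ℂ] A)) := ⟨OneParameterGroup.toFun⟩

namespace CStarWeight

variable {A : Type*} [NonUnitalCStarAlgebra A] [PartialOrder A] [StarOrderedRing A]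

instance : CoeFun (CStarWeight A) (fun _ => {a : A // 0 ≤ a} → ℝ≥0∞) := ⟨CStarWeight.toFun⟩

/-- A weight is proper when it is non-zero, densely defined and lower semi-continuous. -/
structure IsProper (ψ : CStarWeight A) : Prop where
  ne_zero : ∃ a, ψ a ≠ 0
  dense : Dense {a : {a : A // 0 ≤ a} | ψ a < ∞}
  lowerSemicontinuous : ∀ r : ℝ≥0, IsClosed {a : {a : A // 0 ≤ a} | ψ a ≤ r}

/-- `𝒩_ψ = {a ∈ A : ψ(a⋆a) < ∞}`. -/
def leftIdeal (ψ : CStarWeight A) : Set A :=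
  {a | ψ ⟨star a * a, star_mul_self_nonneg a⟩ < ∞}

/-- `𝒩_ψ⋆ 𝒩_ψ`, the linear span of the products `a⋆b` with `a, b ∈ 𝒩_ψ`. -/
def defDomain (ψ : CStarWeight A) : Submodule ℂ A :=
  Submodule.span ℂ {x | ∃ a ∈ ψ.leftIdeal, ∃ b ∈ ψ.leftIdeal, x = star a * b}

/-- `Ψ` is a linear functional on `𝒩_ψ⋆ 𝒩_ψ` extending
`ψ : 𝒩_ψ⋆ 𝒩_ψ ∩ A₊ → [0,∞)`. -/
def IsLinearExtension (ψ : CStarWeight A) (Ψ : ψ.defDomain →ₗ[ℂ] ℂ) : Prop :=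
  ∀ x : ψ.defDomain, ∀ hx : 0 ≤ (x : A),
    ψ ⟨x, hx⟩ ≠ ∞ ∧ Ψ x = ((ψ ⟨x, hx⟩).toReal : ℂ)

theorem map_zero_of_isProper {ψ : CStarWeight A} (h : ψ.IsProper) : ψ 0 = 0 := by
  have h0 : (⟨0, le_rfl⟩ : {a : A // 0 ≤ a}) = 0 := rfl
  obtain ⟨a, ha⟩ := h.dense.nonempty
  have h1 := ψ.map_add' a 0
  rw [add_zero] at h1
  have h2 : ψ a + 0 = ψ a + ψ 0 := by rw [add_zero]; exact h1
  exact ((ENNReal.add_right_inj (ne_of_lt ha)).1 h2).symm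

theorem mono (ψ : CStarWeight A) {a b : {a : A // 0 ≤ a}} (h : (a : A) ≤ b) : ψ a ≤ ψ b := by
  have : b = a + ⟨(b : A) - a, sub_nonneg.2 h⟩ := by
    ext; simp
  rw [this, ψ.map_add']
  exact le_self_add

theorem smul_mem_leftIdeal {ψ : CStarWeight A} (h : ψ.IsProper) (c : ℂ) {a : A}
    (ha : a ∈ ψ.leftIdeal) : c • a ∈ ψ.leftIdeal := by
  rcases eq_or_ne c 0 with rfl | hc
  · have : (⟨star ((0 : ℂ) • a) * ((0 : ℂ) • a), star_mul_self_nonneg _⟩ :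
        {a : A // 0 ≤ a}) = 0 := by ext; simp
    simp only [leftIdeal, Set.mem_ofPred_eq]
    rw [this, map_zero_of_isProper h]
    exact ENNReal.zero_lt_top
  · have hc' : 0 < ‖c‖ ^ 2 := by positivity
    have : (⟨star (c • a) * (c • a), star_mul_self_nonneg _⟩ : {a : A // 0 ≤ a}) =
        ⟨(‖c‖ ^ 2) • (star a * a), smul_nonneg hc'.le (star_mul_self_nonneg a)⟩ := by
      ext
      simp only [star_smul, smul_mul_assoc, mul_smul_comm, smul_smul]
      rw [← Complex.coe_smul (‖c‖ ^ 2)]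
      congr 1
      simpa using Complex.mul_conj' c
    simp only [leftIdeal, Set.mem_ofPred_eq]
    rw [this, ψ.map_smul' _ hc' ⟨star a * a, star_mul_self_nonneg a⟩]
    exact ENNReal.mul_lt_top ENNReal.ofReal_lt_top ha

theorem add_mem_leftIdeal {ψ : CStarWeight A} {a b : A}
    (ha : a ∈ ψ.leftIdeal) (hb : b ∈ ψ.leftIdeal) : a + b ∈ ψ.leftIdeal := by
  set x : {a : A // 0 ≤ a} := ⟨star a * a, star_mul_self_nonneg a⟩
  set y : {a : A // 0 ≤ a} := ⟨star b * b, star_mul_self_nonneg b⟩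
  have : (⟨star (a + b) * (a + b), star_mul_self_nonneg _⟩ : {a : A // 0 ≤ a}) +
      ⟨star (a - b) * (a - b), star_mul_self_nonneg _⟩ = (x + y) + (x + y) := by
    ext
    simp only [x, y, Nonneg.mk_add_mk, star_add, star_sub]
    noncomm_ring
  have h2 := congrArg ψ this
  rw [ψ.map_add', ψ.map_add', ψ.map_add'] at h2
  have h3 : ψ x + ψ y + (ψ x + ψ y) < ∞ := by
    have hx : ψ x < ∞ := ha
    have hy : ψ y < ∞ := hb
    exact ENNReal.add_lt_top.2 ⟨ENNReal.add_lt_top.2 ⟨hx, hy⟩, ENNReal.add_lt_top.2 ⟨hx, hy⟩⟩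
  rw [← h2] at h3
  exact lt_of_le_of_lt le_self_add h3

theorem sum_aux {ψ : CStarWeight A} (h : ψ.IsProper) {ι : Type*} (s : Finset ι)
    (p : ι → {a : A // 0 ≤ a}) (w : ι → ℝ) (hw : ∀ i, 0 ≤ w i) :
    ∃ hn : 0 ≤ ∑ i ∈ s, w i • (p i : A),
      ψ ⟨∑ i ∈ s, w i • (p i : A), hn⟩ = ∑ i ∈ s, ENNReal.ofReal (w i) * ψ (p i) := by
  classical
  have hn : ∀ t : Finset ι, 0 ≤ ∑ i ∈ t, w i • (p i : A) := fun t =>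
    Finset.sum_nonneg fun i _ => smul_nonneg (hw i) (p i).2
  refine ⟨hn s, ?_⟩
  induction s using Finset.induction_on with
  | empty =>
    simp only [Finset.sum_empty]
    exact map_zero_of_isProper h
  | insert i t hi ih =>
    have e1 : (⟨∑ j ∈ insert i t, w j • (p j : A), hn _⟩ : {a : A // 0 ≤ a}) =
        ⟨w i • (p i : A), smul_nonneg (hw i) (p i).2⟩ + ⟨∑ j ∈ t, w j • (p j : A), hn t⟩ := by
      ext; simp [Finset.sum_insert hi]
    rw [e1, ψ.map_add', ih, Finset.sum_insert hi]
    congr 1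
    rcases (hw i).eq_or_lt with h0 | h0
    · have : (⟨w i • (p i : A), smul_nonneg (hw i) (p i).2⟩ : {a : A // 0 ≤ a}) = 0 := by
        ext; simp [← h0]
      rw [this, map_zero_of_isProper h, ← h0]; simp
    · exact ψ.map_smul' _ h0 _

/-- The elements `a⋆a` with `a ∈ 𝒩_ψ`. -/
def sq (ψ : CStarWeight A) (a : ψ.leftIdeal) : {a : A // 0 ≤ a} :=
  ⟨star (a : A) * a, star_mul_self_nonneg (a : A)⟩

theorem mem_span_sq {ψ : CStarWeight A} (h : ψ.IsProper) {x : A} (hx : x ∈ ψ.defDomain) :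
    x ∈ Submodule.span ℂ (range fun a : ψ.leftIdeal => (ψ.sq a : A)) := by
  refine Submodule.span_le.2 ?_ hx
  rintro _ ⟨a, ha, b, hb, rfl⟩
  have key : ∀ c : ℂ, star (b + c • a) * (b + c • a) ∈
      Submodule.span ℂ (range fun a : ψ.leftIdeal => (ψ.sq a : A)) := fun c =>
    Submodule.subset_span ⟨⟨_, add_mem_leftIdeal hb (smul_mem_leftIdeal h c ha)⟩, rfl⟩
  have e : star a * b = (1 / 4 : ℂ) • (star (b + (1 : ℂ) • a) * (b + (1 : ℂ) • a))
      + (-1 / 4 : ℂ) • (star (b + (-1 : ℂ) • a) * (b + (-1 : ℂ) • a))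
      + (Complex.I / 4 : ℂ) • (star (b + Complex.I • a) * (b + Complex.I • a))
      + (-Complex.I / 4 : ℂ) • (star (b + (-Complex.I) • a) * (b + (-Complex.I) • a)) := by
    simp only [star_add, star_smul, add_mul, mul_add, smul_mul_assoc, mul_smul_comm, smul_add,
      smul_smul]
    simp only [Complex.star_def, map_one, map_neg, Complex.conj_I]
    match_scalars <;> ring_nf <;> norm_num [Complex.I_sq]
  rw [SetLike.mem_coe, e]
  exact Submodule.add_mem _ (Submodule.add_mem _ (Submodule.add_mem _
    (Submodule.smul_mem _ _ (key _)) (Submodule.smul_mem _ _ (key _)))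
    (Submodule.smul_mem _ _ (key _))) (Submodule.smul_mem _ _ (key _))

theorem span_sq_eq {ψ : CStarWeight A} (h : ψ.IsProper) :
    Submodule.span ℂ (range fun a : ψ.leftIdeal => (ψ.sq a : A)) = ψ.defDomain := by
  refine le_antisymm (Submodule.span_le.2 ?_) (fun x hx => mem_span_sq h hx)
  rintro _ ⟨a, rfl⟩
  exact Submodule.subset_span ⟨a, a.2, a, a.2, rfl⟩

theorem self_adjoint_aux {ψ : CStarWeight A} (h : ψ.IsProper) (v : ψ.leftIdeal →₀ ℂ) (x : A)
    (hx : ∑ a ∈ v.support, v a • (ψ.sq a : A) = x) (hx0 : 0 ≤ x) :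
    ψ ⟨x, hx0⟩ ≠ ∞ ∧
      ∑ a ∈ v.support, v a * ((ψ (ψ.sq a)).toReal : ℂ) = ((ψ ⟨x, hx0⟩).toReal : ℂ) := by
  -- decomposition of a combination with real coefficients
  have fin : ∀ a : ψ.leftIdeal, ψ (ψ.sq a) ≠ ∞ := fun a => ne_of_lt a.2
  have real_case : ∀ (w : ψ.leftIdeal → ℝ) (y : A) (hy0 : 0 ≤ y),
      ∑ a ∈ v.support, w a • (ψ.sq a : A) = y → ψ ⟨y, hy0⟩ ≠ ∞ ∧
        ∑ a ∈ v.support, w a * (ψ (ψ.sq a)).toReal = (ψ ⟨y, hy0⟩).toReal := by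
    intro w y hy0 hy
    obtain ⟨hp, hpe⟩ := sum_aux h v.support ψ.sq (fun a => max (w a) 0) (fun a => le_max_right _ _)
    obtain ⟨hq, hqe⟩ := sum_aux h v.support ψ.sq (fun a => max (-w a) 0)
      (fun a => le_max_right _ _)
    have e : (⟨_, hp⟩ : {a : A // 0 ≤ a}) = ⟨y, hy0⟩ + ⟨_, hq⟩ := by
      ext
      simp only [Nonneg.mk_add_mk]
      rw [← hy, ← Finset.sum_add_distrib]
      refine Finset.sum_congr rfl fun a _ => ?_
      rw [← add_smul]
      congr 1
      rcases le_total 0 (w a) with h1 | h1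
      · rw [max_eq_left h1, max_eq_right (by linarith)]; ring
      · rw [max_eq_right h1, max_eq_left (by linarith)]; ring
    have e2 := congrArg ψ e
    rw [ψ.map_add', hpe, hqe] at e2
    have finp : ∀ u : ψ.leftIdeal → ℝ,
        ∑ a ∈ v.support, ENNReal.ofReal (u a) * ψ (ψ.sq a) ≠ ∞ := fun u =>
      ENNReal.sum_ne_top.2 fun a _ => ENNReal.mul_ne_top ENNReal.ofReal_ne_top (fin a)
    have hyfin : ψ ⟨y, hy0⟩ ≠ ∞ := by
      intro ht
      rw [ht, top_add] at e2
      exact finp _ e2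
    refine ⟨hyfin, ?_⟩
    have e3 := congrArg ENNReal.toReal e2
    rw [ENNReal.toReal_add hyfin (finp _), ENNReal.toReal_sum, ENNReal.toReal_sum] at e3
    · simp only [ENNReal.toReal_mul] at e3
      rw [← sub_eq_iff_eq_add] at e3
      rw [← e3, ← Finset.sum_sub_distrib]
      refine Finset.sum_congr rfl fun a _ => ?_
      rw [ENNReal.toReal_ofReal (le_max_right _ _), ENNReal.toReal_ofReal (le_max_right _ _),
        ← sub_mul]
      congr 1
      rcases le_total 0 (w a) with h1 | h1
      · rw [max_eq_left h1, max_eq_right (by linarith)]; ring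
      · rw [max_eq_right h1, max_eq_left (by linarith)]; ring
    · exact fun a _ => ENNReal.mul_ne_top ENNReal.ofReal_ne_top (fin a)
    · exact fun a _ => ENNReal.mul_ne_top ENNReal.ofReal_ne_top (fin a)
  have hsa : ∀ a : ψ.leftIdeal, star (ψ.sq a : A) = ψ.sq a := fun a => by simp [sq]
  have hstar : ∑ a ∈ v.support, star (v a) • (ψ.sq a : A) = x := by
    have := congrArg star hx
    rw [star_sum, (IsSelfAdjoint.of_nonneg hx0).star_eq] at this
    simpa only [star_smul, hsa] using this
  have hre : ∑ a ∈ v.support, (v a).re • (ψ.sq a : A) = x := by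
    have e : ∀ a, (v a).re • (ψ.sq a : A) =
        (1 / 2 : ℂ) • (v a • (ψ.sq a : A) + star (v a) • (ψ.sq a : A)) := fun a => by
      rw [← Complex.coe_smul, Complex.re_eq_add_conj, ← add_smul, smul_smul]
      congr 1
      simp only [Complex.star_def]; ring
    rw [Finset.sum_congr rfl fun a _ => e a, ← Finset.smul_sum, Finset.sum_add_distrib, hx,
      hstar, ← two_smul ℂ, smul_smul]
    norm_num
  have him : ∑ a ∈ v.support, (v a).im • (ψ.sq a : A) = 0 := by
    have e : ∀ a, (v a).im • (ψ.sq a : A) =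
        (1 / (2 * Complex.I) : ℂ) • (v a • (ψ.sq a : A) - star (v a) • (ψ.sq a : A)) :=
      fun a => by
      rw [← Complex.coe_smul, Complex.im_eq_sub_conj, ← sub_smul, smul_smul]
      congr 1
      simp only [Complex.star_def]; ring
    rw [Finset.sum_congr rfl fun a _ => e a, ← Finset.smul_sum, Finset.sum_sub_distrib, hx,
      hstar, sub_self, smul_zero]
  obtain ⟨h1, h2⟩ := real_case (fun a => (v a).re) x hx0 hre
  obtain ⟨-, h3⟩ := real_case (fun a => (v a).im) 0 le_rfl him
  have h0 : ψ ⟨0, le_rfl⟩ = 0 := map_zero_of_isProper h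
  rw [h0, ENNReal.toReal_zero] at h3
  refine ⟨h1, ?_⟩
  rw [← h2]
  apply Complex.ext
  · simp [Complex.re_sum]
  · simpa [Complex.im_sum] using h3

/-- The linear extension of a proper weight to `𝒩_ψ⋆ 𝒩_ψ` exists and is unique. -/
theorem existsUnique_linearExtension {ψ : CStarWeight A} (h : ψ.IsProper) :
    ∃! Ψ : ψ.defDomain →ₗ[ℂ] ℂ, ψ.IsLinearExtension Ψ := by
  let L : (ψ.leftIdeal →₀ ℂ) →ₗ[ℂ] A :=
    Finsupp.linearCombination ℂ (fun a : ψ.leftIdeal => (ψ.sq a : A))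
  let Λ : (ψ.leftIdeal →₀ ℂ) →ₗ[ℂ] ℂ :=
    Finsupp.linearCombination ℂ (fun a : ψ.leftIdeal => ((ψ (ψ.sq a)).toReal : ℂ))
  have hLr : LinearMap.range L = ψ.defDomain := by
    rw [← span_sq_eq h, Finsupp.range_linearCombination]
  have key : ∀ v (hv : 0 ≤ L v), ψ ⟨L v, hv⟩ ≠ ∞ ∧ Λ v = ((ψ ⟨L v, hv⟩).toReal : ℂ) := by
    intro v hv
    have := self_adjoint_aux h v (L v) rfl hv
    exact this
  have hker : LinearMap.ker L ≤ LinearMap.ker Λ := by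
    intro v hv
    rw [LinearMap.mem_ker] at hv ⊢
    have := (key v hv.ge).2
    have h0 : (⟨L v, hv.ge⟩ : {a : A // 0 ≤ a}) = 0 := by ext; exact hv
    rw [this, h0, map_zero_of_isProper h]; simp
  let Φ : LinearMap.range L →ₗ[ℂ] ℂ :=
    ((LinearMap.ker L).liftQ Λ hker) ∘ₗ (L.quotKerEquivRange.symm : _ →ₗ[ℂ] _)
  have hΦ : ∀ v, Φ ⟨L v, LinearMap.mem_range_self L v⟩ = Λ v := by
    intro v
    have : L.quotKerEquivRange.symm ⟨L v, LinearMap.mem_range_self L v⟩ =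
        (LinearMap.ker L).mkQ v := by
      rw [LinearEquiv.symm_apply_eq]
      rfl
    simp only [Φ, LinearMap.comp_apply, LinearEquiv.coe_coe, this]
    simp
  refine ⟨Φ ∘ₗ (LinearEquiv.ofEq _ _ hLr.symm : ψ.defDomain →ₗ[ℂ] _), ?_, ?_⟩
  · rintro ⟨x, hxm⟩ hx
    obtain ⟨v, hv⟩ : x ∈ LinearMap.range L := hLr ▸ hxm
    subst hv
    refine ⟨(key v hx).1, ?_⟩
    rw [← (key v hx).2, ← hΦ v]
    rfl
  · intro Ψ hΨ
    ext ⟨x, hxm⟩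
    obtain ⟨v, hv⟩ : x ∈ LinearMap.range L := hLr ▸ hxm
    subst hv
    have lhs : ∀ v (hm : L v ∈ ψ.defDomain), Ψ ⟨L v, hm⟩ = Λ v := by
      have : ∀ v, L v ∈ ψ.defDomain := fun v => hLr ▸ LinearMap.mem_range_self L v
      have e : Ψ ∘ₗ L.codRestrict ψ.defDomain this = Λ := by
        ext a
        have hL1 : L (Finsupp.single a 1) = (ψ.sq a : A) := by simp [L]
        have h1 := (hΨ ⟨(ψ.sq a : A), hL1 ▸ this _⟩ (ψ.sq a).2).2
        simp only [LinearMap.comp_apply, Finsupp.lsingle_apply]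
        have : L.codRestrict ψ.defDomain this (Finsupp.single a 1) =
          ⟨(ψ.sq a : A), hL1 ▸ this _⟩ := Subtype.ext hL1
        rw [this, h1]
        simp [Λ]
      intro v hm
      exact LinearMap.congr_fun e v
    rw [lhs v hxm, ← hΦ v]
    rfl

/-- The linear functional `𝒩_ψ⋆ 𝒩_ψ → ℂ` extending a proper weight `ψ`. -/
noncomputable def linearExtension (ψ : CStarWeight A) (h : ψ.IsProper) : ψ.defDomain →ₗ[ℂ] ℂ :=
  (existsUnique_linearExtension h).choose

theorem linearExtension_spec (ψ : CStarWeight A) (h : ψ.IsProper) :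
    ψ.IsLinearExtension (ψ.linearExtension h) :=
  (existsUnique_linearExtension h).choose_spec.1

/-- `ψ ∘ φ = ψ` on the positive cone, for an automorphism `φ` of `A`. -/
def IsInvariantUnder (ψ : CStarWeight A) (φ : A ≃⋆ₐ[ℂ] A) : Prop :=
  ∀ a : {a : A // 0 ≤ a}, ψ ⟨φ a, map_nonneg φ a.2⟩ = ψ a

theorem IsInvariantUnder.mem_leftIdeal {ψ : CStarWeight A} {φ : A ≃⋆ₐ[ℂ] A}
    (h : ψ.IsInvariantUnder φ) {b : A} (hb : b ∈ ψ.leftIdeal) : φ b ∈ ψ.leftIdeal := by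
  have := h ⟨star b * b, star_mul_self_nonneg b⟩
  have e : (⟨star (φ b) * φ b, star_mul_self_nonneg _⟩ : {a : A // 0 ≤ a}) =
      ⟨φ (star b * b), map_nonneg φ (star_mul_self_nonneg b)⟩ := by
    ext; simp [map_mul, map_star]
  simp only [leftIdeal, Set.mem_ofPred_eq]
  rw [e, this]
  exact hb

theorem mul_mem_defDomain {ψ : CStarWeight A} {a b : A} (ha : star a ∈ ψ.leftIdeal)
    (hb : b ∈ ψ.leftIdeal) : a * b ∈ ψ.defDomain :=
  Submodule.subset_span ⟨star a, ha, b, hb, by rw [star_star]⟩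

/-- The closed strip of complex numbers whose imaginary part lies between `0` and `β`
(`β` may be negative or zero). -/
def kmsStrip (β : ℝ) : Set ℂ := {z | z.im ∈ uIcc 0 β}

/-- `ψ` is a `β`-KMS weight for the one-parameter group `α`. The set
`𝒩_ψ ∩ 𝒩_ψ⋆` consists of the `a` with `a ∈ 𝒩_ψ` and `a⋆ ∈ 𝒩_ψ`. -/
structure IsKMS (ψ : CStarWeight A) (α : OneParameterGroup A) (β : ℝ) : Prop where
  proper : ψ.IsProper
  invariant : ∀ t, ψ.IsInvariantUnder (α t)
  kms : ∀ (a b : A) (ha : a ∈ ψ.leftIdeal) (ha' : star a ∈ ψ.leftIdeal)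
    (hb : b ∈ ψ.leftIdeal) (hb' : star b ∈ ψ.leftIdeal),
    ∃ F : ℂ → ℂ, ContinuousOn F (kmsStrip β) ∧ (∃ C : ℝ, ∀ z ∈ kmsStrip β, ‖F z‖ ≤ C) ∧
      DifferentiableOn ℂ F (interior (kmsStrip β)) ∧
      ∀ t : ℝ,
        F t = ψ.linearExtension proper
          ⟨a * α t b, mul_mem_defDomain ha' ((invariant t).mem_leftIdeal hb)⟩ ∧
        F (t + Complex.I * β) = ψ.linearExtension proper
          ⟨α t b * a, mul_mem_defDomain
            (by rw [← map_star]; exact (invariant t).mem_leftIdeal hb') ha⟩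

end CStarWeight

end Weights

/-! ### Étale groupoids -/

section Groupoids

/-- An étale topological groupoid, given by its space of arrows `G`. The unit space is the set of
arrows `x` with `range x = x`. The product `mul g h` is only meaningful when
`source g = range h`. Étale means that the range map is a local homeomorphism from `G` to the unit
space, the latter with the subspace topology. -/
class EtaleGroupoid (G : Type*) [TopologicalSpace G] where
  range : G → G
  source : G → G
  mul : G → G → G
  inv : G → G
  range_range : ∀ g, range (range g) = range g
  source_range : ∀ g, source (range g) = range g
  range_source : ∀ g, range (source g) = source g
  source_source : ∀ g, source (source g) = source g
  range_mul : ∀ g h, source g = range h → range (mul g h) = range g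
  source_mul : ∀ g h, source g = range h → source (mul g h) = source h
  mul_assoc : ∀ g h k, source g = range h → source h = range k →
    mul (mul g h) k = mul g (mul h k)
  range_mul_self : ∀ g, mul (range g) g = g
  self_mul_source : ∀ g, mul g (source g) = g
  range_inv : ∀ g, range (inv g) = source g
  source_inv : ∀ g, source (inv g) = range g
  mul_inv : ∀ g, mul g (inv g) = range g
  inv_mul : ∀ g, mul (inv g) g = source g
  continuous_inv : Continuous inv
  continuousOn_mul : ContinuousOn (fun p : G × G => mul p.1 p.2) {p | source p.1 = range p.2}
  isLocalHomeomorph_range :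
    IsLocalHomeomorph (fun g : G => (⟨range g, range_range g⟩ : {x : G // range x = x}))

namespace EtaleGroupoid

/-- The unit space `G⁽⁰⁾`, as a subset of the groupoid. -/
def unitSpace (G : Type*) [TopologicalSpace G] [EtaleGroupoid G] : Set G := {x | range x = x}

/-- The isotropy group `Gˣₓ`, the set of arrows with range and source `x`. -/
def isotropy {G : Type*} [TopologicalSpace G] [EtaleGroupoid G] (x : G) : Set G :=
  {g | range g = x ∧ source g = x}

/-- A continuous homomorphism `c : G → ℝ`. -/
structure RealHom (G : Type*) [TopologicalSpace G] [EtaleGroupoid G] where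
  toFun : G → ℝ
  continuous' : Continuous toFun
  map_mul' : ∀ g h, source g = range h → toFun (mul g h) = toFun g + toFun h

instance {G : Type*} [TopologicalSpace G] [EtaleGroupoid G] :
    CoeFun (RealHom G) (fun _ => G → ℝ) := ⟨RealHom.toFun⟩

/-- The kernel `{g ∈ G : c(g) = 0}`. -/
def RealHom.ker {G : Type*} [TopologicalSpace G] [EtaleGroupoid G] (c : RealHom G) : Set G :=
  {g | c g = 0}

variable {G : Type*} [TopologicalSpace G] [EtaleGroupoid G]

theorem continuous_range : Continuous (range : G → G) :=
  continuous_subtype_val.comp isLocalHomeomorph_range.continuous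

theorem continuous_source : Continuous (source : G → G) := by
  have : (source : G → G) = range ∘ inv := by ext g; exact (range_inv g).symm
  rw [this]; exact continuous_range.comp continuous_inv

theorem source_unit {x : G} (hx : range x = x) : source x = x := by
  rw [← hx, source_range]

theorem inv_mul_cancel_left {g h : G} (e : source g = range h) : mul (inv g) (mul g h) = h := by
  rw [← mul_assoc _ _ _ (source_inv g) e, inv_mul, e, range_mul_self]

theorem mul_inv_cancel_left {g h : G} (e : range g = range h) : mul g (mul (inv g) h) = h := by
  rw [← mul_assoc _ _ _ (range_inv g).symm ((source_inv g).trans e), mul_inv, e, range_mul_self]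

theorem mul_inv_cancel_right {g h : G} (e : source g = range h) : mul (mul g h) (inv h) = g := by
  rw [mul_assoc _ _ _ e (range_inv h).symm, mul_inv, ← e, self_mul_source]

theorem inv_mul_cancel_right {g h : G} (e : source g = source h) :
    mul (mul g (inv h)) h = g := by
  rw [mul_assoc _ _ _ (e.trans (range_inv h).symm) (source_inv h), inv_mul, ← e, self_mul_source]

theorem eq_inv_of_mul {g h : G} (e : source g = range h) (hm : mul g h = range g) :
    h = inv g := by
  have := inv_mul_cancel_left e
  rw [hm, ← source_inv g, self_mul_source] at this
  exact this.symm

theorem inv_inv (g : G) : inv (inv g) = g :=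
  (eq_inv_of_mul (source_inv g) (by rw [inv_mul, range_inv])).symm

theorem mul_inv_rev {g h : G} (e : source g = range h) :
    inv (mul g h) = mul (inv h) (inv g) := by
  have e1 : source (inv h) = range (inv g) := by rw [source_inv, range_inv, e]
  refine (eq_inv_of_mul ?_ ?_).symm
  · rw [source_mul _ _ e, range_mul _ _ e1, range_inv]
  · rw [mul_assoc _ _ _ e (by rw [range_mul _ _ e1, range_inv]),
      mul_inv_cancel_left (by rw [range_inv, e]), mul_inv, range_mul _ _ e]

/-- Each arrow has an open neighbourhood on which both range and source are injective. -/
theorem exists_bisection (g : G) :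
    ∃ V : Set G, IsOpen V ∧ g ∈ V ∧ InjOn (range : G → G) V ∧ InjOn (source : G → G) V := by
  have key : ∀ g : G, ∃ V : Set G, IsOpen V ∧ g ∈ V ∧ InjOn (range : G → G) V := fun g => by
    obtain ⟨e, he, hee⟩ := isLocalHomeomorph_range (G := G) g
    refine ⟨e.source, e.open_source, he, fun a ha b hb hab => e.injOn ha hb ?_⟩
    rw [← hee]
    exact Subtype.ext hab
  obtain ⟨V, hV, hgV, hVi⟩ := key g
  obtain ⟨W, hW, hgW, hWi⟩ := key (inv g)
  refine ⟨V ∩ inv ⁻¹' W, hV.inter (hW.preimage continuous_inv), ⟨hgV, hgW⟩,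
    hVi.mono inter_subset_left, fun a ha b hb hab => ?_⟩
  have := hWi ha.2 hb.2 (by rw [range_inv, range_inv, hab])
  rw [← inv_inv a, this, inv_inv]

/-- A compact set is covered by finitely many bisections. -/
theorem exists_cover {K : Set G} (hK : IsCompact K) :
    ∃ (n : ℕ) (V : Fin n → Set G), (∀ i, IsOpen (V i)) ∧ (∀ i, InjOn (range : G → G) (V i)) ∧
      (∀ i, InjOn (source : G → G) (V i)) ∧ K ⊆ ⋃ i, V i := by
  choose V hV hgV hr hs using exists_bisection (G := G)
  obtain ⟨t, ht⟩ := hK.elim_finite_subcover V hV (fun g _ => mem_iUnion.2 ⟨g, hgV g⟩)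
  refine ⟨t.card, fun i => V (t.equivFin.symm i), fun i => hV _, fun i => hr _, fun i => hs _, ?_⟩
  intro g hg
  obtain ⟨j, hj, hgj⟩ := mem_iUnion₂.1 (ht hg)
  exact mem_iUnion.2 ⟨t.equivFin ⟨j, hj⟩, by simpa using hgj⟩

theorem exists_colouring {K : Set G} (hK : IsCompact K) :
    ∃ (n : ℕ) (c : G → Fin (n + 1)), ∀ g ∈ K, ∀ h ∈ K, c g = c h →
      (range g = range h → g = h) ∧ (source g = source h → g = h) := by
  obtain ⟨n, V, -, hr, hs, hc⟩ := exists_cover hK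
  have : ∀ g : G, ∃ i : Fin (n + 1), g ∈ K → ∃ hi : (i : ℕ) < n, g ∈ V ⟨i, hi⟩ := fun g => by
    by_cases hg : g ∈ K
    · obtain ⟨i, hi⟩ := mem_iUnion.1 (hc hg)
      exact ⟨i.castSucc, fun _ => ⟨i.2, hi⟩⟩
    · exact ⟨0, fun h => absurd h hg⟩
  choose c hcc using this
  refine ⟨n, c, fun g hg h hh hgh => ?_⟩
  obtain ⟨i1, h1⟩ := hcc g hg
  obtain ⟨i2, h2⟩ := hcc h hh
  have e : (⟨c g, i1⟩ : Fin n) = ⟨c h, i2⟩ := by ext; simp [hgh]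
  rw [← e] at h2
  exact ⟨fun e => hr _ h1 h2 e, fun e => hs _ h1 h2 e⟩

end EtaleGroupoid

/-- A Schur test for matrices with uniformly finite rows and columns. -/
theorem exists_matrix_operator {ι : Type*} (K : ι → ι → ℂ) (n : ℕ) (M : ℝ) (hM0 : 0 ≤ M)
    (hM : ∀ g k, ‖K g k‖ ≤ M) (c : ι → ι → Fin n)
    (hrow : ∀ g k k', K g k ≠ 0 → K g k' ≠ 0 → c g k = c g k' → k = k')
    (hcol : ∀ g g' k, K g k ≠ 0 → K g' k ≠ 0 → c g k = c g' k → g = g') :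
    ∃ T : lp (fun _ : ι => ℂ) 2 →L[ℂ] lp (fun _ : ι => ℂ) 2,
      (∀ ξ g, (T ξ : ι → ℂ) g = ∑' k, K g k * (ξ : ι → ℂ) k) ∧ ‖T‖ ≤ n * M := by
  classical
  have hfin : ∀ g, {k | K g k ≠ 0}.Finite := fun g =>
    Set.Finite.of_finite_image (f := c g) (Set.toFinite _) fun k hk k' hk' h => hrow g k k' hk hk' h
  have htwo : (2 : ℝ≥0∞).toReal = 2 := by norm_num
  let S : ι → Finset ι := fun g => (hfin g).toFinset
  have hS : ∀ g k, k ∈ S g ↔ K g k ≠ 0 := fun g k => by simp [S]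
  have hcard : ∀ g, (S g).card ≤ n := fun g => by
    simpa using Finset.card_le_card_of_injOn (t := Finset.univ) (c g) (fun _ _ => Finset.mem_univ _)
      (fun k hk k' hk' h => hrow g k k' ((hS g k).1 hk) ((hS g k').1 hk') h)
  have hts : ∀ (ξ : ι → ℂ) g, ∑' k, K g k * ξ k = ∑ k ∈ S g, K g k * ξ k := fun ξ g =>
    tsum_eq_sum fun k hk => by
      have : K g k = 0 := by by_contra h; exact hk ((hS g k).2 h)
      rw [this, zero_mul]
  have hsummand : ∀ (ξ : ι → ℂ) g, ‖∑' k, K g k * ξ k‖ ^ 2 ≤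
      n * M ^ 2 * ∑ k ∈ S g, ‖ξ k‖ ^ 2 := fun ξ g => by
    rw [hts]
    have h1 : ‖∑ k ∈ S g, K g k * ξ k‖ ≤ ∑ k ∈ S g, M * ‖ξ k‖ :=
      (norm_sum_le _ _).trans (Finset.sum_le_sum fun k _ => by
        rw [norm_mul]; exact mul_le_mul_of_nonneg_right (hM g k) (norm_nonneg _))
    calc ‖∑ k ∈ S g, K g k * ξ k‖ ^ 2 ≤ (∑ k ∈ S g, M * ‖ξ k‖) ^ 2 := by gcongr
      _ ≤ (S g).card * ∑ k ∈ S g, (M * ‖ξ k‖) ^ 2 := sq_sum_le_card_mul_sum_sq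
      _ ≤ n * ∑ k ∈ S g, (M * ‖ξ k‖) ^ 2 := by
          gcongr
          exact hcard g
      _ = n * M ^ 2 * ∑ k ∈ S g, ‖ξ k‖ ^ 2 := by
          simp only [mul_pow, ← Finset.mul_sum, mul_assoc]
  have hsum : ∀ (ξ : lp (fun _ : ι => ℂ) 2) (s : Finset ι),
      ∑ g ∈ s, ‖∑' k, K g k * (ξ : ι → ℂ) k‖ ^ (2 : ℝ≥0∞).toReal ≤
        (n * M * ‖ξ‖) ^ (2 : ℝ≥0∞).toReal := fun ξ s => by
    rw [htwo]
    simp only [Real.rpow_two]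
    have hξ : ∀ t : Finset ι, ∑ k ∈ t, ‖(ξ : ι → ℂ) k‖ ^ 2 ≤ ‖ξ‖ ^ 2 := fun t => by
      have := lp.sum_rpow_le_norm_rpow (p := 2) (by rw [htwo]; norm_num) ξ t
      rw [htwo] at this
      simpa only [Real.rpow_two] using this
    calc ∑ g ∈ s, ‖∑' k, K g k * (ξ : ι → ℂ) k‖ ^ 2
        ≤ ∑ g ∈ s, n * M ^ 2 * ∑ k ∈ S g, ‖(ξ : ι → ℂ) k‖ ^ 2 :=
          Finset.sum_le_sum fun g _ => hsummand _ g
      _ = n * M ^ 2 * ∑ g ∈ s, ∑ k ∈ S g, ‖(ξ : ι → ℂ) k‖ ^ 2 := by rw [Finset.mul_sum]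
      _ = n * M ^ 2 * ∑ k ∈ s.biUnion S, ∑ g ∈ s.filter (fun g => k ∈ S g),
            ‖(ξ : ι → ℂ) k‖ ^ 2 := by
          congr 1
          apply Finset.sum_comm'
          intro g k
          simp only [Finset.mem_filter, Finset.mem_biUnion]
          constructor
          · rintro ⟨h1, h2⟩; exact ⟨⟨h1, h2⟩, g, h1, h2⟩
          · rintro ⟨h, -⟩; exact h
      _ ≤ n * M ^ 2 * ∑ k ∈ s.biUnion S, n * ‖(ξ : ι → ℂ) k‖ ^ 2 := by
          gcongr with k hk
          rw [Finset.sum_const, nsmul_eq_mul]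
          gcongr
          simpa using Finset.card_le_card_of_injOn (t := Finset.univ) (fun g => c g k)
            (fun _ _ => Finset.mem_univ _) (fun g hg g' hg' h => hcol g g' k
              ((hS g k).1 (Finset.mem_filter.1 hg).2) ((hS g' k).1 (Finset.mem_filter.1 hg').2) h)
      _ = n * M ^ 2 * n * ∑ k ∈ s.biUnion S, ‖(ξ : ι → ℂ) k‖ ^ 2 := by
          rw [← Finset.mul_sum]; ring
      _ ≤ n * M ^ 2 * n * ‖ξ‖ ^ 2 := by gcongr; exact hξ _
      _ = (n * M * ‖ξ‖) ^ 2 := by ring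
  let T : lp (fun _ : ι => ℂ) 2 →ₗ[ℂ] lp (fun _ : ι => ℂ) 2 :=
    { toFun := fun ξ => ⟨fun g => ∑' k, K g k * (ξ : ι → ℂ) k, memℓp_gen' (hsum ξ)⟩
      map_add' := fun ξ η => by
        ext g
        change ∑' k, K g k * ((ξ + η : lp (fun _ : ι => ℂ) 2) : ι → ℂ) k =
          ∑' k, K g k * (ξ : ι → ℂ) k + ∑' k, K g k * (η : ι → ℂ) k
        rw [hts, hts, hts, ← Finset.sum_add_distrib]
        exact Finset.sum_congr rfl fun k _ => by rw [lp.coeFn_add, Pi.add_apply, mul_add]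
      map_smul' := fun z ξ => by
        ext g
        simp only [lp.coeFn_smul, Pi.smul_apply, hts, smul_eq_mul, RingHom.id_apply,
          Finset.mul_sum]
        exact Finset.sum_congr rfl fun k _ => by ring }
  have hb : ∀ ξ, ‖T ξ‖ ≤ n * M * ‖ξ‖ := fun ξ =>
    lp.norm_le_of_forall_sum_le (by rw [htwo]; norm_num) (by positivity) (hsum ξ)
  exact ⟨T.mkContinuous _ hb, fun ξ g => rfl, T.mkContinuous_norm_le (by positivity) _⟩

namespace EtaleGroupoid

/-! ### The convolution algebra `C_c(G)` -/

section Convolution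

variable {G : Type*} [TopologicalSpace G] [EtaleGroupoid G]

/-- For `g ∈ G` the map `k ↦ g k⁻¹` is a bijection from `G_{s(g)}` onto `G^{r(g)}`, with inverse
`h ↦ h⁻¹ g`. -/
def fiberEquiv (x : G) (g : {g : G // source g = x}) :
    {k : G // source k = x} ≃ {h : G // range h = range (g : G)} where
  toFun k := ⟨mul g (inv k), range_mul _ _ (by rw [range_inv, g.2, k.2])⟩
  invFun h := ⟨mul (inv h) g, by rw [source_mul _ _ ((source_inv _).trans h.2), g.2]⟩
  left_inv k := by
    ext
    simp only
    rw [mul_inv_rev (by rw [range_inv, g.2, k.2]), inv_inv,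
      inv_mul_cancel_right (by rw [g.2, k.2])]
  right_inv h := by
    ext
    simp only
    rw [mul_inv_rev ((source_inv _).trans h.2), inv_inv, mul_inv_cancel_left h.2.symm]

theorem finite_fiber (f : C_c(G, ℂ)) (y : G) :
    {h : {h : G // range h = y} | f h ≠ 0}.Finite := by
  obtain ⟨n, c, hc⟩ := exists_colouring f.hasCompactSupport.isCompact
  refine Set.Finite.of_finite_image (f := fun h => c (h : G)) (Set.toFinite _) ?_
  intro h hh h' hh' e
  exact Subtype.ext ((hc h (subset_tsupport _ hh) h' (subset_tsupport _ hh') e).1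
    (h.2.trans h'.2.symm))

/-- The convolution of two functions on the groupoid,
`(f₁ * f₂)(g) = ∑_{h ∈ G^{r(g)}} f₁(h) f₂(h⁻¹ g)`. -/
noncomputable def convFun (f₁ f₂ : G → ℂ) (g : G) : ℂ :=
  ∑' h : {h : G // range h = range g}, f₁ h * f₂ (mul (inv h) g)

theorem convFun_ne_zero {f₁ f₂ : G → ℂ} {g : G} (h : convFun f₁ f₂ g ≠ 0) :
    ∃ h : G, range h = range g ∧ f₁ h ≠ 0 ∧ f₂ (mul (inv h) g) ≠ 0 := by
  by_contra hcon
  push Not at hcon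
  apply h
  unfold convFun
  convert! tsum_zero with k
  by_cases hk : f₁ k = 0
  · rw [hk, zero_mul]
  · rw [hcon k k.2 hk, mul_zero]

theorem hasCompactSupport_convFun [T2Space G] (f₁ f₂ : C_c(G, ℂ)) :
    HasCompactSupport (convFun f₁ f₂) := by
  have hcl : IsClosed {p : G × G | source p.1 = range p.2} :=
    isClosed_eq (continuous_source.comp continuous_fst) (continuous_range.comp continuous_snd)
  have hK : IsCompact ((tsupport f₁ ×ˢ tsupport f₂) ∩ {p : G × G | source p.1 = range p.2}) :=
    (f₁.hasCompactSupport.isCompact.prod f₂.hasCompactSupport.isCompact).inter_right hcl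
  refine HasCompactSupport.intro
    (hK.image_of_continuousOn (continuousOn_mul.mono inter_subset_right)) fun g hg => ?_
  by_contra hne
  obtain ⟨h, hr, h1, h2⟩ := convFun_ne_zero hne
  refine hg ⟨(h, mul (inv h) g), ⟨⟨subset_tsupport _ h1, subset_tsupport _ h2⟩, ?_⟩, ?_⟩
  · change source h = range (mul (inv h) g)
    rw [range_mul _ _ ((source_inv _).trans hr), range_inv]
  · exact mul_inv_cancel_left hr

theorem continuous_convFun_of_injOn [T2Space G] (f₁ f₂ : C_c(G, ℂ)) {V : Set G} (hV : IsOpen V)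
    (hr : InjOn (range : G → G) V) (hf : tsupport f₁ ⊆ V) : Continuous (convFun f₁ f₂) := by
  rw [continuous_iff_continuousAt]
  intro g₀
  by_cases h0 : range g₀ ∈ (range : G → G) '' tsupport f₁
  · obtain ⟨h₀, hh₀, e₀⟩ := h0
    obtain ⟨e, he, hee⟩ := isLocalHomeomorph_range (G := G) h₀
    let ρ : G → {x : G // range x = x} := fun g => ⟨range g, range_range g⟩
    have hρ : Continuous ρ := isLocalHomeomorph_range.continuous
    have hee' : ∀ g, e g = ρ g := fun g => (congrFun hee g).symm
    have hρ0 : ρ g₀ = e h₀ := by rw [hee']; exact Subtype.ext e₀.symm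
    let τ : G → G := fun g => e.symm (ρ g)
    have hτ0 : τ g₀ = h₀ := by simp only [τ]; rw [hρ0]; exact e.left_inv he
    have htgt : ρ g₀ ∈ e.target := hρ0 ▸ e.map_source he
    have hτc : ContinuousAt τ g₀ :=
      ContinuousAt.comp (e.symm.continuousAt htgt) hρ.continuousAt
    have ev1 : ∀ᶠ g in 𝓝 g₀, τ g ∈ V :=
      hτc.eventually (hV.mem_nhds (by rw [hτ0]; exact hf hh₀))
    have ev2 : ∀ᶠ g in 𝓝 g₀, range (τ g) = range g := by
      filter_upwards [hρ.continuousAt.eventually (e.open_target.mem_nhds htgt)] with g hg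
      have h1 := e.right_inv hg
      rw [hee'] at h1
      exact congrArg Subtype.val h1
    have hev : (fun g => f₁ (τ g) * f₂ (mul (inv (τ g)) g)) =ᶠ[𝓝 g₀] convFun f₁ f₂ := by
      filter_upwards [ev1, ev2] with g h1 h2
      symm
      unfold convFun
      rw [tsum_eq_single (⟨τ g, h2⟩ : {h : G // range h = range g})]
      intro h hne
      by_cases hh : f₁ h = 0
      · rw [hh, zero_mul]
      · exact absurd (Subtype.ext (hr (hf (subset_tsupport _ hh)) h1 (h.2.trans h2.symm))) hne
    refine ContinuousAt.congr ?_ hev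
    have hpair : Tendsto (fun g => (inv (τ g), g)) (𝓝 g₀)
        (𝓝[{p : G × G | source p.1 = range p.2}] (inv (τ g₀), g₀)) := by
      refine tendsto_nhdsWithin_iff.2 ⟨?_, ?_⟩
      · exact (continuous_inv.continuousAt.comp hτc).prodMk continuousAt_id
      · filter_upwards [ev2] with g hg
        exact (source_inv _).trans hg
    have hm : ContinuousAt (fun g => mul (inv (τ g)) g) g₀ :=
      (continuousOn_mul (inv (τ g₀), g₀)
        ((source_inv _).trans (by rw [hτ0, e₀]))).tendsto.comp hpair
    exact (f₁.continuous.continuousAt.comp hτc).mul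
      (ContinuousAt.comp (f := fun g => mul (inv (τ g)) g) f₂.continuous.continuousAt hm)
  · have hcl : IsClosed ((range : G → G) '' tsupport f₁) :=
      (f₁.hasCompactSupport.isCompact.image continuous_range).isClosed
    have hev : (fun _ => (0 : ℂ)) =ᶠ[𝓝 g₀] convFun f₁ f₂ := by
      filter_upwards [(hcl.isOpen_compl.preimage continuous_range).mem_nhds h0] with g hg
      by_contra hne
      obtain ⟨h, h1, h2, -⟩ := convFun_ne_zero (Ne.symm hne)
      exact hg ⟨h, subset_tsupport _ h2, h1⟩
    exact continuousAt_const.congr hev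

theorem continuous_convFun [T2Space G] [LocallyCompactSpace G] (f₁ f₂ : C_c(G, ℂ)) :
    Continuous (convFun f₁ f₂) := by
  obtain ⟨n, V, hV, hr, -, hc⟩ := exists_cover (G := G) f₁.hasCompactSupport.isCompact
  obtain ⟨p, hp, hp1, -, hpc⟩ :=
    exists_continuous_sum_one_of_isOpen_isCompact hV f₁.hasCompactSupport.isCompact hc
  let q : Fin n → C_c(G, ℂ) := fun i =>
    ⟨⟨fun g => (p i g : ℂ) * f₁ g,
      (Complex.continuous_ofReal.comp (p i).continuous).mul f₁.continuous⟩,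
      f₁.hasCompactSupport.mul_left⟩
  have hq : ∀ i, tsupport (q i) ⊆ V i := fun i => by
    refine subset_trans (closure_mono fun g hg => ?_) (hp i)
    intro h
    apply hg
    change ((p i g : ℝ) : ℂ) * f₁ g = 0
    rw [h, Complex.ofReal_zero, zero_mul]
  have hsum : ∀ g, f₁ g = ∑ i, q i g := fun g => by
    change f₁ g = ∑ i, (p i g : ℂ) * f₁ g
    by_cases hg : f₁ g = 0
    · simp [hg]
    · have := hp1 (subset_tsupport _ hg)
      simp only [Finset.sum_apply, Pi.one_apply] at this
      rw [← Finset.sum_mul, ← Complex.ofReal_sum, this, Complex.ofReal_one, one_mul]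
  have hconv : convFun f₁ f₂ = fun g => ∑ i, convFun (q i) f₂ g := by
    ext g
    unfold convFun
    rw [← Summable.tsum_finsetSum]
    · exact tsum_congr fun h => by rw [hsum, Finset.sum_mul]
    · intro i _
      refine summable_of_hasFiniteSupport ((finite_fiber (q i) (range g)).subset fun h hh => ?_)
      exact left_ne_zero_of_mul hh
  rw [hconv]
  exact continuous_finsetSum _ fun i _ => continuous_convFun_of_injOn _ _ (hV i) (hr i) (hq i)

/-- The convolution product on `C_c(G)`. -/
noncomputable def conv [T2Space G] [LocallyCompactSpace G] (f₁ f₂ : C_c(G, ℂ)) : C_c(G, ℂ) :=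
  ⟨⟨convFun f₁ f₂, continuous_convFun f₁ f₂⟩, hasCompactSupport_convFun f₁ f₂⟩

/-- The inversion of the groupoid as a homeomorphism. -/
def invHomeomorph : G ≃ₜ G where
  toFun := inv
  invFun := inv
  left_inv := inv_inv
  right_inv := inv_inv
  continuous_toFun := continuous_inv
  continuous_invFun := continuous_inv

/-- The involution on `C_c(G)`: the function `g ↦ conj (f(g⁻¹))`. -/
noncomputable def invol (f : C_c(G, ℂ)) : C_c(G, ℂ) :=
  ⟨⟨fun g => star (f (inv g)), continuous_star.comp (f.continuous.comp continuous_inv)⟩,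
    (f.hasCompactSupport.comp_homeomorph (invHomeomorph (G := G))).comp_left (star_zero ℂ)⟩

/-- The function `g ↦ e^{itc(g)} f(g)`. -/
noncomputable def RealHom.twist (c : RealHom G) (t : ℝ) (f : C_c(G, ℂ)) : C_c(G, ℂ) :=
  ⟨⟨fun g => Complex.exp (Complex.I * t * c g) * f g,
    (Complex.continuous_exp.comp (continuous_const.mul
      (Complex.continuous_ofReal.comp c.continuous'))).mul f.continuous⟩,
    f.hasCompactSupport.mul_left⟩

end Convolution

/-! ### The reduced groupoid C*-algebra -/

section Reduced

variable {G : Type*} [TopologicalSpace G] [EtaleGroupoid G]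

/-- The Hilbert space `ℓ²(G_x)`, where `G_x` is the set of arrows with source `x`. -/
abbrev FiberHilbert (x : unitSpace G) : Type _ :=
  lp (fun _ : {g : G // source g = (x : G)} => ℂ) 2

theorem exists_fiberRep {K : Set G} (hK : IsCompact K) :
    ∃ n : ℕ, ∀ (f : C_c(G, ℂ)), (∀ g, f g ≠ 0 → g ∈ K) → ∀ M : ℝ, (∀ g, ‖f g‖ ≤ M) →
      ∀ x : unitSpace G, ∃ T : FiberHilbert x →L[ℂ] FiberHilbert x,
        (∀ (ξ : FiberHilbert x) (g : {g : G // source g = (x : G)}),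
          T ξ g = ∑' h : {h : G // range h = range (g : G)}, f h *
            ξ ⟨mul (inv h) g, by rw [source_mul _ _ ((source_inv _).trans h.2), g.2]⟩) ∧
        ‖T‖ ≤ n * M := by
  obtain ⟨n, c, hc⟩ := exists_colouring (G := G) hK
  refine ⟨n + 1, fun f hfK M hM x => ?_⟩
  have hM0 : 0 ≤ M := (norm_nonneg _).trans (hM x)
  obtain ⟨T, hT, hTn⟩ := exists_matrix_operator
    (ι := {g : G // source g = (x : G)}) (fun g k => f (mul g (inv k))) (n + 1) M hM0
    (fun g k => hM _) (fun g k => c (mul g (inv k)))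
    (fun g k k' h1 h2 e => by
      have e1 : source (g : G) = range (inv (k : G)) := by rw [range_inv, g.2, k.2]
      have e2 : source (g : G) = range (inv (k' : G)) := by rw [range_inv, g.2, k'.2]
      have := (hc _ (hfK _ h1) _ (hfK _ h2) e).1 (by rw [range_mul _ _ e1, range_mul _ _ e2])
      exact (fiberEquiv (x : G) g).injective (Subtype.ext this))
    (fun g g' k h1 h2 e => by
      have e1 : source (g : G) = range (inv (k : G)) := by rw [range_inv, g.2, k.2]
      have e2 : source (g' : G) = range (inv (k : G)) := by rw [range_inv, g'.2, k.2]
      have := (hc _ (hfK _ h1) _ (hfK _ h2) e).2 (by rw [source_mul _ _ e1, source_mul _ _ e2])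
      have h3 := congrArg (fun z => mul z (k : G)) this
      rw [inv_mul_cancel_right (by rw [g.2, k.2]), inv_mul_cancel_right (by rw [g'.2, k.2])] at h3
      exact Subtype.ext h3)
  refine ⟨T, fun ξ g => ?_, hTn⟩
  rw [hT, ← (fiberEquiv (x : G) g).symm.tsum_eq]
  refine tsum_congr fun h => ?_
  congr 2
  exact congrArg Subtype.val ((fiberEquiv (x : G) g).apply_symm_apply h)

theorem exists_norm_bound {G : Type*} [TopologicalSpace G] (f : C_c(G, ℂ)) : ∃ M : ℝ, ∀ g, ‖f g‖ ≤ M :=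
  f.hasCompactSupport.exists_bound_of_continuous f.continuous

theorem exists_fiberRep' (f : C_c(G, ℂ)) (x : unitSpace G) :
    ∃ T : FiberHilbert x →L[ℂ] FiberHilbert x,
        ∀ (ξ : FiberHilbert x) (g : {g : G // source g = (x : G)}),
          T ξ g = ∑' h : {h : G // range h = range (g : G)}, f h *
            ξ ⟨mul (inv h) g, by rw [source_mul _ _ ((source_inv _).trans h.2), g.2]⟩ := by
  obtain ⟨n, hn⟩ := exists_fiberRep (G := G) f.hasCompactSupport.isCompact
  obtain ⟨M, hM⟩ := exists_norm_bound f
  obtain ⟨T, hT, -⟩ := hn f (fun g hg => subset_tsupport _ hg) M hM x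
  exact ⟨T, hT⟩

/-- The operator `π_x(f)` on `ℓ²(G_x)`, determined by `fiberRep_apply` below. -/
noncomputable def fiberRep (x : unitSpace G) (f : C_c(G, ℂ)) :
    FiberHilbert x →L[ℂ] FiberHilbert x := (exists_fiberRep' f x).choose

/-- `(π_x(f) ξ)(g) = ∑_{h ∈ G^{r(g)}} f(h) ξ(h⁻¹ g)`. -/
theorem fiberRep_apply (x : unitSpace G) (f : C_c(G, ℂ)) (ξ : FiberHilbert x)
    (g : {g : G // source g = (x : G)}) :
    fiberRep x f ξ g = ∑' h : {h : G // range h = range (g : G)}, f h *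
      ξ ⟨mul (inv h) g, by rw [source_mul _ _ ((source_inv _).trans h.2), g.2]⟩ :=
  (exists_fiberRep' f x).choose_spec ξ g

theorem norm_fiberRep_le {K : Set G} (hK : IsCompact K) :
    ∃ n : ℕ, ∀ (f : C_c(G, ℂ)), (∀ g, f g ≠ 0 → g ∈ K) → ∀ M : ℝ, (∀ g, ‖f g‖ ≤ M) →
      ∀ x : unitSpace G, ‖fiberRep x f‖ ≤ n * M := by
  obtain ⟨n, hn⟩ := exists_fiberRep (G := G) hK
  refine ⟨n, fun f hf M hM x => ?_⟩
  obtain ⟨T, hT, hTn⟩ := hn f hf M hM x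
  have : fiberRep x f = T := by
    ext ξ g
    rw [fiberRep_apply, hT]
  rwa [this]

/-- `(π_x(f) ξ)(g) = ∑_{k ∈ G_x} f(g k⁻¹) ξ(k)`. -/
theorem fiberRep_apply' (x : unitSpace G) (f : C_c(G, ℂ)) (ξ : FiberHilbert x)
    (g : {g : G // source g = (x : G)}) :
    fiberRep x f ξ g = ∑' k : {g : G // source g = (x : G)}, f (mul g (inv k)) * ξ k := by
  rw [fiberRep_apply, ← (fiberEquiv (x : G) g).tsum_eq]
  refine tsum_congr fun k => ?_
  have : (⟨_, by rw [source_mul _ _ ((source_inv _).trans (fiberEquiv (x : G) g k).2), g.2]⟩ :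
      {g : G // source g = (x : G)}) = k := (fiberEquiv (x : G) g).symm_apply_apply k
  rw [this]
  rfl

theorem finite_row (x : G) (f : C_c(G, ℂ)) (g : {g : G // source g = x}) :
    {k : {g : G // source g = x} | f (mul g (inv k)) ≠ 0}.Finite :=
  ((finite_fiber f (range (g : G))).preimage (fiberEquiv x g).injective.injOn)

/-- The C*-algebra of bounded families `(T_x)` of operators `T_x` on `ℓ²(G_x)`, with norm
`sup_x ‖T_x‖` and with the entrywise operations. -/
def FiberOperators (G : Type*) [TopologicalSpace G] [EtaleGroupoid G] : Type _ :=
  lp (fun x : unitSpace G => FiberHilbert x →L[ℂ] FiberHilbert x) ∞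

noncomputable instance : NonUnitalCStarAlgebra (FiberOperators G) :=
  inferInstanceAs (NonUnitalCStarAlgebra
    (lp (fun x : unitSpace G => FiberHilbert x →L[ℂ] FiberHilbert x) ∞))

/-- The entry `T_x` of a family. -/
def FiberOperators.entry (a : FiberOperators G) (x : unitSpace G) :
    FiberHilbert x →L[ℂ] FiberHilbert x := a.1 x

namespace FiberOperators

@[ext] theorem ext {a b : FiberOperators G} (h : ∀ x, a.entry x = b.entry x) : a = b :=
  lp.ext (funext h)

theorem entry_add (a b : FiberOperators G) (x) : (a + b).entry x = a.entry x + b.entry x := rfl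

theorem entry_sub (a b : FiberOperators G) (x) : (a - b).entry x = a.entry x - b.entry x := rfl

theorem entry_smul (z : ℂ) (a : FiberOperators G) (x) : (z • a).entry x = z • a.entry x := rfl

theorem entry_mul (a b : FiberOperators G) (x) : (a * b).entry x = a.entry x * b.entry x := rfl

theorem entry_star (a : FiberOperators G) (x) : (star a).entry x = star (a.entry x) := rfl

theorem norm_eq (a : FiberOperators G) : ‖a‖ = ⨆ x, ‖a.entry x‖ := lp.norm_eq_ciSup _

theorem norm_entry_le (a : FiberOperators G) (x) : ‖a.entry x‖ ≤ ‖a‖ :=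
  lp.norm_apply_le_norm (by simp) _ x

theorem norm_le (a : FiberOperators G) {C : ℝ} (hC : 0 ≤ C) (h : ∀ x, ‖a.entry x‖ ≤ C) :
    ‖a‖ ≤ C := lp.norm_le_of_forall_le hC h

end FiberOperators

theorem memℓp_fiberRep (f : C_c(G, ℂ)) :
    Memℓp (E := fun x : unitSpace G => FiberHilbert x →L[ℂ] FiberHilbert x)
      (fun x : unitSpace G => fiberRep x f) ∞ := by
  obtain ⟨n, hn⟩ := norm_fiberRep_le (G := G) f.hasCompactSupport.isCompact
  obtain ⟨M, hM⟩ := exists_norm_bound f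
  refine memℓp_infty ⟨n * M, ?_⟩
  rintro _ ⟨x, rfl⟩
  exact hn f (fun g hg => subset_tsupport _ hg) M hM x

/-- The family `(π_x(f))_x`. Its norm is the reduced norm `‖f‖_r = sup_x ‖π_x(f)‖`. -/
noncomputable def regRep (f : C_c(G, ℂ)) : FiberOperators G := ⟨fun x => fiberRep x f,
  memℓp_fiberRep f⟩

theorem norm_regRep (f : C_c(G, ℂ)) : ‖regRep f‖ = ⨆ x : unitSpace G, ‖fiberRep x f‖ :=
  FiberOperators.norm_eq _

theorem norm_regRep_le {K : Set G} (hK : IsCompact K) :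
    ∃ n : ℕ, ∀ (f : C_c(G, ℂ)), (∀ g, f g ≠ 0 → g ∈ K) → ∀ M : ℝ, 0 ≤ M → (∀ g, ‖f g‖ ≤ M) →
      ‖regRep f‖ ≤ n * M := by
  obtain ⟨n, hn⟩ := norm_fiberRep_le (G := G) hK
  exact ⟨n, fun f hf M hM0 hM => FiberOperators.norm_le _ (by positivity)
    fun x => hn f hf M hM x⟩

theorem regRep_add (f₁ f₂ : C_c(G, ℂ)) : regRep (f₁ + f₂) = regRep f₁ + regRep f₂ := by
  refine FiberOperators.ext fun x => ?_
  ext ξ g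
  change fiberRep x (f₁ + f₂) ξ g = fiberRep x f₁ ξ g + fiberRep x f₂ ξ g
  rw [fiberRep_apply', fiberRep_apply', fiberRep_apply', ← Summable.tsum_add]
  · exact tsum_congr fun k => by simp [add_mul]
  · exact summable_of_hasFiniteSupport ((finite_row _ f₁ g).subset
      fun h hh => left_ne_zero_of_mul hh)
  · exact summable_of_hasFiniteSupport ((finite_row _ f₂ g).subset
      fun h hh => left_ne_zero_of_mul hh)

theorem regRep_smul (z : ℂ) (f : C_c(G, ℂ)) : regRep (z • f) = z • regRep f := by
  refine FiberOperators.ext fun x => ?_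
  ext ξ g
  change fiberRep x (z • f) ξ g = z * fiberRep x f ξ g
  rw [fiberRep_apply', fiberRep_apply', ← tsum_mul_left]
  exact tsum_congr fun k => by simp [_root_.mul_assoc]

theorem regRep_conv [T2Space G] [LocallyCompactSpace G] (f₁ f₂ : C_c(G, ℂ)) :
    regRep (conv f₁ f₂) = regRep f₁ * regRep f₂ := by
  refine FiberOperators.ext fun x => ?_
  ext ξ g
  change fiberRep x (conv f₁ f₂) ξ g = fiberRep x f₁ (fiberRep x f₂ ξ) g
  let S := (finite_row (x : G) f₁ g).toFinset
  have hS : ∀ j, j ∉ S → f₁ (mul g (inv j)) = 0 := fun j hj => by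
    by_contra h; exact hj ((Set.Finite.mem_toFinset _).2 h)
  have kernel : ∀ k : {g : G // source g = (x : G)}, conv f₁ f₂ (mul g (inv k)) =
      ∑ j ∈ S, f₁ (mul g (inv j)) * f₂ (mul j (inv k)) := fun k => by
    have e1 : source (g : G) = range (inv (k : G)) := by rw [range_inv, g.2, k.2]
    have e2 : range (mul (g : G) (inv k)) = range (g : G) := range_mul _ _ e1
    change ∑' h : {h : G // range h = range (mul (g : G) (inv k))},
      f₁ h * f₂ (mul (inv h) (mul g (inv k))) = _
    rw [e2, ← (fiberEquiv (x : G) g).tsum_eq, tsum_eq_sum (s := S)]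
    · refine Finset.sum_congr rfl fun j _ => ?_
      change f₁ (mul g (inv j)) * f₂ (mul (inv (mul g (inv j))) (mul g (inv k))) = _
      have e3 : source (g : G) = range (inv (j : G)) := by rw [range_inv, g.2, j.2]
      rw [← mul_assoc _ _ _ (by rw [source_inv, range_mul _ _ e3]) e1, mul_inv_rev e3, inv_inv,
        inv_mul_cancel_right (by rw [g.2, j.2])]
    · intro j hj
      change f₁ (mul g (inv j)) * _ = 0
      rw [hS j hj, zero_mul]
  have hsplit := tsum_eq_sum (L := SummationFilter.unconditional _)
    (f := fun j : {g : G // source g = (x : G)} => f₁ (mul g (inv j)) * fiberRep x f₂ ξ j) (s := S)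
    (fun j hj => by rw [hS j hj, zero_mul])
  rw [fiberRep_apply', fiberRep_apply', hsplit]
  simp_rw [kernel, fiberRep_apply', Finset.sum_mul, ← tsum_mul_left]
  rw [Summable.tsum_finsetSum]
  · exact Finset.sum_congr rfl fun j _ => tsum_congr fun k => by ring
  · intro j _
    refine summable_of_hasFiniteSupport ((finite_row _ f₂ j).subset fun k hk => ?_)
    exact right_ne_zero_of_mul (left_ne_zero_of_mul hk)

/-- The coefficients of an adjoint operator on `ℓ²`. -/
theorem adjoint_apply_eq {ι : Type*} [DecidableEq ι] (T : lp (fun _ : ι => ℂ) 2 →L[ℂ]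
    lp (fun _ : ι => ℂ) 2) (ξ : lp (fun _ : ι => ℂ) 2) (g : ι) :
    (star T ξ) g = ∑' k, star (T (lp.single 2 g 1) k) * ξ k := by
  have h1 : (star T ξ) g = inner ℂ (lp.single 2 g (1 : ℂ)) (star T ξ) := by
    rw [lp.inner_single_left]; simp
  rw [h1, ContinuousLinearMap.star_eq_adjoint, ContinuousLinearMap.adjoint_inner_right,
    lp.inner_eq_tsum]
  exact tsum_congr fun k => by rw [RCLike.inner_apply', Complex.star_def]

theorem regRep_invol (f : C_c(G, ℂ)) : regRep (invol f) = star (regRep f) := by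
  classical
  refine FiberOperators.ext fun x => ?_
  ext ξ g
  change fiberRep x (invol f) ξ g = star (fiberRep x f) ξ g
  rw [adjoint_apply_eq, fiberRep_apply']
  refine tsum_congr fun k => ?_
  congr 1
  rw [fiberRep_apply', tsum_eq_single g]
  · change star (f (inv (mul g (inv k)))) = _
    rw [mul_inv_rev (by rw [range_inv, g.2, k.2]), inv_inv]
    simp
  · intro j hj
    simp [hj]

/-! The unitaries that implement `σ^c`. -/

/-- Multiplication by `e^{itc(g)}` on `ℓ²(G_x)`. -/
theorem exists_fiberUnitary (c : RealHom G) (t : ℝ) (x : unitSpace G) :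
    ∃ T : FiberHilbert x →L[ℂ] FiberHilbert x,
      (∀ ξ g, T ξ g = Complex.exp (Complex.I * t * c g) * ξ g) ∧ ‖T‖ ≤ 1 := by
  classical
  have hn : ∀ s : ℝ, ‖Complex.exp (Complex.I * t * s)‖ = 1 := fun s => by
    have : Complex.I * t * s = ((t * s : ℝ) : ℂ) * Complex.I := by push_cast; ring
    rw [this, Complex.norm_exp_ofReal_mul_I]
  obtain ⟨T, hT, hTn⟩ := exists_matrix_operator (ι := {g : G // source g = (x : G)})
    (fun g k => if g = k then Complex.exp (Complex.I * t * c g) else 0) 1 1 zero_le_one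
    (fun g k => by
      split_ifs
      · exact (hn _).le
      · simp)
    (fun _ _ => 0)
    (fun g k k' h1 h2 _ => by
      simp only [ne_eq, ite_eq_right_iff, not_forall] at h1 h2
      exact h1.1.symm.trans h2.1)
    (fun g g' k h1 h2 _ => by
      simp only [ne_eq, ite_eq_right_iff, not_forall] at h1 h2
      exact h1.1.trans h2.1.symm)
  refine ⟨T, fun ξ g => ?_, by simpa using hTn⟩
  rw [hT, tsum_eq_single g]
  · simp
  · intro k hk
    simp [hk.symm]

/-- The unitary `u_t` on `ℓ²(G_x)`, `(u_t ξ)(g) = e^{itc(g)} ξ(g)`. -/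
noncomputable def fiberUnitary (c : RealHom G) (t : ℝ) (x : unitSpace G) :
    FiberHilbert x →L[ℂ] FiberHilbert x := (exists_fiberUnitary c t x).choose

theorem fiberUnitary_apply (c : RealHom G) (t : ℝ) (x : unitSpace G) (ξ : FiberHilbert x)
    (g : {g : G // source g = (x : G)}) :
    fiberUnitary c t x ξ g = Complex.exp (Complex.I * t * c g) * ξ g :=
  (exists_fiberUnitary c t x).choose_spec.1 ξ g

/-- The family of unitaries `(u_t)_x`. -/
noncomputable def unitaryFamily (c : RealHom G) (t : ℝ) : FiberOperators G :=
  ⟨fun x => fiberUnitary c t x, memℓp_infty ⟨1, by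
    rintro _ ⟨x, rfl⟩
    exact (exists_fiberUnitary c t x).choose_spec.2⟩⟩

theorem unitaryFamily_add (c : RealHom G) (s t : ℝ) :
    unitaryFamily c (s + t) = unitaryFamily c s * unitaryFamily c t := by
  refine FiberOperators.ext fun x => ?_
  ext ξ g
  change fiberUnitary c (s + t) x ξ g = fiberUnitary c s x (fiberUnitary c t x ξ) g
  rw [fiberUnitary_apply, fiberUnitary_apply, fiberUnitary_apply, ← _root_.mul_assoc,
    ← Complex.exp_add]
  congr 2
  push_cast
  ring

theorem unitaryFamily_zero_mul (c : RealHom G) (a : FiberOperators G) :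
    unitaryFamily c 0 * a = a := by
  refine FiberOperators.ext fun x => ?_
  ext ξ g
  change fiberUnitary c 0 x (a.entry x ξ) g = a.entry x ξ g
  simp [fiberUnitary_apply]

theorem mul_unitaryFamily_zero (c : RealHom G) (a : FiberOperators G) :
    a * unitaryFamily c 0 = a := by
  refine FiberOperators.ext fun x => ?_
  ext ξ g
  change a.entry x (fiberUnitary c 0 x ξ) g = a.entry x ξ g
  have : fiberUnitary c 0 x ξ = ξ := by
    ext g
    simp [fiberUnitary_apply]
  rw [this]

theorem star_unitaryFamily (c : RealHom G) (t : ℝ) :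
    star (unitaryFamily c t) = unitaryFamily c (-t) := by
  classical
  refine FiberOperators.ext fun x => ?_
  ext ξ g
  change star (fiberUnitary c t x) ξ g = fiberUnitary c (-t) x ξ g
  rw [adjoint_apply_eq, tsum_eq_single g]
  · rw [fiberUnitary_apply, fiberUnitary_apply]
    simp [← Complex.exp_conj]
  · intro k hk
    rw [fiberUnitary_apply]
    simp [hk]

/-- `u_t π_x(f) u_t⋆ = π_x(σ^c_t(f))`. -/
theorem unitaryFamily_conj_regRep (c : RealHom G) (t : ℝ) (f : C_c(G, ℂ)) :
    unitaryFamily c t * regRep f * star (unitaryFamily c t) = regRep (c.twist t f) := by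
  rw [star_unitaryFamily]
  refine FiberOperators.ext fun x => ?_
  ext ξ g
  change fiberUnitary c t x (fiberRep x f (fiberUnitary c (-t) x ξ)) g =
    fiberRep x (c.twist t f) ξ g
  rw [fiberUnitary_apply, fiberRep_apply, fiberRep_apply, ← tsum_mul_left]
  refine tsum_congr fun h => ?_
  rw [fiberUnitary_apply]
  have e : source (h : G) = range (mul (inv (h : G)) g) := by
    rw [range_mul _ _ ((source_inv _).trans h.2), range_inv]
  have hc : c (g : G) = c h + c (mul (inv (h : G)) g) := by
    rw [← c.map_mul' _ _ e, mul_inv_cancel_left h.2]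
  change Complex.exp (Complex.I * t * c g) * (f h *
    (Complex.exp (Complex.I * ((-t : ℝ) : ℂ) * c (mul (inv (h : G)) g)) * _)) =
    Complex.exp (Complex.I * t * c h) * f h * _
  have : Complex.exp (Complex.I * t * c h) = Complex.exp (Complex.I * t * c g) *
      Complex.exp (Complex.I * ((-t : ℝ) : ℂ) * c (mul (inv (h : G)) g)) := by
    rw [← Complex.exp_add, hc]
    congr 1
    push_cast
    ring
  rw [this]
  ring

theorem isClosed_unitSpace [T2Space G] : IsClosed (unitSpace G) :=
  isClosed_eq continuous_range continuous_id

variable [T2Space G] [LocallyCompactSpace G]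

/-! ### The reduced C*-algebra as a norm closure -/

/-- The *-algebra `C_c(G)`, with convolution and the involution, in its faithful representation
`f ↦ (π_x(f))_x`. -/
noncomputable def ccSubalgebra (G : Type*) [TopologicalSpace G] [EtaleGroupoid G] [T2Space G]
    [LocallyCompactSpace G] : NonUnitalStarSubalgebra ℂ (FiberOperators G) where
  carrier := Set.range (regRep (G := G))
  add_mem' := by
    rintro _ _ ⟨f₁, rfl⟩ ⟨f₂, rfl⟩
    exact ⟨f₁ + f₂, regRep_add _ _⟩
  zero_mem' := ⟨0, by
    have := regRep_smul (0 : ℂ) (0 : C_c(G, ℂ))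
    rwa [zero_smul, zero_smul] at this⟩
  mul_mem' := by
    rintro _ _ ⟨f₁, rfl⟩ ⟨f₂, rfl⟩
    exact ⟨conv f₁ f₂, regRep_conv _ _⟩
  smul_mem' := by
    rintro z _ ⟨f, rfl⟩
    exact ⟨z • f, regRep_smul _ _⟩
  star_mem' := by
    rintro _ ⟨f, rfl⟩
    exact ⟨invol f, regRep_invol _⟩

/-- The reduced groupoid C*-algebra `C*_r(G)`: the completion of `C_c(G)` in the norm
`‖f‖_r = sup_x ‖π_x(f)‖`, realised as a norm closure. -/
def ReducedCStarAlgebra (G : Type*) [TopologicalSpace G] [EtaleGroupoid G] [T2Space G]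
    [LocallyCompactSpace G] : Type _ := (ccSubalgebra G).topologicalClosure

noncomputable instance : NonUnitalCStarAlgebra (ReducedCStarAlgebra G) :=
  NonUnitalStarSubalgebra.nonUnitalCStarAlgebra (ccSubalgebra G).topologicalClosure
    (h_closed := (ccSubalgebra G).isClosed_topologicalClosure)

/-- The usual order of a C*-algebra: `a ≤ b` when `b - a` is positive. -/
noncomputable instance : PartialOrder (ReducedCStarAlgebra G) := CStarAlgebra.spectralOrder _

instance : StarOrderedRing (ReducedCStarAlgebra G) := CStarAlgebra.spectralOrderedRing _

namespace ReducedCStarAlgebra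

/-- The inclusion of `C*_r(G)` in the bounded families of operators. -/
def incl (a : ReducedCStarAlgebra G) : FiberOperators G := Subtype.val a

theorem incl_injective : Function.Injective (incl (G := G)) := Subtype.val_injective

theorem incl_add (a b : ReducedCStarAlgebra G) : incl (a + b) = incl a + incl b := rfl

theorem incl_sub (a b : ReducedCStarAlgebra G) : incl (a - b) = incl a - incl b := rfl

theorem incl_smul (z : ℂ) (a : ReducedCStarAlgebra G) : incl (z • a) = z • incl a := rfl

theorem incl_mul (a b : ReducedCStarAlgebra G) : incl (a * b) = incl a * incl b := rfl

theorem incl_star (a : ReducedCStarAlgebra G) : incl (star a) = star (incl a) := rfl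

theorem norm_incl (a : ReducedCStarAlgebra G) : ‖incl a‖ = ‖a‖ := rfl

theorem incl_mem (a : ReducedCStarAlgebra G) :
    incl a ∈ closure (Set.range (regRep (G := G))) := a.2

/-- The canonical map `C_c(G) → C*_r(G)`. -/
noncomputable def ofCc (f : C_c(G, ℂ)) : ReducedCStarAlgebra G :=
  ⟨regRep f, subset_closure ⟨f, rfl⟩⟩

theorem incl_ofCc (f : C_c(G, ℂ)) : incl (ofCc f) = regRep f := rfl

theorem exists_approx (a : ReducedCStarAlgebra G) {ε : ℝ} (hε : 0 < ε) :
    ∃ f : C_c(G, ℂ), ‖a - ofCc f‖ < ε := by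
  obtain ⟨_, ⟨f, rfl⟩, hf⟩ := Metric.mem_closure_iff.1 (incl_mem a) ε hε
  exact ⟨f, by rwa [dist_eq_norm] at hf⟩

end ReducedCStarAlgebra

/-! ### The one-parameter group `σ^c` -/

namespace ReducedCStarAlgebra

theorem conj_mem (c : RealHom G) (t : ℝ) (a : ReducedCStarAlgebra G) :
    unitaryFamily c t * incl a * star (unitaryFamily c t) ∈
      (ccSubalgebra G).topologicalClosure := by
  have hcont : Continuous fun b : FiberOperators G =>
      unitaryFamily c t * b * star (unitaryFamily c t) := by fun_prop
  refine map_mem_closure (f := fun b : FiberOperators G =>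
    unitaryFamily c t * b * star (unitaryFamily c t)) hcont (incl_mem a) ?_
  rintro _ ⟨f, rfl⟩
  exact ⟨c.twist t f, (unitaryFamily_conj_regRep c t f).symm⟩

/-- The map `σ^c_t` on `C*_r(G)`, `a ↦ u_t a u_t⋆`. -/
noncomputable def sigmaFun (c : RealHom G) (t : ℝ) (a : ReducedCStarAlgebra G) :
    ReducedCStarAlgebra G :=
  ⟨unitaryFamily c t * incl a * star (unitaryFamily c t), conj_mem c t a⟩

theorem incl_sigmaFun (c : RealHom G) (t : ℝ) (a : ReducedCStarAlgebra G) :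
    incl (sigmaFun c t a) = unitaryFamily c t * incl a * star (unitaryFamily c t) := rfl

theorem sigmaFun_zero (c : RealHom G) (a : ReducedCStarAlgebra G) : sigmaFun c 0 a = a := by
  apply incl_injective
  rw [incl_sigmaFun, star_unitaryFamily, neg_zero, mul_unitaryFamily_zero,
    unitaryFamily_zero_mul]

theorem sigmaFun_add (c : RealHom G) (s t : ℝ) (a : ReducedCStarAlgebra G) :
    sigmaFun c (s + t) a = sigmaFun c s (sigmaFun c t a) := by
  apply incl_injective
  simp only [incl_sigmaFun, unitaryFamily_add, star_mul, _root_.mul_assoc]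

theorem sigmaFun_sub (c : RealHom G) (t : ℝ) (a b : ReducedCStarAlgebra G) :
    sigmaFun c t (a - b) = sigmaFun c t a - sigmaFun c t b := by
  apply incl_injective
  simp only [incl_sigmaFun, incl_sub, mul_sub, sub_mul]

/-- The automorphism `σ^c_t` of `C*_r(G)`. -/
noncomputable def sigmaAut (c : RealHom G) (t : ℝ) :
    ReducedCStarAlgebra G ≃⋆ₐ[ℂ] ReducedCStarAlgebra G where
  toFun := sigmaFun c t
  invFun := sigmaFun c (-t)
  left_inv a := by rw [← sigmaFun_add, neg_add_cancel, sigmaFun_zero]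
  right_inv a := by rw [← sigmaFun_add, add_neg_cancel, sigmaFun_zero]
  map_mul' a b := by
    apply incl_injective
    simp only [incl_sigmaFun, incl_mul, _root_.mul_assoc]
    rw [← _root_.mul_assoc (star (unitaryFamily c t)) (unitaryFamily c t), star_unitaryFamily,
      ← unitaryFamily_add, neg_add_cancel, unitaryFamily_zero_mul]
  map_add' a b := by
    apply incl_injective
    simp only [incl_sigmaFun, incl_add, mul_add, add_mul]
  map_smul' z a := by
    apply incl_injective
    simp only [incl_sigmaFun, incl_smul, mul_smul_comm, smul_mul_assoc]
  map_star' a := by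
    apply incl_injective
    simp only [incl_sigmaFun, incl_star, star_mul, star_star, _root_.mul_assoc]

/-- On `C_c(G)`, `σ^c_t(f)(g) = e^{itc(g)} f(g)`. -/
theorem sigmaAut_ofCc (c : RealHom G) (t : ℝ) (f : C_c(G, ℂ)) :
    sigmaAut c t (ofCc f) = ofCc (c.twist t f) :=
  incl_injective (unitaryFamily_conj_regRep c t f)

theorem norm_sigmaAut (c : RealHom G) (t : ℝ) (a : ReducedCStarAlgebra G) :
    ‖sigmaAut c t a‖ = ‖a‖ := NonUnitalStarAlgHom.norm_map (sigmaAut c t)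
      (sigmaAut c t).injective a

theorem ofCc_sub (f₁ f₂ : C_c(G, ℂ)) : ofCc f₁ - ofCc f₂ = ofCc (f₁ - f₂) := by
  have h : f₁ - f₂ = f₁ + (-1 : ℂ) • f₂ := by ext; simp [sub_eq_add_neg]
  apply incl_injective
  rw [incl_sub, incl_ofCc, incl_ofCc, incl_ofCc, h, regRep_add, regRep_smul, neg_one_smul,
    sub_eq_add_neg]

theorem continuous_twist (c : RealHom G) (f : C_c(G, ℂ)) :
    Continuous fun t => ofCc (c.twist t f) := by
  obtain ⟨n, hn⟩ := norm_regRep_le (G := G) f.hasCompactSupport.isCompact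
  obtain ⟨M, hM⟩ := exists_norm_bound f
  have hM0 : 0 ≤ max M 0 := le_max_right _ _
  obtain ⟨B, hB⟩ := f.hasCompactSupport.isCompact.exists_bound_of_continuousOn
    c.continuous'.continuousOn
  have key : ∀ s t : ℝ, ‖ofCc (c.twist s f) - ofCc (c.twist t f)‖ ≤
      n * (|s - t| * max B 0 * max M 0) := by
    intro s t
    rw [ofCc_sub, ← norm_incl, incl_ofCc]
    have hval : ∀ g, (c.twist s f - c.twist t f) g = Complex.exp (Complex.I * t * c g) *
        (Complex.exp (Complex.I * ((s - t) * c g : ℝ)) - 1) * f g := fun g => by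
      change Complex.exp (Complex.I * s * c g) * f g - Complex.exp (Complex.I * t * c g) * f g = _
      rw [mul_sub, ← Complex.exp_add, ← sub_mul, mul_one]
      congr 4
      push_cast
      ring
    refine hn _ (fun g hg => ?_) _ (by positivity) (fun g => ?_)
    · rw [hval] at hg
      exact subset_tsupport _ (right_ne_zero_of_mul hg)
    · rw [hval]
      by_cases hg : f g = 0
      · rw [hg, mul_zero, norm_zero]; positivity
      · have e1 : Complex.I * t * c g = ((t * c g : ℝ) : ℂ) * Complex.I := by push_cast; ring
        rw [norm_mul, norm_mul, e1, Complex.norm_exp_ofReal_mul_I, one_mul]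
        refine mul_le_mul ?_ ((hM g).trans (le_max_left _ _)) (norm_nonneg _) (by positivity)
        refine (Real.norm_exp_I_mul_ofReal_sub_one_le).trans ?_
        rw [norm_mul, Real.norm_eq_abs]
        exact mul_le_mul_of_nonneg_left
          ((hB g (subset_tsupport _ hg)).trans (le_max_left _ _)) (abs_nonneg _)
  rw [continuous_iff_continuousAt]
  intro t
  rw [ContinuousAt, tendsto_iff_norm_sub_tendsto_zero]
  refine squeeze_zero (fun _ => norm_nonneg _) (fun s => key s t) ?_
  have : Continuous fun s : ℝ => (n : ℝ) * (|s - t| * max B 0 * max M 0) := by fun_prop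
  simpa using this.tendsto t

/-- The continuous one-parameter group `σ^c` of automorphisms of `C*_r(G)`. -/
noncomputable def sigma (c : RealHom G) : OneParameterGroup (ReducedCStarAlgebra G) where
  toFun := sigmaAut c
  map_zero' := sigmaFun_zero c
  map_add' := sigmaFun_add c
  continuous' a := by
    refine continuous_of_uniform_approx_of_continuous fun u hu => ?_
    obtain ⟨ε, hε, hεu⟩ := Metric.mem_uniformity_dist.1 hu
    obtain ⟨f, hf⟩ := exists_approx a hε
    refine ⟨fun t => ofCc (c.twist t f), continuous_twist c f, fun t => hεu ?_⟩
    rw [dist_eq_norm]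
    change ‖sigmaAut c t a - ofCc (c.twist t f)‖ < ε
    rw [← sigmaAut_ofCc, ← map_sub, norm_sigmaAut]
    exact hf

/-! ### The conditional expectation and the weights `φ_m` -/

/-- The unit `x`, as an element of `G_x`. -/
def unitArrow (x : unitSpace G) : {g : G // source g = (x : G)} := ⟨x, source_unit x.2⟩

open Classical in
/-- The matrix coefficient `⟨δ_x, a_x δ_x⟩` of `a ∈ C*_r(G)` at the unit `x`. -/
noncomputable def diag (a : ReducedCStarAlgebra G) (x : unitSpace G) : ℂ :=
  (incl a).entry x (lp.single 2 (unitArrow x) (1 : ℂ)) (unitArrow x)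

theorem diag_ofCc (f : C_c(G, ℂ)) (x : unitSpace G) : diag (ofCc f) x = f x := by
  classical
  change fiberRep x f (lp.single 2 (unitArrow x) (1 : ℂ)) (unitArrow x) = f x
  rw [fiberRep_apply', tsum_eq_single (unitArrow x)]
  · have h1 : mul (x : G) (inv (x : G)) = x := by rw [mul_inv]; exact x.2
    simp [unitArrow, h1]
  · intro k hk
    simp [hk]

theorem diag_add (a b : ReducedCStarAlgebra G) (x : unitSpace G) :
    diag (a + b) x = diag a x + diag b x := rfl

theorem diag_sub (a b : ReducedCStarAlgebra G) (x : unitSpace G) :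
    diag (a - b) x = diag a x - diag b x := rfl

theorem diag_smul (z : ℂ) (a : ReducedCStarAlgebra G) (x : unitSpace G) :
    diag (z • a) x = z * diag a x := rfl

theorem norm_diag_le (a : ReducedCStarAlgebra G) (x : unitSpace G) : ‖diag a x‖ ≤ ‖a‖ := by
  classical
  calc ‖diag a x‖ ≤ ‖(incl a).entry x (lp.single 2 (unitArrow x) (1 : ℂ))‖ :=
        lp.norm_apply_le_norm (by simp) _ _
    _ ≤ ‖(incl a).entry x‖ * ‖(lp.single 2 (unitArrow x) (1 : ℂ) : FiberHilbert x)‖ :=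
        ContinuousLinearMap.le_opNorm _ _
    _ = ‖(incl a).entry x‖ := by rw [lp.norm_single (by simp), norm_one, mul_one]
    _ ≤ ‖a‖ := FiberOperators.norm_entry_le _ x

/-- The canonical conditional expectation `P : C*_r(G) → C₀(G⁽⁰⁾)`, the continuous linear
extension of the restriction map `C_c(G) → C_c(G⁽⁰⁾)`; see `condExp_ofCc` and `norm_condExp_le`. -/
noncomputable def condExp : ReducedCStarAlgebra G →ₗ[ℂ] C₀(unitSpace G, ℂ) where
  toFun a :=
    { toFun := diag a
      continuous_toFun := by
        refine continuous_of_uniform_approx_of_continuous fun u hu => ?_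
        obtain ⟨ε, hε, hεu⟩ := Metric.mem_uniformity_dist.1 hu
        obtain ⟨f, hf⟩ := exists_approx a hε
        refine ⟨fun x => f x, f.continuous.comp continuous_subtype_val, fun x => hεu ?_⟩
        rw [dist_eq_norm]
        change ‖diag a x - f x‖ < ε
        rw [← diag_ofCc f x, ← diag_sub]
        exact (norm_diag_le _ _).trans_lt hf
      zero_at_infty' := by
        rw [Metric.tendsto_nhds]
        intro ε hε
        obtain ⟨f, hf⟩ := exists_approx a hε
        have hK : IsCompact ((Subtype.val : unitSpace G → G) ⁻¹' tsupport f) :=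
          isClosed_unitSpace.isClosedEmbedding_subtypeVal.isCompact_preimage
            f.hasCompactSupport.isCompact
        filter_upwards [hK.compl_mem_cocompact] with x hx
        have h0 : f x = 0 := by
          by_contra h
          exact hx (subset_tsupport _ h)
        rw [dist_zero_right]
        have : diag a x = diag (a - ofCc f) x := by rw [diag_sub, diag_ofCc, h0, sub_zero]
        rw [this]
        exact (norm_diag_le _ _).trans_lt hf }
  map_add' a b := by ext x; rfl
  map_smul' z a := by ext x; rfl

theorem condExp_ofCc (f : C_c(G, ℂ)) (x : unitSpace G) : condExp (ofCc f) x = f x :=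
  diag_ofCc f x

theorem norm_condExp_le (a : ReducedCStarAlgebra G) : ‖condExp a‖ ≤ ‖a‖ := by
  rw [← ZeroAtInftyContinuousMap.norm_toBCF_eq_norm]
  exact (BoundedContinuousFunction.norm_le (norm_nonneg a)).2 fun x => norm_diag_le a x

theorem condExp_nonneg (a : ReducedCStarAlgebra G) (ha : 0 ≤ a) (x : unitSpace G) :
    ∃ r : ℝ, 0 ≤ r ∧ condExp a x = r := by
  classical
  obtain ⟨b, rfl⟩ := CStarAlgebra.nonneg_iff_eq_star_mul_self.1 ha
  let δ : FiberHilbert x := lp.single 2 (unitArrow x) (1 : ℂ)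
  let T := (incl b).entry x
  have h : condExp (star b * b) x = inner ℂ (T δ) (T δ) := by
    change (star T * T) δ (unitArrow x) = _
    rw [← ContinuousLinearMap.adjoint_inner_right]
    have e : ∀ η : FiberHilbert x, η (unitArrow x) = inner ℂ δ η := fun η => by
      rw [lp.inner_single_left]; simp
    rw [e]
    rfl
  exact ⟨‖T δ‖ ^ 2, by positivity, by rw [h, inner_self_eq_norm_sq_to_K]; simp⟩

/-- The map `φ_m(a) = ∫ P(a) dm` on the positive elements of `C*_r(G)`, with values in `[0,∞]`.
For `a ≥ 0` the function `P(a)` is real and non-negative, see `condExp_nonneg`. -/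
noncomputable def phi [MeasurableSpace G] (m : Measure (unitSpace G))
    (a : {a : ReducedCStarAlgebra G // 0 ≤ a}) : ℝ≥0∞ :=
  ∫⁻ x, ENNReal.ofReal (condExp (a : ReducedCStarAlgebra G) x).re ∂m

end ReducedCStarAlgebra

end Reduced

end EtaleGroupoid

end Groupoids

/-!
For a fixed element the KMS function is constant on each edge of the strip, and comparing Gaussian
integrals along the two edges shows that the constants agree, so fixed elements lie in the
centralizer of the weight. Hence `C_c(G⁽⁰⁾)` lies in the centralizer of `ψ` as soon as it lies in
`𝒩_ψ`. For the latter, shifting the contour in the Gaussian average `y` of an element `x` gives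
`ψ(y⋆y) ≤ e^{β²} ψ(xx⋆)`, and Gaussian averages of elements of finite weight approximate a local
unit of `C_c(G⁽⁰⁾)`.

On `C_c(G)` the weight is therefore a functional `Φ` that commutes with `C_c(G⁽⁰⁾)` and is invariant
under the twists by `c₀`. Functions supported off the open set `ker c₀` are differences of the form
`e^{itc₀} k - k` and are killed by invariance. Functions supported on `ker c₀` off the units live
where `r ≠ s`, and are killed by the centralizer property after localization. So `Φ` only sees the
restriction to `G⁽⁰⁾`, where the Riesz representation theorem provides `m`.

For `a = b⋆b` in the C*-algebra take cut-offs `u_n` on `G⁽⁰⁾` with `b u_n → b`. The formula holds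
for `u_n a u_n` by density. Lower semicontinuity of `ψ` gives one inequality, and Fatou's lemma
together with `ψ(u_n a u_n) ≤ ψ(a)` the other.
-/

theorem mul_self_le_norm_smul_self {A : Type*} [NonUnitalCStarAlgebra A] [PartialOrder A]
    [StarOrderedRing A] {a : A} (ha : 0 ≤ a) : a * a ≤ ‖a‖ • a := by
  have hroot : IsSelfAdjoint (CFC.sqrt a) := .of_nonneg (CFC.sqrt_nonneg a)
  have hconj : star (CFC.sqrt a) * a * CFC.sqrt a = a * a := by
    rw [hroot.star_eq]
    conv_lhs => enter [1, 2]; rw [← CFC.sqrt_mul_sqrt_self a ha]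
    rw [← mul_assoc, CFC.sqrt_mul_sqrt_self a ha, mul_assoc, CFC.sqrt_mul_sqrt_self a ha]
  calc a * a = star (CFC.sqrt a) * a * CFC.sqrt a := hconj.symm
    _ ≤ ‖a‖ • (star (CFC.sqrt a) * CFC.sqrt a) :=
      CStarAlgebra.star_left_conjugate_le_norm_smul (.of_nonneg ha)
    _ = ‖a‖ • a := by rw [hroot.star_eq, CFC.sqrt_mul_sqrt_self a ha]

/-! ### The left ideal of a weight and its sesquilinear form -/

namespace CStarWeight

variable {A : Type*} [NonUnitalCStarAlgebra A] [PartialOrder A] [StarOrderedRing A]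

/-- The value `ψ(x⋆x) ∈ [0,∞]`, the square of the GNS seminorm of `x`. -/
def normSq (ψ : CStarWeight A) (x : A) : ℝ≥0∞ := ψ ⟨star x * x, star_mul_self_nonneg x⟩

variable {ψ : CStarWeight A}

theorem mem_leftIdeal_iff {x : A} : x ∈ ψ.leftIdeal ↔ ψ.normSq x < ∞ := Iff.rfl

theorem apply_congr {a b : A} {ha : 0 ≤ a} {hb : 0 ≤ b} (h : a = b) : ψ ⟨a, ha⟩ = ψ ⟨b, hb⟩ :=
  congrArg ψ.toFun (Subtype.ext h)

theorem apply_smul (hψ : ψ.IsProper) {r : ℝ} (hr : 0 ≤ r) (a : {a : A // 0 ≤ a}) :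
    ψ ⟨r • (a : A), smul_nonneg hr a.2⟩ = ENNReal.ofReal r * ψ a := by
  rcases hr.eq_or_lt with rfl | hr
  · rw [ENNReal.ofReal_zero, zero_mul, ← map_zero_of_isProper hψ]
    exact apply_congr (zero_smul ℝ _)
  · exact ψ.map_smul' r hr a

theorem normSq_mul_le (hψ : ψ.IsProper) (c x : A) :
    ψ.normSq (c * x) ≤ ENNReal.ofReal (‖c‖ ^ 2) * ψ.normSq x := by
  rw [normSq, normSq, ← apply_smul hψ (sq_nonneg _)]
  refine ψ.mono ?_
  have hconj := CStarAlgebra.star_left_conjugate_le_norm_smul (a := x) (b := star c * c)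
    (.star_mul_self c)
  rw [CStarRing.norm_star_mul_self, ← pow_two] at hconj
  simpa only [star_mul, mul_assoc] using hconj

theorem mul_mem_leftIdeal (hψ : ψ.IsProper) (c : A) {x : A} (hx : x ∈ ψ.leftIdeal) :
    c * x ∈ ψ.leftIdeal :=
  (normSq_mul_le hψ c x).trans_lt (ENNReal.mul_lt_top ENNReal.ofReal_lt_top hx)

theorem mem_leftIdeal_of_lt_top (hψ : ψ.IsProper) {a : A} (ha : 0 ≤ a) (hfin : ψ ⟨a, ha⟩ < ∞) :
    a ∈ ψ.leftIdeal := by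
  refine lt_of_le_of_lt ?_ (ENNReal.mul_lt_top (ENNReal.ofReal_lt_top (r := ‖a‖)) hfin)
  rw [← apply_smul hψ (norm_nonneg _) ⟨a, ha⟩]
  refine ψ.mono (le_of_eq_of_le ?_ (mul_self_le_norm_smul_self ha))
  exact congrArg (· * a) (IsSelfAdjoint.of_nonneg ha).star_eq

theorem sqrt_mem_leftIdeal {a : A} (ha : 0 ≤ a) (hfin : ψ ⟨a, ha⟩ < ∞) :
    CFC.sqrt a ∈ ψ.leftIdeal := by
  have hsq : star (CFC.sqrt a) * CFC.sqrt a = a := by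
    rw [(IsSelfAdjoint.of_nonneg (CFC.sqrt_nonneg a)).star_eq, CFC.sqrt_mul_sqrt_self a ha]
  exact (apply_congr hsq).trans_lt hfin

theorem mem_defDomain_of_lt_top {a : A} (ha : 0 ≤ a) (hfin : ψ ⟨a, ha⟩ < ∞) :
    a ∈ ψ.defDomain := by
  have hroot := sqrt_mem_leftIdeal ha hfin
  rw [← CFC.sqrt_mul_sqrt_self a ha]
  refine mul_mem_defDomain ?_ hroot
  rwa [(IsSelfAdjoint.of_nonneg (CFC.sqrt_nonneg a)).star_eq]

/-- The linear extension of `ψ` to `𝒩_ψ⋆ 𝒩_ψ`, extended further to a linear functional on `A`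
so that it can be applied without a proof of membership. Only its values on `𝒩_ψ⋆ 𝒩_ψ` are
meaningful. -/
noncomputable def functional (ψ : CStarWeight A) (hψ : ψ.IsProper) : A →ₗ[ℂ] ℂ :=
  (LinearMap.exists_extend (ψ.linearExtension hψ)).choose

theorem functional_eq (hψ : ψ.IsProper) {x : A} (hx : x ∈ ψ.defDomain) :
    ψ.functional hψ x = ψ.linearExtension hψ ⟨x, hx⟩ :=
  LinearMap.congr_fun (LinearMap.exists_extend (ψ.linearExtension hψ)).choose_spec ⟨x, hx⟩

theorem functional_of_nonneg (hψ : ψ.IsProper) {a : A} (ha : 0 ≤ a) (hfin : ψ ⟨a, ha⟩ < ∞) :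
    ψ.functional hψ a = ((ψ ⟨a, ha⟩).toReal : ℂ) := by
  rw [functional_eq hψ (mem_defDomain_of_lt_top ha hfin)]
  exact (linearExtension_spec ψ hψ ⟨a, mem_defDomain_of_lt_top ha hfin⟩ ha).2

theorem functional_star_mul_self (hψ : ψ.IsProper) {x : A} (hx : x ∈ ψ.leftIdeal) :
    ψ.functional hψ (star x * x) = ((ψ.normSq x).toReal : ℂ) :=
  functional_of_nonneg hψ (star_mul_self_nonneg x) hx

theorem defDomain_induction (hψ : ψ.IsProper) {P : (x : A) → x ∈ ψ.defDomain → Prop}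
    (star_mul_self : ∀ (a : A) (ha : a ∈ ψ.leftIdeal),
      P (star a * a) (Submodule.subset_span ⟨a, ha, a, ha, rfl⟩))
    (zero : P 0 ψ.defDomain.zero_mem)
    (add : ∀ x y hx hy, P x hx → P y hy → P (x + y) (ψ.defDomain.add_mem hx hy))
    (smul : ∀ (z : ℂ) x hx, P x hx → P (z • x) (ψ.defDomain.smul_mem z hx))
    {x : A} (hx : x ∈ ψ.defDomain) : P x hx := by
  suffices ∃ hx, P x hx from this.2
  have hspan := mem_span_sq hψ hx
  clear hx
  induction hspan using Submodule.span_induction with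
  | mem x hx => obtain ⟨a, rfl⟩ := hx; exact ⟨_, star_mul_self a a.2⟩
  | zero => exact ⟨_, zero⟩
  | add x y _ _ hx hy => exact ⟨_, add x y _ _ hx.2 hy.2⟩
  | smul z x _ hx => exact ⟨_, smul z x _ hx.2⟩

theorem functional_star (hψ : ψ.IsProper) {x : A} (hx : x ∈ ψ.defDomain) :
    ψ.functional hψ (star x) = star (ψ.functional hψ x) := by
  induction hx using defDomain_induction hψ with
  | star_mul_self a ha =>
    rw [star_mul, star_star, functional_star_mul_self hψ ha, Complex.star_def, Complex.conj_ofReal]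
  | zero => rw [star_zero, map_zero, star_zero]
  | add x y _ _ hx hy => rw [star_add, map_add, map_add, star_add, hx, hy]
  | smul z x _ hx => rw [star_smul, map_smul, map_smul, hx, star_smul]

theorem normSq_map {φ : A ≃⋆ₐ[ℂ] A} (hφ : ψ.IsInvariantUnder φ) (x : A) :
    ψ.normSq (φ x) = ψ.normSq x := by
  rw [normSq, normSq, ← hφ ⟨star x * x, _⟩]
  exact apply_congr (by rw [map_mul, map_star])

theorem functional_map (hψ : ψ.IsProper) {φ : A ≃⋆ₐ[ℂ] A} (hφ : ψ.IsInvariantUnder φ) {x : A}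
    (hx : x ∈ ψ.defDomain) : ψ.functional hψ (φ x) = ψ.functional hψ x := by
  induction hx using defDomain_induction hψ with
  | star_mul_self a ha =>
    rw [functional_star_mul_self hψ ha, map_mul, map_star,
      functional_star_mul_self hψ (hφ.mem_leftIdeal ha), normSq_map hφ]
  | zero => rw [map_zero]
  | add x y _ _ hx hy => rw [map_add, map_add, map_add, hx, hy]
  | smul z x _ hx => rw [map_smul, map_smul, map_smul, hx]

/-- The left ideal `𝒩_ψ` as a linear subspace. -/
def leftIdealSubmodule (ψ : CStarWeight A) (hψ : ψ.IsProper) : Submodule ℂ A where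
  carrier := ψ.leftIdeal
  add_mem' := add_mem_leftIdeal
  zero_mem' := by
    have hzero : ψ.normSq 0 = ψ 0 := apply_congr (mul_zero _)
    rw [mem_leftIdeal_iff, hzero, map_zero_of_isProper hψ]
    exact ENNReal.zero_lt_top
  smul_mem' z _ hx := smul_mem_leftIdeal hψ z hx

/-- The GNS seminorm `ψ(x⋆x)^{1/2}` on `𝒩_ψ`; it has the junk value `0` off `𝒩_ψ`. -/
noncomputable def gnsNorm (ψ : CStarWeight A) (x : A) : ℝ := √(ψ.normSq x).toReal

theorem gnsNorm_nonneg (x : A) : 0 ≤ ψ.gnsNorm x := Real.sqrt_nonneg _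

theorem gnsNorm_sq (x : A) : ψ.gnsNorm x ^ 2 = (ψ.normSq x).toReal :=
  Real.sq_sqrt ENNReal.toReal_nonneg

theorem gnsNorm_map {φ : A ≃⋆ₐ[ℂ] A} (hφ : ψ.IsInvariantUnder φ) (x : A) :
    ψ.gnsNorm (φ x) = ψ.gnsNorm x := by
  rw [gnsNorm, normSq_map hφ, gnsNorm]

theorem gnsNorm_mul_le (hψ : ψ.IsProper) (c : A) {x : A} (hx : x ∈ ψ.leftIdeal) :
    ψ.gnsNorm (c * x) ≤ ‖c‖ * ψ.gnsNorm x := by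
  refine Real.sqrt_le_iff.2 ⟨mul_nonneg (norm_nonneg c) (gnsNorm_nonneg x), ?_⟩
  calc (ψ.normSq (c * x)).toReal
      ≤ (ENNReal.ofReal (‖c‖ ^ 2) * ψ.normSq x).toReal := ENNReal.toReal_mono
        (ENNReal.mul_lt_top ENNReal.ofReal_lt_top hx).ne (normSq_mul_le hψ c x)
    _ = (‖c‖ * ψ.gnsNorm x) ^ 2 := by
      rw [ENNReal.toReal_mul, ENNReal.toReal_ofReal (sq_nonneg _), mul_pow, gnsNorm_sq]

theorem norm_functional_star_mul_le (hψ : ψ.IsProper) {a b : A} (ha : a ∈ ψ.leftIdeal)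
    (hb : b ∈ ψ.leftIdeal) :
    ‖ψ.functional hψ (star a * b)‖ ≤ ψ.gnsNorm a * ψ.gnsNorm b := by
  have hdom : ∀ x y : ψ.leftIdealSubmodule hψ, star (x : A) * y ∈ ψ.defDomain := fun x y =>
    mul_mem_defDomain (by rw [star_star]; exact x.2) y.2
  have hsymm : ∀ x y : ψ.leftIdealSubmodule hψ,
      star (ψ.functional hψ (star (y : A) * x)) = ψ.functional hψ (star (x : A) * y) :=
    fun x y => by rw [← functional_star hψ (hdom y x), star_mul, star_star]
  let core : PreInnerProductSpace.Core ℂ (ψ.leftIdealSubmodule hψ) :=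
    { inner := fun x y => ψ.functional hψ (star (x : A) * y)
      conj_inner_symm := hsymm
      re_inner_nonneg := fun x => by
        rw [functional_star_mul_self hψ x.2]
        exact ENNReal.toReal_nonneg
      add_left := fun x y z => by
        simp only [Submodule.coe_add, star_add, add_mul, map_add]
      smul_left := fun x y r => by
        simp only [SetLike.val_smul, star_smul, smul_mul_assoc, map_smul]
        rfl }
  have hCS := InnerProductSpace.Core.inner_mul_inner_self_le (𝕜 := ℂ)
    (⟨a, ha⟩ : ψ.leftIdealSubmodule hψ) ⟨b, hb⟩
  change ‖ψ.functional hψ (star a * b)‖ * ‖ψ.functional hψ (star b * a)‖ ≤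
    (ψ.functional hψ (star a * a)).re * (ψ.functional hψ (star b * b)).re at hCS
  rw [functional_star_mul_self hψ ha, functional_star_mul_self hψ hb,
    ← hsymm ⟨b, hb⟩ ⟨a, ha⟩, norm_star, Complex.ofReal_re, Complex.ofReal_re, ← gnsNorm_sq,
    ← gnsNorm_sq, ← mul_pow, ← pow_two] at hCS
  exact le_of_sq_le_sq hCS (mul_nonneg (gnsNorm_nonneg a) (gnsNorm_nonneg b))

theorem apply_le_of_tendsto (hψ : ψ.IsProper) {ι : Type*} {l : Filter ι} [l.NeBot] {a : ι → A}
    {b : A} (hb : 0 ≤ b) (ha : ∀ i, 0 ≤ a i) (hlim : Tendsto a l (𝓝 b)) {r : ℝ≥0∞}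
    (hr : ∀ᶠ i in l, ψ ⟨a i, ha i⟩ ≤ r) : ψ ⟨b, hb⟩ ≤ r := by
  rcases eq_or_ne r ∞ with rfl | hr'
  · exact le_top
  lift r to ℝ≥0 using hr'
  have hlim' : Tendsto (fun i => (⟨a i, ha i⟩ : {a : A // 0 ≤ a})) l (𝓝 ⟨b, hb⟩) :=
    tendsto_subtype_rng.2 hlim
  exact (hψ.lowerSemicontinuous r).mem_of_tendsto hlim' hr

theorem normSq_le_of_tendsto (hψ : ψ.IsProper) {ι : Type*} {l : Filter ι} [l.NeBot] {x : ι → A}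
    {y : A} (hlim : Tendsto x l (𝓝 y)) {r : ℝ≥0∞} (hr : ∀ᶠ i in l, ψ.normSq (x i) ≤ r) :
    ψ.normSq y ≤ r :=
  apply_le_of_tendsto hψ (star_mul_self_nonneg y) (fun i => star_mul_self_nonneg (x i))
    (hlim.star.mul hlim) hr

theorem normSq_le_of_tendsto_functional (hψ : ψ.IsProper) {ι : Type*} {l : Filter ι} [l.NeBot]
    {x : ι → A} {y : A} (hlim : Tendsto x l (𝓝 y)) (hx : ∀ i, x i ∈ ψ.leftIdeal) {z : ℂ}
    (hz : Tendsto (fun i => ψ.functional hψ (star (x i) * x i)) l (𝓝 z)) :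
    ψ.normSq y ≤ ENNReal.ofReal ‖z‖ := by
  have hval : ∀ i, ENNReal.ofReal ‖ψ.functional hψ (star (x i) * x i)‖ = ψ.normSq (x i) :=
    fun i => by
      rw [functional_star_mul_self hψ (hx i), Complex.norm_real,
        Real.norm_of_nonneg ENNReal.toReal_nonneg,
        ENNReal.ofReal_toReal (mem_leftIdeal_iff.1 (hx i)).ne]
  have hlimSq : Tendsto (fun i => ψ.normSq (x i)) l (𝓝 (ENNReal.ofReal ‖z‖)) :=
    ((ENNReal.continuous_ofReal.tendsto _).comp hz.norm).congr hval
  exact le_of_forall_gt_imp_ge_of_dense fun r hr =>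
    normSq_le_of_tendsto hψ hlim (hlimSq.eventually_le_const hr)

end CStarWeight
/-! ### Gaussian integrals of holomorphic functions on a strip -/

/-- The normal distribution on the line with density proportional to `exp(-s²)`. -/
noncomputable def gaussMeasure : Measure ℝ := ProbabilityTheory.gaussianReal 0 (1 / 2)

instance : IsProbabilityMeasure gaussMeasure :=
  ProbabilityTheory.instIsProbabilityMeasureGaussianReal 0 (1 / 2)

theorem integral_gaussMeasure (f : ℝ → ℂ) :
    ∫ s, f s ∂gaussMeasure = (√Real.pi : ℂ)⁻¹ * ∫ s : ℝ, Complex.exp (-(s : ℂ) ^ 2) * f s := by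
  rw [gaussMeasure, ProbabilityTheory.integral_gaussianReal_eq_integral_smul (by norm_num),
    ← integral_const_mul]
  refine integral_congr_ae (Eventually.of_forall fun s => ?_)
  simp only [ProbabilityTheory.gaussianPDFReal]
  rw [show 2 * Real.pi * ((1 / 2 : ℝ≥0) : ℝ) = Real.pi by push_cast; ring,
    show -(s - 0) ^ 2 / (2 * ((1 / 2 : ℝ≥0) : ℝ)) = -s ^ 2 by push_cast; ring,
    ← Complex.coe_smul, smul_eq_mul]
  push_cast
  ring

theorem norm_integral_gaussMeasure_le {f : ℝ → ℂ} {C : ℝ} (hf : ∀ s, ‖f s‖ ≤ C) :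
    ‖∫ s, f s ∂gaussMeasure‖ ≤ C := by
  simpa only [probReal_univ, mul_one] using
    norm_integral_le_of_norm_le_const (μ := gaussMeasure) (Eventually.of_forall hf)

namespace CStarWeight

theorem ofReal_add_mul_I_mem_kmsStrip {β y : ℝ} (hy : y ∈ uIcc 0 β) (x : ℝ) :
    (x : ℂ) + y * Complex.I ∈ kmsStrip β := by
  simpa [kmsStrip] using hy

theorem ofReal_add_I_mul_mem_kmsStrip (β x : ℝ) : (x : ℂ) + Complex.I * β ∈ kmsStrip β := by
  simp [kmsStrip]

theorem mem_interior_kmsStrip {β : ℝ} {z : ℂ} (hz : z.im ∈ Ioo (min 0 β) (max 0 β)) :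
    z ∈ interior (kmsStrip β) :=
  mem_interior.2 ⟨Complex.im ⁻¹' Ioo (min 0 β) (max 0 β), fun _ hw => Ioo_subset_Icc_self hw,
    isOpen_Ioo.preimage Complex.continuous_im, hz⟩

section ContourShift

variable {β : ℝ} {H : ℂ → ℂ} {B : ℝ → ℝ}

theorem tendsto_integral_vertical (hB : ∀ z ∈ kmsStrip β, ‖H z‖ ≤ B z.re) {l : Filter ℝ}
    (hl : Tendsto B l (𝓝 0)) :
    Tendsto (fun x : ℝ => ∫ y in (0 : ℝ)..β, H (x + y * Complex.I)) l (𝓝 0) := by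
  have hbound : Tendsto (fun x => B x * |β - 0|) l (𝓝 0) := by
    simpa only [zero_mul] using hl.mul_const |β - 0|
  refine squeeze_zero_norm (fun x => ?_) hbound
  refine intervalIntegral.norm_integral_le_of_norm_le_const fun y hy => ?_
  simpa using hB _ (ofReal_add_mul_I_mem_kmsStrip (uIoc_subset_uIcc hy) x)

theorem integrable_horizontal (hc : ContinuousOn H (kmsStrip β))
    (hB : ∀ z ∈ kmsStrip β, ‖H z‖ ≤ B z.re) (hint : Integrable B) {y : ℝ} (hy : y ∈ uIcc 0 β) :
    Integrable fun x : ℝ => H (x + y * Complex.I) := by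
  refine hint.mono' ?_ (Eventually.of_forall fun x => ?_)
  · exact (hc.comp_continuous (by fun_prop)
      (ofReal_add_mul_I_mem_kmsStrip hy)).aestronglyMeasurable
  · simpa using hB _ (ofReal_add_mul_I_mem_kmsStrip hy x)

theorem integral_eq_integral_add_I_mul (hc : ContinuousOn H (kmsStrip β))
    (hd : DifferentiableOn ℂ H (interior (kmsStrip β))) (hB : ∀ z ∈ kmsStrip β, ‖H z‖ ≤ B z.re)
    (hint : Integrable B) (htop : Tendsto B atTop (𝓝 0)) (hbot : Tendsto B atBot (𝓝 0)) :
    ∫ s : ℝ, H s = ∫ s : ℝ, H (s + Complex.I * β) := by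
  have hrect : ∀ R : ℝ, ((∫ x in (-R)..R, H (x + (0 : ℝ) * Complex.I)) -
      ∫ x in (-R)..R, H (x + β * Complex.I)) +
      Complex.I • (∫ y in (0 : ℝ)..β, H (R + y * Complex.I)) -
      Complex.I • (∫ y in (0 : ℝ)..β, H ((-R : ℝ) + y * Complex.I)) = 0 := fun R =>
    Complex.integral_boundary_rect_eq_zero_of_continuousOn_of_differentiableOn H
      ⟨-R, 0⟩ ⟨R, β⟩ (hc.mono fun z hz => hz.2) (hd.mono fun z hz => mem_interior_kmsStrip hz.2)
  have hhoriz : ∀ y ∈ uIcc 0 β, Tendsto (fun R => ∫ x in (-R)..R, H (x + y * Complex.I)) atTop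
      (𝓝 (∫ x : ℝ, H (x + y * Complex.I))) := fun y hy =>
    intervalIntegral_tendsto_integral (integrable_horizontal hc hB hint hy)
      tendsto_neg_atTop_atBot tendsto_id
  have hlim := (((hhoriz 0 left_mem_uIcc).sub (hhoriz β right_mem_uIcc)).add
    ((tendsto_integral_vertical hB htop).const_smul Complex.I)).sub
    (((tendsto_integral_vertical hB hbot).comp tendsto_neg_atTop_atBot).const_smul Complex.I)
  have hzero := tendsto_nhds_unique (hlim.congr hrect) tendsto_const_nhds
  rw [smul_zero, add_zero, sub_zero, sub_eq_zero] at hzero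
  simpa only [Complex.ofReal_zero, zero_mul, add_zero, mul_comm Complex.I] using hzero

end ContourShift

theorem norm_cexp_neg_sub_I_mul_sq_le {β : ℝ} {z : ℂ} (hz : z ∈ kmsStrip β) :
    ‖Complex.exp (-(z - Complex.I * β) ^ 2)‖ ≤ Real.exp (β ^ 2) * Real.exp (-z.re ^ 2) := by
  have him : (z.im - β) ^ 2 ≤ β ^ 2 := by
    have habs := Set.abs_sub_right_of_mem_uIcc hz
    rw [sub_zero, abs_sub_comm] at habs
    exact sq_le_sq.2 habs
  rw [Complex.norm_exp, ← Real.exp_add, Real.exp_le_exp]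
  simp only [pow_two, Complex.neg_re, Complex.mul_re, Complex.sub_re, Complex.sub_im,
    Complex.I_re, Complex.I_im, Complex.ofReal_re, Complex.ofReal_im, Complex.mul_im] at him ⊢
  linarith

theorem tendsto_exp_neg_sq {l : Filter ℝ} (hl : Tendsto (fun x => |x|) l atTop) :
    Tendsto (fun x : ℝ => Real.exp (-x ^ 2)) l (𝓝 0) := by
  refine Real.tendsto_exp_neg_atTop_nhds_zero.comp ?_
  simpa only [Function.comp_def, sq_abs] using
    (tendsto_pow_atTop (α := ℝ) two_ne_zero).comp hl

section Strip

variable {β : ℝ} {F : ℂ → ℂ} (hc : ContinuousOn F (kmsStrip β))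
  (hb : ∃ C : ℝ, ∀ z ∈ kmsStrip β, ‖F z‖ ≤ C)
  (hd : DifferentiableOn ℂ F (interior (kmsStrip β)))

include hc hb hd

theorem integral_gaussMeasure_add_I_mul :
    ∫ s : ℝ, F (s + Complex.I * β) ∂gaussMeasure =
      ∫ s : ℝ, Complex.exp (β ^ 2 + 2 * Complex.I * β * s) * F s ∂gaussMeasure := by
  obtain ⟨C, hC⟩ := hb
  let H : ℂ → ℂ := fun z => Complex.exp (-(z - Complex.I * β) ^ 2) * F z
  let B : ℝ → ℝ := fun x => Real.exp (β ^ 2) * Real.exp (-x ^ 2) * C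
  have hB : ∀ z ∈ kmsStrip β, ‖H z‖ ≤ B z.re := fun z hz => by
    rw [norm_mul]
    exact mul_le_mul (norm_cexp_neg_sub_I_mul_sq_le hz) (hC z hz) (norm_nonneg _) (by positivity)
  have hint : Integrable B := by
    have hgauss : Integrable fun x : ℝ => Real.exp (-x ^ 2) := by
      simpa using integrable_exp_neg_mul_sq one_pos
    exact (hgauss.const_mul _).mul_const C
  have hlim : ∀ l : Filter ℝ, Tendsto (fun x => |x|) l atTop → Tendsto B l (𝓝 0) :=
    fun l hl => by
      simpa only [mul_zero, zero_mul] using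
        ((tendsto_exp_neg_sq hl).const_mul (Real.exp (β ^ 2))).mul_const C
  have hshift := integral_eq_integral_add_I_mul (H := H) (β := β) (by fun_prop) (by fun_prop) hB
    hint (hlim _ tendsto_abs_atTop_atTop) (hlim _ tendsto_abs_atBot_atTop)
  rw [integral_gaussMeasure, integral_gaussMeasure]
  congr 1
  simp only [H, add_sub_cancel_right] at hshift
  rw [← hshift]
  refine integral_congr_ae (Eventually.of_forall fun s => ?_)
  simp only [← mul_assoc, ← Complex.exp_add]
  congr 2
  linear_combination -(β : ℂ) ^ 2 * Complex.I_sq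

theorem norm_integral_gaussMeasure_add_I_mul_le {M : ℝ} (hM : ∀ s : ℝ, ‖F s‖ ≤ M) :
    ‖∫ s : ℝ, F (s + Complex.I * β) ∂gaussMeasure‖ ≤ Real.exp (β ^ 2) * M := by
  rw [integral_gaussMeasure_add_I_mul hc hb hd]
  refine norm_integral_gaussMeasure_le fun s => ?_
  have hexp : ‖Complex.exp (β ^ 2 + 2 * Complex.I * β * s)‖ = Real.exp (β ^ 2) := by
    rw [Complex.norm_exp]
    simp [← Complex.ofReal_pow]
  rw [norm_mul, hexp]
  exact mul_le_mul_of_nonneg_left (hM s) (Real.exp_nonneg _)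

theorem edge_values_eq {v w : ℂ} (hv : ∀ s : ℝ, F s = v)
    (hw : ∀ s : ℝ, F (s + Complex.I * β) = w) : v = w := by
  have hone := integral_gaussMeasure_add_I_mul (β := β) (F := fun _ => 1) continuousOn_const
    ⟨1, fun _ _ => norm_one.le⟩ (differentiableOn_const _)
  have hF := integral_gaussMeasure_add_I_mul hc hb hd
  simp only [hv, hw, mul_one, integral_mul_const, integral_const, probReal_univ, one_smul]
    at hone hF
  rw [hF, ← hone, one_mul]

end Strip

end CStarWeight

/-! ### Gaussian averages over a one-parameter group -/

namespace OneParameterGroup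

variable {A : Type*} [NonUnitalCStarAlgebra A]

theorem norm_apply (α : OneParameterGroup A) (t : ℝ) (a : A) : ‖α t a‖ = ‖a‖ :=
  NonUnitalStarAlgHom.norm_map (α t) (α t).injective a

theorem integrable_apply (α : OneParameterGroup A) (a : A) :
    Integrable (fun s => α s a) gaussMeasure :=
  (integrable_const ‖a‖).mono' (α.continuous' a).aestronglyMeasurable
    (Eventually.of_forall fun s => (α.norm_apply s a).le)

/-- The average of `s ↦ α_s(a)` for the Gaussian measure. -/
noncomputable def gaussAvg (α : OneParameterGroup A) (a : A) : A := ∫ s, α s a ∂gaussMeasure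

theorem gaussAvg_sub (α : OneParameterGroup A) (a b : A) :
    α.gaussAvg (a - b) = α.gaussAvg a - α.gaussAvg b := by
  simp only [gaussAvg, map_sub]
  exact integral_sub (α.integrable_apply a) (α.integrable_apply b)

theorem norm_gaussAvg_le (α : OneParameterGroup A) (a : A) : ‖α.gaussAvg a‖ ≤ ‖a‖ := by
  simpa only [gaussAvg, probReal_univ, mul_one] using
    norm_integral_le_of_norm_le_const (μ := gaussMeasure) (f := fun s => α s a) (C := ‖a‖)
      (Eventually.of_forall fun s => (α.norm_apply s a).le)

theorem tendsto_gaussAvg (α : OneParameterGroup A) {ι : Type*} {l : Filter ι} {x : ι → A} {y : A}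
    (h : Tendsto x l (𝓝 y)) : Tendsto (fun i => α.gaussAvg (x i)) l (𝓝 (α.gaussAvg y)) := by
  rw [tendsto_iff_norm_sub_tendsto_zero] at h ⊢
  refine squeeze_zero (fun _ => norm_nonneg _) (fun i => ?_) h
  rw [← gaussAvg_sub]
  exact α.norm_gaussAvg_le _

theorem gaussAvg_of_fixed (α : OneParameterGroup A) {a : A} (h : ∀ t, α t a = a) :
    α.gaussAvg a = a := by
  simp only [gaussAvg, h, integral_const, probReal_univ, one_smul]

theorem gaussAvg_mul_of_fixed (α : OneParameterGroup A) (a : A) {g : A} (h : ∀ t, α t g = g) :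
    α.gaussAvg (a * g) = α.gaussAvg a * g := by
  simp only [gaussAvg, map_mul, h]
  exact ((ContinuousLinearMap.mul ℂ A).flip g).integral_comp_comm (α.integrable_apply a)

end OneParameterGroup

theorem integral_simpleFunc_comp {X Y E : Type*} [MeasurableSpace X] [NormedAddCommGroup E]
    [NormedSpace ℝ E] [CompleteSpace E] (s : SimpleFunc X Y) (g : Y → E) (μ : Measure X)
    [IsFiniteMeasure μ] :
    ∫ t, g (s t) ∂μ = ∑ r ∈ s.range, μ.real (s ⁻¹' {r}) • g r := by
  classical
  have hsum : ∀ t, g (s t) = ∑ r ∈ s.range, (s ⁻¹' {r}).indicator (fun _ => g r) t := fun t => by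
    simp only [indicator, mem_preimage, mem_singleton_iff]
    rw [Finset.sum_ite_eq, if_pos (s.mem_range_self t)]
  simp_rw [hsum]
  rw [integral_finsetSum]
  · exact Finset.sum_congr rfl fun r _ => integral_indicator_const _ (s.measurableSet_fiber r)
  · exact fun r _ => (integrable_const _).indicator (s.measurableSet_fiber r)

namespace CStarWeight

variable {A : Type*} [NonUnitalCStarAlgebra A] [PartialOrder A] [StarOrderedRing A]
  {ψ : CStarWeight A}

section Integral

variable {X : Type*} [MeasurableSpace X] {μ : Measure X} [IsFiniteMeasure μ] {φ : X → A}

theorem integral_simpleFunc_mem_leftIdeal (hψ : ψ.IsProper) (hφ : ∀ r, φ r ∈ ψ.leftIdeal)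
    (s : SimpleFunc X X) : ∫ r, φ (s r) ∂μ ∈ ψ.leftIdeal := by
  rw [integral_simpleFunc_comp]
  refine (ψ.leftIdealSubmodule hψ).sum_mem fun r _ => ?_
  rw [← Complex.coe_smul]
  exact (ψ.leftIdealSubmodule hψ).smul_mem _ (hφ r)

theorem functional_star_mul_integral_simpleFunc (hψ : ψ.IsProper) (s : SimpleFunc X X) :
    ψ.functional hψ (star (∫ r, φ (s r) ∂μ) * ∫ r, φ (s r) ∂μ) =
      ∫ t, ∫ r, ψ.functional hψ (star (φ (s r)) * φ (s t)) ∂μ ∂μ := by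
  have hinner : ∀ q, ∫ r, ψ.functional hψ (star (φ (s r)) * φ q) ∂μ =
      ∑ r ∈ s.range, μ.real (s ⁻¹' {r}) • ψ.functional hψ (star (φ r) * φ q) := fun q =>
    integral_simpleFunc_comp s (fun r => ψ.functional hψ (star (φ r) * φ q)) μ
  rw [integral_simpleFunc_comp s fun q => ∫ r, ψ.functional hψ (star (φ (s r)) * φ q) ∂μ]
  simp_rw [hinner]
  rw [integral_simpleFunc_comp, star_sum, Finset.sum_mul_sum, Finset.sum_comm, map_sum]
  refine Finset.sum_congr rfl fun q _ => ?_
  rw [map_sum, Finset.smul_sum]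
  refine Finset.sum_congr rfl fun r _ => ?_
  rw [star_smul, star_trivial, smul_mul_smul_comm, smul_smul, mul_comm, ← Complex.coe_smul,
    map_smul, Complex.coe_smul]

variable [TopologicalSpace X] [TopologicalSpace.PseudoMetrizableSpace X]
  [SecondCountableTopology X] [OpensMeasurableSpace X]

theorem normSq_integral_le (hψ : ψ.IsProper) (hφ : ∀ r, φ r ∈ ψ.leftIdeal)
    (hφc : Continuous φ) {D : ℝ} (hφD : ∀ r, ‖φ r‖ ≤ D)
    (hΨc : Continuous fun p : X × X => ψ.functional hψ (star (φ p.1) * φ p.2)) {C : ℝ}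
    (hΨC : ∀ r t, ‖ψ.functional hψ (star (φ r) * φ t)‖ ≤ C) :
    ψ.normSq (∫ r, φ r ∂μ) ≤
      ENNReal.ofReal ‖∫ t, ∫ r, ψ.functional hψ (star (φ r) * φ t) ∂μ ∂μ‖ := by
  let u : ℕ → SimpleFunc X X := (stronglyMeasurable_id (α := X)).approx
  have hu : ∀ t, Tendsto (fun n => u n t) atTop (𝓝 t) :=
    fun t => stronglyMeasurable_id.tendsto_approx t
  have hlim : Tendsto (fun n => ∫ r, φ (u n r) ∂μ) atTop (𝓝 (∫ r, φ r ∂μ)) :=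
    tendsto_integral_of_dominated_convergence (fun _ => D)
      (fun n => ((u n).map φ).stronglyMeasurable.aestronglyMeasurable)
      (integrable_const _) (fun n => Eventually.of_forall fun t => hφD _)
      (Eventually.of_forall fun t => (hφc.tendsto t).comp (hu t))
  have hinner : ∀ t, Tendsto
      (fun n => ∫ r, ψ.functional hψ (star (φ (u n r)) * φ (u n t)) ∂μ) atTop
      (𝓝 (∫ r, ψ.functional hψ (star (φ r) * φ t) ∂μ)) := fun t =>
    tendsto_integral_of_dominated_convergence (fun _ => C)
      (fun n => ((u n).map fun r =>
        ψ.functional hψ (star (φ r) * φ (u n t))).stronglyMeasurable.aestronglyMeasurable)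
      (integrable_const _) (fun n => Eventually.of_forall fun r => hΨC _ _)
      (Eventually.of_forall fun r => (hΨc.tendsto (r, t)).comp ((hu r).prodMk_nhds (hu t)))
  refine normSq_le_of_tendsto_functional hψ hlim
    (fun n => integral_simpleFunc_mem_leftIdeal hψ hφ (u n)) ?_
  simp_rw [functional_star_mul_integral_simpleFunc hψ]
  refine tendsto_integral_of_dominated_convergence (fun _ => C * μ.real univ) (fun n => ?_)
    (integrable_const _) (fun n => Eventually.of_forall fun t =>
      norm_integral_le_of_norm_le_const (Eventually.of_forall fun r => hΨC _ _))
    (Eventually.of_forall hinner)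
  exact ((u n).map fun q => ∫ r, ψ.functional hψ (star (φ (u n r)) * φ q)
    ∂μ).stronglyMeasurable.aestronglyMeasurable

end Integral

/-! ### Fixed elements of a KMS weight -/

variable {α : OneParameterGroup A} {β : ℝ}

theorem IsKMS.exists_strip (hK : ψ.IsKMS α β) {a b : A} (ha : a ∈ ψ.leftIdeal)
    (ha' : star a ∈ ψ.leftIdeal) (hb : b ∈ ψ.leftIdeal) (hb' : star b ∈ ψ.leftIdeal) :
    ∃ F : ℂ → ℂ, ContinuousOn F (kmsStrip β) ∧ (∃ C : ℝ, ∀ z ∈ kmsStrip β, ‖F z‖ ≤ C) ∧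
      DifferentiableOn ℂ F (interior (kmsStrip β)) ∧
      (∀ t : ℝ, F t = ψ.functional hK.proper (a * α t b)) ∧
      ∀ t : ℝ, F (t + Complex.I * β) = ψ.functional hK.proper (α t b * a) := by
  obtain ⟨F, hc, hb, hd, hF⟩ := hK.kms a b ha ha' hb hb'
  exact ⟨F, hc, hb, hd, fun t => by rw [(hF t).1, functional_eq],
    fun t => by rw [(hF t).2, functional_eq]⟩

theorem IsKMS.functional_mul_comm_of_fixed (hK : ψ.IsKMS α β) {a d : A} (ha : a ∈ ψ.leftIdeal)
    (ha' : star a ∈ ψ.leftIdeal) (hd : d ∈ ψ.leftIdeal) (hd' : star d ∈ ψ.leftIdeal)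
    (hfix : ∀ t, α t d = d) :
    ψ.functional hK.proper (a * d) = ψ.functional hK.proper (d * a) := by
  obtain ⟨F, hFc, hFb, hFd, hF, hF'⟩ := hK.exists_strip ha ha' hd hd'
  exact edge_values_eq hFc hFb hFd (fun s => by rw [hF, hfix]) (fun s => by rw [hF', hfix])

theorem IsKMS.norm_functional_orbit_le (hK : ψ.IsKMS α β) {x : A} (hx : x ∈ ψ.leftIdeal)
    (r t : ℝ) :
    ‖ψ.functional hK.proper (star (α r x) * α t x)‖ ≤ (ψ.normSq x).toReal := by
  refine (norm_functional_star_mul_le hK.proper ((hK.invariant r).mem_leftIdeal hx)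
    ((hK.invariant t).mem_leftIdeal hx)).trans_eq ?_
  rw [gnsNorm_map (hK.invariant r), gnsNorm_map (hK.invariant t), ← pow_two, gnsNorm_sq]

theorem IsKMS.continuous_functional_orbit (hK : ψ.IsKMS α β) {x : A} (hx : x ∈ ψ.leftIdeal)
    (hx' : star x ∈ ψ.leftIdeal) :
    Continuous fun p : ℝ × ℝ => ψ.functional hK.proper (star (α p.1 x) * α p.2 x) := by
  obtain ⟨F, hFc, -, -, -, hF⟩ := hK.exists_strip hx hx' hx' (by rwa [star_star])
  have hcoef : ∀ p : ℝ × ℝ, ψ.functional hK.proper (star (α p.1 x) * α p.2 x) =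
      F ((p.1 - p.2 : ℝ) + Complex.I * β) := fun p => by
    have hdom : α (p.1 - p.2) (star x) * x ∈ ψ.defDomain := mul_mem_defDomain
      (by rw [← map_star, star_star]; exact (hK.invariant _).mem_leftIdeal hx) hx
    have hshift : α p.2 (α (p.1 - p.2) (star x) * x) = star (α p.1 x) * α p.2 x := by
      rw [map_mul, ← α.map_add', add_sub_cancel, map_star]
    rw [hF, ← hshift, functional_map hK.proper (hK.invariant p.2) hdom]
  simp_rw [hcoef]
  exact hFc.comp_continuous (by fun_prop) fun p => ofReal_add_I_mul_mem_kmsStrip β _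

theorem IsKMS.norm_integral_functional_orbit_le (hK : ψ.IsKMS α β) {x : A}
    (hx : x ∈ ψ.leftIdeal) (hx' : star x ∈ ψ.leftIdeal) (t : ℝ) :
    ‖∫ r, ψ.functional hK.proper (star (α r x) * α t x) ∂gaussMeasure‖ ≤
      Real.exp (β ^ 2) * (ψ.normSq (star x)).toReal := by
  have htx' : star (α t x) ∈ ψ.leftIdeal := by
    rw [← map_star]; exact (hK.invariant t).mem_leftIdeal hx'
  obtain ⟨F, hFc, hFb, hFd, hF, hF'⟩ := hK.exists_strip
    ((hK.invariant t).mem_leftIdeal hx) htx' hx' (by rwa [star_star])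
  have hbound : ∀ s : ℝ, ‖F s‖ ≤ (ψ.normSq (star x)).toReal := fun s => by
    have horbit := hK.norm_functional_orbit_le hx' t s
    rwa [map_star, star_star, ← hF] at horbit
  simpa only [hF', map_star] using norm_integral_gaussMeasure_add_I_mul_le hFc hFb hFd hbound

theorem IsKMS.normSq_gaussAvg_le (hK : ψ.IsKMS α β) {x : A} (hx : x ∈ ψ.leftIdeal) :
    ψ.normSq (α.gaussAvg x) ≤ ENNReal.ofReal (Real.exp (β ^ 2)) * ψ.normSq (star x) := by
  rcases eq_or_ne (ψ.normSq (star x)) ∞ with htop | hfin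
  · rw [htop, ENNReal.mul_top (ENNReal.ofReal_pos.2 (Real.exp_pos _)).ne']
    exact le_top
  have hx' : star x ∈ ψ.leftIdeal := hfin.lt_top
  calc ψ.normSq (α.gaussAvg x)
      ≤ ENNReal.ofReal ‖∫ t, ∫ r, ψ.functional hK.proper (star (α r x) * α t x)
          ∂gaussMeasure ∂gaussMeasure‖ := normSq_integral_le hK.proper
        (fun r => (hK.invariant r).mem_leftIdeal hx) (α.continuous' x)
        (fun r => (α.norm_apply r x).le) (hK.continuous_functional_orbit hx hx')
        (hK.norm_functional_orbit_le hx)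
    _ ≤ ENNReal.ofReal (Real.exp (β ^ 2) * (ψ.normSq (star x)).toReal) :=
        ENNReal.ofReal_le_ofReal <|
          norm_integral_gaussMeasure_le (hK.norm_integral_functional_orbit_le hx hx')
    _ = ENNReal.ofReal (Real.exp (β ^ 2)) * ψ.normSq (star x) := by
        rw [ENNReal.ofReal_mul (Real.exp_nonneg _), ENNReal.ofReal_toReal hfin]

theorem IsKMS.gaussAvg_mul_mem_leftIdeal (hK : ψ.IsKMS α β) {g h : A} (hg : IsSelfAdjoint g)
    (hh : 0 ≤ h) (hgfix : ∀ t, α t g = g) (hgh : g * h = g) (hhg : h * g = g) {b : A}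
    (hb : IsSelfAdjoint b) (hbmem : b ∈ ψ.leftIdeal) : α.gaussAvg b * g ∈ ψ.leftIdeal := by
  obtain ⟨d, hdfin, hdlim⟩ := mem_closure_iff_seq_limit.1 (hK.proper.dense ⟨h, hh⟩)
  replace hdlim : Tendsto (fun n => (d n : A)) atTop (𝓝 h) :=
    (continuous_subtype_val.tendsto _).comp hdlim
  have hlim : Tendsto (fun n => α.gaussAvg (b * g * d n)) atTop (𝓝 (α.gaussAvg b * g)) := by
    have hprod := α.tendsto_gaussAvg (hdlim.const_mul (b * g))
    rwa [mul_assoc b g h, hgh, α.gaussAvg_mul_of_fixed _ hgfix] at hprod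
  have hnorm : ∀ᶠ n in atTop, ‖(d n : A) * g‖ ≤ ‖g‖ + 1 := by
    have hdg := (hdlim.mul_const g).norm
    rw [hhg] at hdg
    exact hdg.eventually_le_const (lt_add_one _)
  have hstar : ∀ n, star (b * g * d n) = d n * g * b := fun n => by
    simp only [star_mul, hb.star_eq, (IsSelfAdjoint.of_nonneg (d n).2).star_eq, hg.star_eq,
      mul_assoc]
  refine (normSq_le_of_tendsto hK.proper hlim (r := ENNReal.ofReal (Real.exp (β ^ 2)) *
    (ENNReal.ofReal ((‖g‖ + 1) ^ 2) * ψ.normSq b)) ?_).trans_lt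
    (ENNReal.mul_lt_top ENNReal.ofReal_lt_top (ENNReal.mul_lt_top ENNReal.ofReal_lt_top hbmem))
  filter_upwards [hnorm] with n hn
  refine (hK.normSq_gaussAvg_le (mul_mem_leftIdeal hK.proper _
    (mem_leftIdeal_of_lt_top hK.proper _ (hdfin n)))).trans ?_
  rw [hstar]
  gcongr
  refine (normSq_mul_le hK.proper _ b).trans ?_
  gcongr

theorem star_mul_self_le_two_smul {g h S : A} (hh : IsSelfAdjoint h) (hhg : h * g = g)
    (hS : ‖h * h - star S * S‖ ≤ 1 / 2) : star g * g ≤ (2 : ℝ) • (star (S * g) * (S * g)) := by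
  have hsa : IsSelfAdjoint (h * h - star S * S) := by
    refine IsSelfAdjoint.sub ?_ (.star_mul_self S)
    simpa only [hh.star_eq] using IsSelfAdjoint.star_mul_self h
  have hgh : star g * h = star g := by
    rw [← hh.star_eq, ← star_mul, hhg]
  have hdiff : star g * (h * h - star S * S) * g = star g * g - star (S * g) * (S * g) := by
    rw [mul_sub, sub_mul, ← mul_assoc, hgh, hgh, star_mul]
    simp only [mul_assoc]
  have hhalf : star g * g - star (S * g) * (S * g) ≤ (1 / 2 : ℝ) • (star g * g) :=
    calc star g * g - star (S * g) * (S * g)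
        ≤ ‖h * h - star S * S‖ • (star g * g) :=
          hdiff ▸ CStarAlgebra.star_left_conjugate_le_norm_smul hsa
      _ ≤ (1 / 2 : ℝ) • (star g * g) :=
          smul_le_smul_of_nonneg_right hS (star_mul_self_nonneg g)
  have htwo := smul_le_smul_of_nonneg_left hhalf (zero_le_two (α := ℝ))
  rwa [smul_smul, smul_sub, show (2 : ℝ) * (1 / 2) = 1 by norm_num, one_smul,
    two_smul ℝ (star g * g), sub_le_iff_le_add, add_le_add_iff_left] at htwo

/-- If `b ∈ 𝒩_ψ` approximates `h`, then `b * g` need not lie in the left ideal `𝒩_ψ`, but `S * g`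
does for the Gaussian average `S` of `b`, and `S` still approximates the fixed element `h`. -/
theorem IsKMS.mem_leftIdeal_of_local_unit (hK : ψ.IsKMS α β) {g h : A} (hg : IsSelfAdjoint g)
    (hh : 0 ≤ h) (hgfix : ∀ t, α t g = g) (hhfix : ∀ t, α t h = h) (hhg : h * g = g) :
    g ∈ ψ.leftIdeal := by
  have hh' : IsSelfAdjoint h := .of_nonneg hh
  have hgh : g * h = g := by
    simpa only [star_mul, hg.star_eq, hh'.star_eq] using congrArg star hhg
  obtain ⟨b, hbfin, hblim⟩ := mem_closure_iff_seq_limit.1 (hK.proper.dense ⟨h, hh⟩)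
  have havg : Tendsto (fun n => α.gaussAvg (b n : A)) atTop (𝓝 h) := by
    have hval := (continuous_subtype_val.tendsto _).comp hblim
    rw [← α.gaussAvg_of_fixed hhfix]
    exact α.tendsto_gaussAvg hval
  have hclose : ∀ᶠ n in atTop,
      ‖h * h - star (α.gaussAvg (b n : A)) * α.gaussAvg (b n : A)‖ ≤ 1 / 2 := by
    have hdiff := ((havg.star.mul havg).const_sub (h * h)).norm
    rw [hh'.star_eq, sub_self, norm_zero] at hdiff
    exact hdiff.eventually_le_const (by norm_num)
  obtain ⟨n, hn⟩ := hclose.exists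
  have hmem : α.gaussAvg (b n : A) * g ∈ ψ.leftIdeal :=
    hK.gaussAvg_mul_mem_leftIdeal hg hh hgfix hgh hhg (.of_nonneg (b n).2)
      (mem_leftIdeal_of_lt_top hK.proper _ (hbfin n))
  refine (ψ.mono (b := ⟨_, smul_nonneg zero_le_two (star_mul_self_nonneg _)⟩)
    (star_mul_self_le_two_smul hh' hhg hn)).trans_lt ?_
  rw [apply_smul hK.proper zero_le_two ⟨_, star_mul_self_nonneg (α.gaussAvg (b n : A) * g)⟩]
  exact ENNReal.mul_lt_top ENNReal.ofReal_lt_top hmem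

end CStarWeight


/-! ### Functions on the unit space as elements of `C_c(G)` -/

namespace EtaleGroupoid

theorem exists_mul_self_eq {X : Type*} [TopologicalSpace X] {u : C_c(X, ℝ)} (hu : ∀ x, 0 ≤ u x) :
    ∃ v : C_c(X, ℝ), v * v = u := by
  refine ⟨⟨⟨fun x => √(u x), u.continuous.sqrt⟩, u.hasCompactSupport.comp_left Real.sqrt_zero⟩, ?_⟩
  ext x
  exact Real.mul_self_sqrt (hu x)

/-- The product of a compactly supported function with the indicator function of a clopen set. -/
noncomputable def restrictClopen {X : Type*} [TopologicalSpace X] {S : Set X} (hS : IsClopen S)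
    (f : C_c(X, ℂ)) : C_c(X, ℂ) :=
  ⟨⟨S.indicator f, f.continuous.indicator (by simp [hS.frontier_eq])⟩,
    f.hasCompactSupport.mono (by
      rw [support_indicator]
      exact inter_subset_right)⟩

theorem restrictClopen_apply {X : Type*} [TopologicalSpace X] {S : Set X} (hS : IsClopen S)
    (f : C_c(X, ℂ)) (x : X) : restrictClopen hS f x = S.indicator f x := rfl

theorem tsupport_restrictClopen_subset {X : Type*} [TopologicalSpace X] {S : Set X}
    (hS : IsClopen S) (f : C_c(X, ℂ)) : tsupport (restrictClopen hS f) ⊆ S :=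
  closure_minimal (support_indicator_subset (f := f)) hS.isClosed

variable {G : Type*} [TopologicalSpace G] [EtaleGroupoid G]

theorem isOpen_unitSpace : IsOpen (unitSpace G) := by
  refine isOpen_iff_mem_nhds.2 fun x hx => ?_
  obtain ⟨V, hV, hxV, hr, -⟩ := exists_bisection x
  have hrange : ∀ᶠ g in 𝓝 x, range g ∈ V :=
    continuous_range.continuousAt.eventually (hV.mem_nhds (by rwa [show range x = x from hx]))
  filter_upwards [hrange, hV.mem_nhds hxV] with g hgr hg
  exact hr hgr hg (range_range g)

theorem isClopen_unitSpace [T2Space G] : IsClopen (unitSpace G) :=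
  ⟨isClosed_unitSpace, isOpen_unitSpace⟩

theorem inv_unit {x : G} (hx : x ∈ unitSpace G) : inv x = x := by
  have hx' : range x = x := hx
  have h := range_mul_self (inv x)
  rw [range_inv, source_unit hx'] at h
  rw [← h, mul_inv, hx']

theorem inv_mem_unitSpace {g : G} : inv g ∈ unitSpace G ↔ g ∈ unitSpace G := by
  refine ⟨fun h => ?_, fun h => by rwa [inv_unit h]⟩
  have hg := inv_unit h
  rw [inv_inv] at hg
  rwa [hg]

theorem eq_of_inv_mul_mem_unitSpace {g h : G} (hr : range h = range g)
    (hu : mul (inv h) g ∈ unitSpace G) : h = g := by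
  have hs : source h = mul (inv h) g := by
    rw [← range_inv, ← range_mul _ _ ((source_inv h).trans hr)]
    exact hu
  have hg := mul_inv_cancel_left hr
  rwa [← hs, self_mul_source] at hg

theorem RealHom.map_unit (c : RealHom G) {x : G} (hx : x ∈ unitSpace G) : c x = 0 := by
  have hx' : range x = x := hx
  have hmul := c.map_mul' x x ((source_unit hx').trans hx'.symm)
  have hxx := range_mul_self x
  rw [hx'] at hxx
  rw [hxx] at hmul
  linarith

/-- The range of an arrow, as a point of the unit space. -/
def rangeUnit (g : G) : unitSpace G := ⟨range g, range_range g⟩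

/-- The source of an arrow, as a point of the unit space. -/
def sourceUnit (g : G) : unitSpace G := ⟨source g, range_source g⟩

theorem continuous_rangeUnit : Continuous (rangeUnit : G → unitSpace G) :=
  continuous_range.subtype_mk _

theorem continuous_sourceUnit : Continuous (sourceUnit : G → unitSpace G) :=
  continuous_source.subtype_mk _

theorem rangeUnit_coe (x : unitSpace G) : rangeUnit (x : G) = x := Subtype.ext x.2

theorem sourceUnit_coe (x : unitSpace G) : sourceUnit (x : G) = x := Subtype.ext (source_unit x.2)

theorem convFun_of_left_diag {d : G → ℂ} (hd : ∀ g, g ∉ unitSpace G → d g = 0) (f : G → ℂ) (g : G) :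
    convFun d f g = d (range g) * f g := by
  rw [convFun, tsum_eq_single (⟨range g, range_range g⟩ : {h : G // range h = range g})]
  · simp only [inv_unit (range_range g), range_mul_self]
  · rintro ⟨h, hr⟩ hne
    have hh : h ∉ unitSpace G := fun hh => hne (Subtype.ext (hh.symm.trans hr))
    simp only [hd h hh, zero_mul]

theorem convFun_of_right_diag {d : G → ℂ} (hd : ∀ g, g ∉ unitSpace G → d g = 0) (f : G → ℂ)
    (g : G) : convFun f d g = f g * d (source g) := by
  rw [convFun, tsum_eq_single (⟨g, rfl⟩ : {h : G // range h = range g})]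
  · simp only [inv_mul]
  · rintro ⟨h, hr⟩ hne
    have hh : mul (inv h) g ∉ unitSpace G := fun hh =>
      hne (Subtype.ext (eq_of_inv_mul_mem_unitSpace hr hh))
    simp only [hd _ hh, mul_zero]

section Diagonal

variable [T2Space G]

/-- The inclusion of the real-valued part of `C_c(G⁽⁰⁾)` in `C_c(G)` by extension by zero. -/
noncomputable def diagCc : C_c(unitSpace G, ℝ) →ₗ[ℝ] C_c(G, ℂ) where
  toFun u :=
    { toFun := (unitSpace G).indicator fun g => (u (rangeUnit g) : ℂ)
      continuous_toFun := (Complex.continuous_ofReal.comp (u.continuous.comp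
        continuous_rangeUnit)).indicator (by simp [isClopen_unitSpace.frontier_eq])
      hasCompactSupport' := by
        refine HasCompactSupport.intro
          (u.hasCompactSupport.isCompact.image continuous_subtype_val) fun g hg => ?_
        refine indicator_apply_eq_zero.2 fun hgu => ?_
        have hu : rangeUnit g ∉ tsupport u := fun h => hg ⟨_, h, hgu⟩
        rw [image_eq_zero_of_notMem_tsupport hu, Complex.ofReal_zero] }
  map_add' u v := by
    ext g
    by_cases hg : g ∈ unitSpace G <;> simp [hg]
  map_smul' r u := by
    ext g
    by_cases hg : g ∈ unitSpace G <;> simp [hg]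

theorem diagCc_apply (u : C_c(unitSpace G, ℝ)) (g : G) :
    diagCc u g = (unitSpace G).indicator (fun g => (u (rangeUnit g) : ℂ)) g := rfl

theorem diagCc_coe (u : C_c(unitSpace G, ℝ)) (x : unitSpace G) : diagCc u (x : G) = u x := by
  rw [diagCc_apply, indicator_of_mem x.2, rangeUnit_coe]

theorem diagCc_of_notMem (u : C_c(unitSpace G, ℝ)) {g : G} (hg : g ∉ unitSpace G) :
    diagCc u g = 0 := by
  rw [diagCc_apply, indicator_of_notMem hg]

theorem eq_diagCc {u : C_c(unitSpace G, ℝ)} {f : C_c(G, ℂ)}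
    (hunit : ∀ x : unitSpace G, f (x : G) = u x) (hzero : ∀ g, g ∉ unitSpace G → f g = 0) :
    f = diagCc u := by
  ext g
  by_cases hg : g ∈ unitSpace G
  · rw [hunit ⟨g, hg⟩, diagCc_coe u ⟨g, hg⟩]
  · rw [hzero g hg, diagCc_of_notMem u hg]

theorem twist_diagCc (c : RealHom G) (t : ℝ) (u : C_c(unitSpace G, ℝ)) :
    c.twist t (diagCc u) = diagCc u := by
  refine eq_diagCc (fun x => ?_) (fun g hg => ?_)
  · change Complex.exp (Complex.I * t * c x) * diagCc u x = _
    rw [c.map_unit x.2, diagCc_coe]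
    simp
  · change Complex.exp (Complex.I * t * c g) * diagCc u g = _
    rw [diagCc_of_notMem u hg, mul_zero]

theorem invol_diagCc (u : C_c(unitSpace G, ℝ)) : invol (diagCc u) = diagCc u := by
  refine eq_diagCc (fun x => ?_) (fun g hg => ?_)
  · change star (diagCc u (inv (x : G))) = _
    rw [inv_unit x.2, diagCc_coe]
    simp
  · change star (diagCc u (inv g)) = _
    rw [diagCc_of_notMem u fun h => hg (inv_mem_unitSpace.1 h), star_zero]

theorem exists_restrict_unitSpace_eq (f : C_c(G, ℂ)) :
    ∃ p q : C_c(unitSpace G, ℝ),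
      restrictClopen isClopen_unitSpace f = diagCc p + Complex.I • diagCc q ∧
        ∀ x : unitSpace G, f x = p x + Complex.I * q x := by
  let v : C_c(unitSpace G, ℂ) := ⟨⟨fun x => f x, f.continuous.comp continuous_subtype_val⟩,
    f.hasCompactSupport.comp_isClosedEmbedding isClosed_unitSpace.isClosedEmbedding_subtypeVal⟩
  let p : C_c(unitSpace G, ℝ) := ⟨⟨fun x => (v x).re, Complex.continuous_re.comp v.continuous⟩,
    v.hasCompactSupport.comp_left Complex.zero_re⟩
  let q : C_c(unitSpace G, ℝ) := ⟨⟨fun x => (v x).im, Complex.continuous_im.comp v.continuous⟩,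
    v.hasCompactSupport.comp_left Complex.zero_im⟩
  have hpq (x : unitSpace G) : f x = p x + Complex.I * q x := by
    rw [_root_.mul_comm]
    exact (Complex.re_add_im (f x)).symm
  refine ⟨p, q, ?_, hpq⟩
  ext g
  rw [restrictClopen_apply, CompactlySupportedContinuousMap.add_apply,
    CompactlySupportedContinuousMap.smul_apply, smul_eq_mul]
  by_cases hg : g ∈ unitSpace G
  · rw [indicator_of_mem hg, diagCc_coe p ⟨g, hg⟩, diagCc_coe q ⟨g, hg⟩, ← hpq]
  · rw [indicator_of_notMem hg, diagCc_of_notMem p hg, diagCc_of_notMem q hg, mul_zero, add_zero]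

variable [LocallyCompactSpace G]

theorem conv_diagCc_left (u : C_c(unitSpace G, ℝ)) (f : C_c(G, ℂ)) (g : G) :
    conv (diagCc u) f g = u (rangeUnit g) * f g := by
  rw [← diagCc_coe]
  exact convFun_of_left_diag (fun g hg => diagCc_of_notMem u hg) f g

theorem conv_diagCc_right (u : C_c(unitSpace G, ℝ)) (f : C_c(G, ℂ)) (g : G) :
    conv f (diagCc u) g = f g * u (sourceUnit g) := by
  rw [← diagCc_coe]
  exact convFun_of_right_diag (fun g hg => diagCc_of_notMem u hg) f g

theorem conv_diagCc_left_eq_smul {u : C_c(unitSpace G, ℝ)} {f : C_c(G, ℂ)} {r : ℝ}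
    (h : ∀ g ∈ tsupport f, u (rangeUnit g) = r) : conv (diagCc u) f = (r : ℂ) • f := by
  ext g
  rw [conv_diagCc_left, CompactlySupportedContinuousMap.smul_apply, smul_eq_mul]
  by_cases hg : f g = 0
  · rw [hg, mul_zero, mul_zero]
  · rw [h g (subset_tsupport _ hg)]

theorem conv_diagCc_right_eq_smul {u : C_c(unitSpace G, ℝ)} {f : C_c(G, ℂ)} {r : ℝ}
    (h : ∀ g ∈ tsupport f, u (sourceUnit g) = r) : conv f (diagCc u) = (r : ℂ) • f := by
  ext g
  rw [conv_diagCc_right, CompactlySupportedContinuousMap.smul_apply, smul_eq_mul,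
    _root_.mul_comm]
  by_cases hg : f g = 0
  · rw [hg, mul_zero, mul_zero]
  · rw [h g (subset_tsupport _ hg)]

theorem conv_diagCc_diagCc (u v : C_c(unitSpace G, ℝ)) :
    conv (diagCc u) (diagCc v) = diagCc (u * v) := by
  refine eq_diagCc (fun x => ?_) (fun g hg => ?_)
  · rw [conv_diagCc_left, rangeUnit_coe, diagCc_coe]
    exact (Complex.ofReal_mul _ _).symm
  · rw [conv_diagCc_left, diagCc_of_notMem v hg, mul_zero]

instance : LocallyCompactSpace (unitSpace G) :=
  isClosed_unitSpace.isClosedEmbedding_subtypeVal.locallyCompactSpace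

theorem exists_cutoff {K L : Set (unitSpace G)} (hK : IsCompact K) (hL : IsClosed L)
    (hKL : Disjoint K L) : ∃ u : C_c(unitSpace G, ℝ), (∀ x ∈ K, u x = 1) ∧ (∀ x ∈ L, u x = 0) ∧
      ∀ x, u x ∈ Icc (0 : ℝ) 1 := by
  obtain ⟨u, hone, hzero, hsupp, hIcc⟩ := exists_continuous_one_zero_of_isCompact hK hL hKL
  exact ⟨⟨u, hsupp⟩, hone, hzero, hIcc⟩

theorem exists_local_unit (f : C_c(G, ℂ)) :
    ∃ v : C_c(unitSpace G, ℝ), (∀ x, v x ∈ Icc (0 : ℝ) 1) ∧ conv (diagCc v) f = f ∧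
      conv f (diagCc v) = f := by
  have hK := f.hasCompactSupport.isCompact
  obtain ⟨v, hone, -, hIcc⟩ := exists_cutoff
    ((hK.image continuous_rangeUnit).union (hK.image continuous_sourceUnit)) isClosed_empty
    (disjoint_empty _)
  have hleft := conv_diagCc_left_eq_smul fun g hg => hone _ (Or.inl (mem_image_of_mem _ hg))
  have hright := conv_diagCc_right_eq_smul fun g hg => hone _ (Or.inr (mem_image_of_mem _ hg))
  rw [Complex.ofReal_one, one_smul] at hleft hright
  exact ⟨v, hIcc, hleft, hright⟩

end Diagonal

end EtaleGroupoid

/-! ### Invariant central functionals on `C_c(G)` -/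

namespace EtaleGroupoid

theorem exp_I_mul_sub_one_ne_zero {x : ℝ} (hx : x ≠ 0) (hlt : |x| < 2 * Real.pi) :
    Complex.exp (Complex.I * x) - 1 ≠ 0 := by
  intro h
  have hcos : Real.cos x = 1 := by
    rw [← Complex.exp_ofReal_mul_I_re, _root_.mul_comm, sub_eq_zero.1 h, Complex.one_re]
  exact hx ((Real.cos_eq_one_iff_of_lt_of_lt (neg_lt_of_abs_lt hlt) (lt_of_abs_lt hlt)).1 hcos)

theorem eq_zero_of_locally_eq_zero {X : Type*} [TopologicalSpace X] [T2Space X]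
    [LocallyCompactSpace X] {Φ : C_c(X, ℂ) →ₗ[ℂ] ℂ} {f : C_c(X, ℂ)}
    (h : ∀ x ∈ tsupport f, ∃ V, IsOpen V ∧ x ∈ V ∧ ∀ q : C_c(X, ℂ), tsupport q ⊆ V → Φ q = 0) :
    Φ f = 0 := by
  have hK := f.hasCompactSupport.isCompact
  choose V hV hxV hΦ using fun x : tsupport f => h x x.2
  obtain ⟨t, ht⟩ := hK.elim_finite_subcover V hV fun x hx => mem_iUnion.2 ⟨⟨x, hx⟩, hxV _⟩
  obtain ⟨ρ, hρV, -⟩ := PartitionOfUnity.exists_isSubordinate_of_locallyFinite_t2space hK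
    (fun i : t => V i) (fun i => hV i) (locallyFinite_of_finite _)
    (by rwa [iUnion_subtype])
  let q (i : t) : C_c(X, ℂ) := ⟨⟨fun x => (ρ i x : ℂ) * f x,
    (Complex.continuous_ofReal.comp (ρ i).continuous).mul f.continuous⟩,
    f.hasCompactSupport.mul_left⟩
  have hsupp (i : t) : tsupport (q i) ⊆ V i := by
    refine (closure_mono fun x hx => ?_).trans (hρV i)
    exact Complex.ofReal_ne_zero.1 (left_ne_zero_of_mul hx)
  have hsum : f = ∑ i, q i := by
    ext x
    rw [CompactlySupportedContinuousMap.sum_apply]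
    change f x = ∑ i, (ρ i x : ℂ) * f x
    by_cases hx : f x = 0
    · simp only [hx, mul_zero, Finset.sum_const_zero]
    · rw [← Finset.sum_mul, ← Complex.ofReal_sum,
        ρ.sum_finsupport' (subset_tsupport _ hx) (Finset.subset_univ _), Complex.ofReal_one,
        one_mul]
  rw [hsum, map_sum]
  exact Finset.sum_eq_zero fun i _ => hΦ i (q i) (hsupp i)

variable {G : Type*} [TopologicalSpace G] [EtaleGroupoid G]

theorem RealHom.isClopen_ker {c : RealHom G} (hopen : IsOpen c.ker) : IsClopen c.ker :=
  ⟨isClosed_eq c.continuous' continuous_const, hopen⟩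

theorem RealHom.exists_exp_sub_one_ne_zero {c : RealHom G} {K : Set G} (hK : IsCompact K)
    (hKc : Disjoint K c.ker) :
    ∃ t : ℝ, ∀ g ∈ K, Complex.exp (Complex.I * t * c g) - 1 ≠ 0 := by
  obtain ⟨B, hB⟩ := hK.exists_bound_of_continuousOn c.continuous'.continuousOn
  obtain ⟨t, ht, htB⟩ : ∃ t : ℝ, 0 < t ∧ t * max B 1 < 2 * Real.pi := by
    refine ⟨(max B 1)⁻¹, by positivity, ?_⟩
    rw [inv_mul_cancel₀ (by positivity)]
    linarith [Real.pi_gt_three]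
  refine ⟨t, fun g hg => ?_⟩
  have hcg : c g ≠ 0 := fun h => disjoint_left.1 hKc hg h
  have hlt : |t * c g| < 2 * Real.pi := by
    rw [abs_mul, abs_of_pos ht]
    exact (mul_le_mul_of_nonneg_left ((hB g hg).trans (le_max_left _ _)) ht.le).trans_lt htB
  simpa [_root_.mul_assoc] using exp_I_mul_sub_one_ne_zero (mul_ne_zero ht.ne' hcg) hlt

/-- Functions supported off `ker c` are coboundaries for the twisting by `c`: divide by
`exp (i t c) - 1`, which has no zeros on the support when `t` is small. -/
theorem RealHom.exists_twist_sub {c : RealHom G} {f : C_c(G, ℂ)}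
    (hf : Disjoint (tsupport f) c.ker) : ∃ (t : ℝ) (k : C_c(G, ℂ)), f = c.twist t k - k := by
  obtain ⟨t, ht⟩ := RealHom.exists_exp_sub_one_ne_zero f.hasCompactSupport.isCompact hf
  have hcont : Continuous fun g => f g * (Complex.exp (Complex.I * t * c g) - 1)⁻¹ := by
    have hexp : Continuous fun g => Complex.exp (Complex.I * t * c g) - 1 :=
      (Complex.continuous_exp.comp (continuous_const.mul
        (Complex.continuous_ofReal.comp c.continuous'))).sub continuous_const
    refine continuous_of_tsupport fun g hg => ?_
    exact f.continuous.continuousAt.mul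
      (hexp.continuousAt.inv₀ (ht g (tsupport_mul_subset_left hg)))
  refine ⟨t, ⟨⟨_, hcont⟩, f.hasCompactSupport.mul_right⟩, ?_⟩
  ext g
  change f g = Complex.exp (Complex.I * t * c g) * (f g * _) - f g * _
  by_cases hg : f g = 0
  · simp [hg]
  · have := ht g (subset_tsupport _ hg)
    field_simp

variable [T2Space G]

theorem exists_separating_nhd {g : G} (hg : range g ≠ source g) :
    ∃ V : Set G, IsOpen V ∧ g ∈ V ∧ ∀ a ∈ V, ∀ b ∈ V, range a ≠ source b := by
  obtain ⟨U, W, hU, hW, hgU, hgW, hdisj⟩ := t2_separation hg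
  refine ⟨range ⁻¹' U ∩ source ⁻¹' W, (hU.preimage continuous_range).inter
    (hW.preimage continuous_source), ⟨hgU, hgW⟩, fun a ha b hb e => ?_⟩
  exact disjoint_left.1 hdisj ha.1 (e ▸ hb.2)

variable [LocallyCompactSpace G]

theorem eq_zero_of_disjoint_range_source {Φ : C_c(G, ℂ) →ₗ[ℂ] ℂ}
    (hcomm : ∀ u f, Φ (conv (diagCc u) f) = Φ (conv f (diagCc u))) {f : C_c(G, ℂ)}
    (hf : ∀ a ∈ tsupport f, ∀ b ∈ tsupport f, range a ≠ source b) : Φ f = 0 := by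
  have hK := f.hasCompactSupport.isCompact
  have hdisj : Disjoint (rangeUnit '' tsupport f) (sourceUnit '' tsupport f) := by
    refine disjoint_left.2 ?_
    rintro _ ⟨a, ha, rfl⟩ ⟨b, hb, hab⟩
    exact hf a ha b hb (congrArg Subtype.val hab).symm
  obtain ⟨u, hone, hzero, -⟩ := exists_cutoff (hK.image continuous_rangeUnit)
    (hK.image continuous_sourceUnit).isClosed hdisj
  have h := hcomm u f
  rwa [conv_diagCc_left_eq_smul fun g hg => hone _ (mem_image_of_mem _ hg),
    conv_diagCc_right_eq_smul fun g hg => hzero _ (mem_image_of_mem _ hg),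
    Complex.ofReal_one, one_smul, Complex.ofReal_zero, zero_smul, map_zero] at h

theorem eq_zero_of_range_ne_source {Φ : C_c(G, ℂ) →ₗ[ℂ] ℂ}
    (hcomm : ∀ u f, Φ (conv (diagCc u) f) = Φ (conv f (diagCc u))) {f : C_c(G, ℂ)}
    (hf : ∀ g ∈ tsupport f, range g ≠ source g) : Φ f = 0 := by
  refine eq_zero_of_locally_eq_zero fun g hg => ?_
  obtain ⟨V, hV, hgV, hsep⟩ := exists_separating_nhd (hf g hg)
  exact ⟨V, hV, hgV, fun q hq => eq_zero_of_disjoint_range_source hcomm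
    fun a ha b hb => hsep a (hq ha) b (hq hb)⟩

theorem eq_restrict_unitSpace {c₀ : RealHom G}
    (hiso : ∀ x ∈ unitSpace G, isotropy x ∩ c₀.ker = {x}) (hopen : IsOpen c₀.ker)
    {Φ : C_c(G, ℂ) →ₗ[ℂ] ℂ}
    (hcomm : ∀ u f, Φ (conv (diagCc u) f) = Φ (conv f (diagCc u)))
    (hinv : ∀ t f, Φ (c₀.twist t f) = Φ f) (f : C_c(G, ℂ)) :
    Φ f = Φ (restrictClopen isClopen_unitSpace f) := by
  have hker := RealHom.isClopen_ker hopen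
  let fOff := restrictClopen hker.compl f
  let fKer := restrictClopen (hker.inter isClopen_unitSpace.compl) f
  have hsum : f = fOff + fKer + restrictClopen isClopen_unitSpace f := by
    ext g
    simp only [fOff, fKer, CompactlySupportedContinuousMap.add_apply, restrictClopen_apply]
    by_cases hg : g ∈ unitSpace G
    · simp [hg, show g ∈ c₀.ker from c₀.map_unit hg]
    · by_cases hgker : g ∈ c₀.ker <;> simp [hg, hgker]
  have hOff : Φ fOff = 0 := by
    obtain ⟨t, k, hk⟩ := RealHom.exists_twist_sub (c := c₀) (f := fOff)
      (disjoint_left.2 (tsupport_restrictClopen_subset hker.compl f))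
    rw [hk, map_sub, hinv, sub_self]
  have hKer : Φ fKer = 0 := by
    refine eq_zero_of_range_ne_source hcomm fun g hg hrs => ?_
    obtain ⟨hgker, hgunit⟩ := tsupport_restrictClopen_subset _ f hg
    have hgx : g ∈ isotropy (source g) ∩ c₀.ker := ⟨⟨hrs, rfl⟩, hgker⟩
    rw [hiso _ (range_source g)] at hgx
    exact hgunit (hgx ▸ range_source g)
  conv_lhs => rw [hsum]
  rw [map_add, map_add, hOff, hKer, zero_add, zero_add]

end EtaleGroupoid

/-! ### The diagonal of the reduced groupoid C*-algebra -/

namespace EtaleGroupoid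

variable {G : Type*} [TopologicalSpace G] [EtaleGroupoid G] [T2Space G] [LocallyCompactSpace G]

namespace ReducedCStarAlgebra

theorem ofCc_mul (f₁ f₂ : C_c(G, ℂ)) : ofCc f₁ * ofCc f₂ = ofCc (conv f₁ f₂) :=
  incl_injective (regRep_conv f₁ f₂).symm

theorem star_ofCc (f : C_c(G, ℂ)) : star (ofCc f) = ofCc (invol f) :=
  incl_injective (regRep_invol f).symm

/-- The canonical map `C_c(G) → C*_r(G)`, as a linear map. -/
noncomputable def ofCcLinear : C_c(G, ℂ) →ₗ[ℂ] ReducedCStarAlgebra G where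
  toFun := ofCc
  map_add' f₁ f₂ := incl_injective (regRep_add f₁ f₂)
  map_smul' z f := incl_injective (regRep_smul z f)

theorem denseRange_ofCc : DenseRange (ofCc (G := G)) := by
  refine Metric.dense_iff.2 fun a ε hε => ?_
  obtain ⟨f, hf⟩ := exists_approx a hε
  exact ⟨ofCc f, by rwa [Metric.mem_ball, dist_comm, dist_eq_norm], f, rfl⟩

/-- The inclusion of the real-valued part of `C_c(G⁽⁰⁾)` in `C*_r(G)`. -/
noncomputable def ofUnits : C_c(unitSpace G, ℝ) →ₗ[ℝ] ReducedCStarAlgebra G :=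
  ofCcLinear.restrictScalars ℝ ∘ₗ diagCc

theorem ofUnits_apply (u : C_c(unitSpace G, ℝ)) : ofUnits u = ofCc (diagCc u) := rfl

theorem ofUnits_mul (u v : C_c(unitSpace G, ℝ)) : ofUnits u * ofUnits v = ofUnits (u * v) := by
  rw [ofUnits_apply, ofUnits_apply, ofCc_mul, conv_diagCc_diagCc, ofUnits_apply]

theorem star_ofUnits (u : C_c(unitSpace G, ℝ)) : star (ofUnits u) = ofUnits u := by
  rw [ofUnits_apply, star_ofCc, invol_diagCc]

theorem sigma_ofUnits (c : RealHom G) (t : ℝ) (u : C_c(unitSpace G, ℝ)) :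
    sigma c t (ofUnits u) = ofUnits u := by
  change sigmaAut c t (ofCc _) = _
  rw [sigmaAut_ofCc, twist_diagCc, ofUnits_apply]

theorem ofUnits_nonneg {u : C_c(unitSpace G, ℝ)} (hu : ∀ x, 0 ≤ u x) : 0 ≤ ofUnits u := by
  obtain ⟨v, rfl⟩ := exists_mul_self_eq hu
  rw [← ofUnits_mul]
  nth_rw 1 [← star_ofUnits v]
  exact star_mul_self_nonneg _

theorem norm_ofUnits_le_one {u : C_c(unitSpace G, ℝ)} (hu : ∀ x, u x ∈ Icc (0 : ℝ) 1) :
    ‖ofUnits u‖ ≤ 1 := by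
  have hle : ofUnits (u * u) ≤ ofUnits u := by
    rw [← sub_nonneg, ← map_sub]
    exact ofUnits_nonneg fun x => sub_nonneg.2 (mul_le_of_le_one_left (hu x).1 (hu x).2)
  have hnorm : ‖ofUnits u‖ * ‖ofUnits u‖ ≤ ‖ofUnits u‖ := by
    rw [← CStarRing.norm_star_mul_self, star_ofUnits, ofUnits_mul]
    exact CStarAlgebra.norm_le_norm_of_nonneg_of_le
      (ofUnits_nonneg fun x => mul_self_nonneg (u x)) hle
  by_contra! hlt
  exact hnorm.not_gt (lt_mul_of_one_lt_left (by linarith) hlt)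

theorem exists_tendsto_mul_ofUnits (b : ReducedCStarAlgebra G) :
    ∃ u : ℕ → C_c(unitSpace G, ℝ), (∀ n x, u n x ∈ Icc (0 : ℝ) 1) ∧
      Tendsto (fun n => b * ofUnits (u n)) atTop (𝓝 b) := by
  choose f hf using fun n : ℕ => exists_approx b (Nat.one_div_pos_of_nat (α := ℝ) (n := n))
  have hunit (n : ℕ) : ∃ v : C_c(unitSpace G, ℝ), (∀ x, v x ∈ Icc (0 : ℝ) 1) ∧
      conv (f n) (diagCc v) = f n := by
    obtain ⟨v, hv, -, hfv⟩ := exists_local_unit (f n)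
    exact ⟨v, hv, hfv⟩
  choose u hu hfu using hunit
  refine ⟨u, hu, tendsto_iff_norm_sub_tendsto_zero.2 ?_⟩
  have hbound (n : ℕ) : ‖b * ofUnits (u n) - b‖ ≤ 1 / ((n : ℝ) + 1) + 1 / ((n : ℝ) + 1) := by
    have hfix : ofCc (f n) * ofUnits (u n) = ofCc (f n) := by
      rw [ofUnits_apply, ofCc_mul, hfu]
    have hsplit : b * ofUnits (u n) - b =
        (b - ofCc (f n)) * ofUnits (u n) - (b - ofCc (f n)) := by
      rw [sub_mul, hfix]; abel
    have hmul : ‖(b - ofCc (f n)) * ofUnits (u n)‖ ≤ ‖b - ofCc (f n)‖ :=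
      (norm_mul_le _ _).trans
        (mul_le_of_le_one_right (norm_nonneg _) (norm_ofUnits_le_one (hu n)))
    rw [hsplit]
    exact (norm_sub_le _ _).trans (add_le_add (hmul.trans (hf n).le) (hf n).le)
  refine squeeze_zero (fun n => norm_nonneg _) hbound ?_
  simpa only [add_zero] using (tendsto_one_div_add_atTop_nhds_zero_nat (𝕜 := ℝ)).add
    (tendsto_one_div_add_atTop_nhds_zero_nat (𝕜 := ℝ))

theorem tendsto_condExp {ι : Type*} {l : Filter ι} {a : ι → ReducedCStarAlgebra G}
    {b : ReducedCStarAlgebra G} (hlim : Tendsto a l (𝓝 b)) (x : unitSpace G) :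
    Tendsto (fun i => condExp (a i) x) l (𝓝 (condExp b x)) := by
  refine tendsto_iff_norm_sub_tendsto_zero.2 (squeeze_zero (fun i => norm_nonneg _) (fun i => ?_)
    (tendsto_iff_norm_sub_tendsto_zero.1 hlim))
  rw [← ZeroAtInftyContinuousMap.sub_apply, ← map_sub]
  exact norm_diag_le _ x

theorem condExp_conj_ofUnits (u : C_c(unitSpace G, ℝ)) (a : ReducedCStarAlgebra G)
    (x : unitSpace G) :
    condExp (ofUnits u * a * ofUnits u) x = (u x : ℂ) ^ 2 * condExp a x := by
  refine congrFun (Continuous.ext_on (f := fun a => condExp (ofUnits u * a * ofUnits u) x)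
    (g := fun a => (u x : ℂ) ^ 2 * condExp a x) denseRange_ofCc ?_ ?_ ?_) a
  · exact continuous_iff_continuousAt.2 fun a => tendsto_condExp
      ((continuous_const.mul continuous_id).mul continuous_const).continuousAt x
  · exact continuous_iff_continuousAt.2 fun a => (tendsto_condExp tendsto_id x).const_mul _
  · rintro _ ⟨f, rfl⟩
    simp only [ofUnits_apply, ofCc_mul, condExp_ofCc, conv_diagCc_right, conv_diagCc_left,
      rangeUnit_coe, sourceUnit_coe]
    ring

theorem condExp_nonneg_re {a : ReducedCStarAlgebra G} (ha : 0 ≤ a) (x : unitSpace G) :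
    0 ≤ (condExp a x).re := by
  obtain ⟨r, hr, hcond⟩ := condExp_nonneg a ha x
  rwa [hcond, Complex.ofReal_re]

theorem star_mul_ofUnits_mul_self (b : ReducedCStarAlgebra G) (u : C_c(unitSpace G, ℝ)) :
    star (b * ofUnits u) * (b * ofUnits u) = ofUnits u * (star b * b) * ofUnits u := by
  simp only [star_mul, star_ofUnits, _root_.mul_assoc]

section Measure

variable [MeasurableSpace G] {m : Measure (unitSpace G)}

theorem phi_mul_ofUnits_le (b : ReducedCStarAlgebra G) {u : C_c(unitSpace G, ℝ)}
    (hu : ∀ x, u x ∈ Icc (0 : ℝ) 1) :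
    phi m ⟨star (b * ofUnits u) * (b * ofUnits u), star_mul_self_nonneg _⟩ ≤
      phi m ⟨star b * b, star_mul_self_nonneg b⟩ := by
  refine lintegral_mono fun x => ENNReal.ofReal_le_ofReal ?_
  simp only [star_mul_ofUnits_mul_self, condExp_conj_ofUnits]
  rw [← Complex.ofReal_pow, Complex.re_ofReal_mul]
  exact mul_le_of_le_one_left (condExp_nonneg_re (star_mul_self_nonneg b) x)
    (pow_le_one₀ (hu x).1 (hu x).2)

theorem phi_eq_ofReal_integral {a : ReducedCStarAlgebra G} (ha : 0 ≤ a)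
    (hint : Integrable (fun x => condExp a x) m) :
    phi m ⟨a, ha⟩ = ENNReal.ofReal (∫ x, condExp a x ∂m).re := by
  have hre : (∫ x, condExp a x ∂m).re = ∫ x, (condExp a x).re ∂m := (integral_re hint).symm
  rw [hre]
  exact (ofReal_integral_eq_lintegral_ofReal hint.re
    (Eventually.of_forall fun x => condExp_nonneg_re ha x)).symm

variable [BorelSpace G]

theorem phi_le_of_tendsto {a : ℕ → ReducedCStarAlgebra G} {b : ReducedCStarAlgebra G} (hb : 0 ≤ b)
    (ha : ∀ n, 0 ≤ a n) (hlim : Tendsto a atTop (𝓝 b)) {r : ℝ≥0∞}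
    (hr : ∀ n, phi m ⟨a n, ha n⟩ ≤ r) : phi m ⟨b, hb⟩ ≤ r := by
  have hpoint (x : unitSpace G) : liminf (fun n => ENNReal.ofReal (condExp (a n) x).re) atTop =
      ENNReal.ofReal (condExp b x).re :=
    (ENNReal.tendsto_ofReal ((Complex.continuous_re.tendsto _).comp
      (tendsto_condExp hlim x))).liminf_eq
  calc phi m ⟨b, hb⟩
      = ∫⁻ x, liminf (fun n => ENNReal.ofReal (condExp (a n) x).re) atTop ∂m := by
        simp_rw [hpoint]; rfl
    _ ≤ liminf (fun n => phi m ⟨a n, ha n⟩) atTop := lintegral_liminf_le fun n =>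
        (Complex.continuous_re.comp (condExp (a n)).continuous).measurable.ennreal_ofReal
    _ ≤ r := liminf_le_of_frequently_le' (Frequently.of_forall hr)

variable [IsFiniteMeasureOnCompacts m]

theorem integrable_condExp_conj (u : C_c(unitSpace G, ℝ)) (a : ReducedCStarAlgebra G) :
    Integrable (fun x => condExp (ofUnits u * a * ofUnits u) x) m := by
  refine (condExp _).continuous.integrable_of_hasCompactSupport ?_
  have hcomp : HasCompactSupport fun x => (u x : ℂ) ^ 2 * condExp a x :=
    (u.hasCompactSupport.comp_left (g := fun r : ℝ => (r : ℂ) ^ 2) (by simp)).mul_right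
  exact (funext (condExp_conj_ofUnits u a) : _ = fun x => (u x : ℂ) ^ 2 * condExp a x) ▸ hcomp

theorem continuous_integral_condExp_conj (u : C_c(unitSpace G, ℝ)) :
    Continuous fun a : ReducedCStarAlgebra G =>
      ∫ x, condExp (ofUnits u * a * ofUnits u) x ∂m := by
  have hsq : Integrable (fun x => u x * u x) m :=
    (u.continuous.mul u.continuous).integrable_of_hasCompactSupport u.hasCompactSupport.mul_right
  have hint (a : ReducedCStarAlgebra G) : Integrable (fun x => (u x : ℂ) ^ 2 * condExp a x) m := by
    simpa only [condExp_conj_ofUnits] using integrable_condExp_conj (m := m) u a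
  simp only [condExp_conj_ofUnits]
  refine continuous_of_linear_of_bound (𝕜 := ℂ) (C := ∫ x, u x * u x ∂m) (fun a b => ?_)
    (fun z a => ?_) fun a => ?_
  · simp only [map_add, ZeroAtInftyContinuousMap.add_apply, mul_add]
    exact integral_add (hint a) (hint b)
  · simp only [map_smul, ZeroAtInftyContinuousMap.smul_apply, mul_smul_comm]
    exact integral_smul z _
  · rw [← integral_mul_const]
    refine norm_integral_le_of_norm_le (hsq.mul_const _) (Eventually.of_forall fun x => ?_)
    rw [norm_mul, norm_pow, Complex.norm_real, Real.norm_eq_abs, sq_abs, sq]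
    exact mul_le_mul_of_nonneg_left (norm_diag_le a x) (mul_self_nonneg _)

end Measure

end ReducedCStarAlgebra

end EtaleGroupoid

/-! ### KMS weights on `C*_r(G)` -/

namespace EtaleGroupoid

variable {G : Type*} [TopologicalSpace G] [EtaleGroupoid G] [T2Space G] [LocallyCompactSpace G]

namespace ReducedCStarAlgebra

open CStarWeight

variable {ψ : CStarWeight (ReducedCStarAlgebra G)} {c : RealHom G} {β : ℝ}

theorem ofUnits_mem_leftIdeal (hK : ψ.IsKMS (sigma c) β) (u : C_c(unitSpace G, ℝ)) :
    ofUnits u ∈ ψ.leftIdeal := by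
  obtain ⟨v, hv, hvu, -⟩ := exists_local_unit (diagCc u)
  refine hK.mem_leftIdeal_of_local_unit (star_ofUnits u) (ofUnits_nonneg fun x => (hv x).1)
    (fun t => sigma_ofUnits c t u) (fun t => sigma_ofUnits c t v) ?_
  rw [ofUnits_apply, ofUnits_apply, ofCc_mul, hvu]

theorem ofCc_mem_leftIdeal (hK : ψ.IsKMS (sigma c) β) (f : C_c(G, ℂ)) :
    ofCc f ∈ ψ.leftIdeal := by
  obtain ⟨v, -, -, hfv⟩ := exists_local_unit f
  rw [← hfv, ← ofCc_mul]
  exact mul_mem_leftIdeal hK.proper _ (ofUnits_mem_leftIdeal hK v)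

theorem star_ofCc_mem_leftIdeal (hK : ψ.IsKMS (sigma c) β) (f : C_c(G, ℂ)) :
    star (ofCc f) ∈ ψ.leftIdeal := by
  rw [star_ofCc]
  exact ofCc_mem_leftIdeal hK _

theorem ofCc_mem_defDomain (hK : ψ.IsKMS (sigma c) β) (f : C_c(G, ℂ)) :
    ofCc f ∈ ψ.defDomain := by
  obtain ⟨v, -, hvf, -⟩ := exists_local_unit f
  rw [← hvf, ← ofCc_mul]
  exact mul_mem_defDomain (star_ofCc_mem_leftIdeal hK _) (ofCc_mem_leftIdeal hK f)

theorem functional_mul_ofUnits (hK : ψ.IsKMS (sigma c) β) {a : ReducedCStarAlgebra G}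
    (ha : a ∈ ψ.leftIdeal) (ha' : star a ∈ ψ.leftIdeal) (u : C_c(unitSpace G, ℝ)) :
    ψ.functional hK.proper (a * ofUnits u) = ψ.functional hK.proper (ofUnits u * a) :=
  hK.functional_mul_comm_of_fixed ha ha' (ofUnits_mem_leftIdeal hK u)
    (star_ofCc_mem_leftIdeal hK _) fun t => sigma_ofUnits c t u

theorem functional_ofCc_restrict {c₀ : RealHom G}
    (hiso : ∀ x ∈ unitSpace G, isotropy x ∩ c₀.ker = {x}) (hopen : IsOpen c₀.ker)
    (hK : ψ.IsKMS (sigma c) β) (hinv : ∀ t : ℝ, ψ.IsInvariantUnder (sigma c₀ t))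
    (f : C_c(G, ℂ)) :
    ψ.functional hK.proper (ofCc f) =
      ψ.functional hK.proper (ofCc (restrictClopen isClopen_unitSpace f)) := by
  refine eq_restrict_unitSpace hiso hopen (Φ := ψ.functional hK.proper ∘ₗ ofCcLinear)
    (fun u f => ?_) (fun t f => ?_) f
  · change ψ.functional hK.proper (ofCc _) = ψ.functional hK.proper (ofCc _)
    rw [← ofCc_mul, ← ofCc_mul]
    exact (functional_mul_ofUnits hK (ofCc_mem_leftIdeal hK f)
      (star_ofCc_mem_leftIdeal hK f) u).symm
  · change ψ.functional hK.proper (ofCc _) = ψ.functional hK.proper (ofCc _)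
    rw [← sigmaAut_ofCc]
    exact functional_map hK.proper (hinv t) (ofCc_mem_defDomain hK f)

/-- The restriction of a KMS weight to the real-valued part of `C_c(G⁽⁰⁾)`. -/
noncomputable def unitFunctional (hK : ψ.IsKMS (sigma c) β) : C_c(unitSpace G, ℝ) →ₚ[ℝ] ℝ :=
  PositiveLinearMap.mk₀
    (Complex.reLm ∘ₗ (ψ.functional hK.proper).restrictScalars ℝ ∘ₗ ofUnits) fun u hu => by
      obtain ⟨v, rfl⟩ := exists_mul_self_eq hu
      change 0 ≤ (ψ.functional hK.proper (ofUnits (v * v))).re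
      have hsq : ofUnits (v * v) = star (ofUnits v) * ofUnits v := by
        rw [star_ofUnits, ofUnits_mul]
      rw [hsq, functional_star_mul_self hK.proper (ofUnits_mem_leftIdeal hK v), Complex.ofReal_re]
      exact ENNReal.toReal_nonneg

theorem functional_ofUnits (hK : ψ.IsKMS (sigma c) β) (u : C_c(unitSpace G, ℝ)) :
    ψ.functional hK.proper (ofUnits u) = (unitFunctional hK u : ℂ) := by
  have hreal := functional_star hK.proper (ofCc_mem_defDomain hK (diagCc u))
  rw [star_ofCc, invol_diagCc] at hreal
  exact (Complex.conj_eq_iff_re.1 hreal.symm).symm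

theorem continuous_functional_conj (hψ : ψ.IsProper) {d : ReducedCStarAlgebra G}
    (hd : d ∈ ψ.leftIdeal) (hsa : star d = d) :
    Continuous fun a => ψ.functional hψ (d * a * d) := by
  refine continuous_of_linear_of_bound (𝕜 := ℂ) (C := ψ.gnsNorm d * ψ.gnsNorm d)
    (fun a b => by rw [mul_add, add_mul, map_add])
    (fun z a => by rw [mul_smul_comm, smul_mul_assoc, map_smul]) fun a => ?_
  calc ‖ψ.functional hψ (d * a * d)‖
      = ‖ψ.functional hψ (star d * (a * d))‖ := by rw [hsa, _root_.mul_assoc]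
    _ ≤ ψ.gnsNorm d * ψ.gnsNorm (a * d) :=
      norm_functional_star_mul_le hψ hd (mul_mem_leftIdeal hψ a hd)
    _ ≤ ψ.gnsNorm d * (‖a‖ * ψ.gnsNorm d) :=
      mul_le_mul_of_nonneg_left (gnsNorm_mul_le hψ a hd) (gnsNorm_nonneg d)
    _ = ψ.gnsNorm d * ψ.gnsNorm d * ‖a‖ := by ring

variable [MeasurableSpace G] [BorelSpace G]

/-- The regular Borel measure on `G⁽⁰⁾` that represents a KMS weight on `C_c(G⁽⁰⁾)`. -/
noncomputable def kmsMeasure (hK : ψ.IsKMS (sigma c) β) : Measure (unitSpace G) :=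
  RealRMK.rieszMeasure (unitFunctional hK)

instance (hK : ψ.IsKMS (sigma c) β) : (kmsMeasure hK).Regular :=
  RealRMK.regular_rieszMeasure _

theorem functional_ofUnits_eq_integral (hK : ψ.IsKMS (sigma c) β) (u : C_c(unitSpace G, ℝ)) :
    ψ.functional hK.proper (ofUnits u) = ∫ x, (u x : ℂ) ∂(kmsMeasure hK) := by
  rw [functional_ofUnits, integral_complex_ofReal, kmsMeasure, RealRMK.integral_rieszMeasure]

theorem functional_ofCc_eq_integral {c₀ : RealHom G}
    (hiso : ∀ x ∈ unitSpace G, isotropy x ∩ c₀.ker = {x}) (hopen : IsOpen c₀.ker)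
    (hK : ψ.IsKMS (sigma c) β) (hinv : ∀ t : ℝ, ψ.IsInvariantUnder (sigma c₀ t))
    (f : C_c(G, ℂ)) :
    ψ.functional hK.proper (ofCc f) = ∫ x : unitSpace G, f x ∂(kmsMeasure hK) := by
  obtain ⟨p, q, hpq, hval⟩ := exists_restrict_unitSpace_eq f
  have hsplit : ofCc (diagCc p + Complex.I • diagCc q) = ofUnits p + Complex.I • ofUnits q :=
    (map_add ofCcLinear _ _).trans (congrArg _ (map_smul ofCcLinear _ _))
  have hint (u : C_c(unitSpace G, ℝ)) : Integrable (fun x => (u x : ℂ)) (kmsMeasure hK) :=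
    (u.continuous.integrable_of_hasCompactSupport u.hasCompactSupport).ofReal
  rw [functional_ofCc_restrict hiso hopen hK hinv, hpq, hsplit, map_add, map_smul,
    functional_ofUnits_eq_integral hK, functional_ofUnits_eq_integral hK, smul_eq_mul,
    ← integral_const_mul, ← integral_add (hint p) ((hint q).const_mul _)]
  simp only [hval]

variable {m : Measure (unitSpace G)} [IsFiniteMeasureOnCompacts m]

theorem functional_conj_eq_integral (hK : ψ.IsKMS (sigma c) β)
    (hm : ∀ f : C_c(G, ℂ), ψ.functional hK.proper (ofCc f) = ∫ x : unitSpace G, f x ∂m)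
    (u : C_c(unitSpace G, ℝ)) (a : ReducedCStarAlgebra G) :
    ψ.functional hK.proper (ofUnits u * a * ofUnits u) =
      ∫ x, condExp (ofUnits u * a * ofUnits u) x ∂m := by
  refine congrFun (Continuous.ext_on denseRange_ofCc (continuous_functional_conj hK.proper
    (ofUnits_mem_leftIdeal hK u) (star_ofUnits u)) (continuous_integral_condExp_conj u) ?_) a
  rintro _ ⟨f, rfl⟩
  simp only [ofUnits_apply, ofCc_mul, hm, condExp_ofCc]

theorem normSq_mul_ofUnits (hK : ψ.IsKMS (sigma c) β)
    (hm : ∀ f : C_c(G, ℂ), ψ.functional hK.proper (ofCc f) = ∫ x : unitSpace G, f x ∂m)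
    (b : ReducedCStarAlgebra G) (u : C_c(unitSpace G, ℝ)) :
    ψ.normSq (b * ofUnits u) =
      phi m ⟨star (b * ofUnits u) * (b * ofUnits u), star_mul_self_nonneg _⟩ := by
  have hmem : b * ofUnits u ∈ ψ.leftIdeal :=
    mul_mem_leftIdeal hK.proper b (ofUnits_mem_leftIdeal hK u)
  have hint := integrable_condExp_conj (m := m) u (star b * b)
  have hval := functional_conj_eq_integral hK hm u (star b * b)
  rw [← star_mul_ofUnits_mul_self] at hint hval
  rw [phi_eq_ofReal_integral _ hint, ← hval, functional_star_mul_self hK.proper hmem,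
    Complex.ofReal_re]
  exact (ENNReal.ofReal_toReal (mem_leftIdeal_iff.1 hmem).ne).symm

theorem gnsNorm_mul_ofUnits_le (hK : ψ.IsKMS (sigma c) β)
    (hm : ∀ f : C_c(G, ℂ), ψ.functional hK.proper (ofCc f) = ∫ x : unitSpace G, f x ∂m)
    {b : ReducedCStarAlgebra G} (hb : b ∈ ψ.leftIdeal) {u : C_c(unitSpace G, ℝ)}
    (hu : ∀ x, u x ∈ Icc (0 : ℝ) 1) : ψ.gnsNorm (b * ofUnits u) ≤ ψ.gnsNorm b := by
  have hu_mem := ofUnits_mem_leftIdeal hK u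
  have hbu := mul_mem_leftIdeal hK.proper b hu_mem
  have hbuu := mul_mem_leftIdeal hK.proper (b * ofUnits u) hu_mem
  have hanti : ψ.gnsNorm (b * ofUnits u * ofUnits u) ≤ ψ.gnsNorm (b * ofUnits u) := by
    refine Real.sqrt_le_sqrt (ENNReal.toReal_mono (mem_leftIdeal_iff.1 hbu).ne ?_)
    rw [normSq_mul_ofUnits hK hm, normSq_mul_ofUnits hK hm]
    exact phi_mul_ofUnits_le _ hu
  have hcomm : ψ.functional hK.proper (star (b * ofUnits u) * (b * ofUnits u)) =
      ψ.functional hK.proper (star b * (b * ofUnits u * ofUnits u)) := by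
    have hstar : star (star b * (b * ofUnits u)) ∈ ψ.leftIdeal := by
      rw [star_mul, star_star]
      exact mul_mem_leftIdeal hK.proper _ hb
    have hfix := functional_mul_ofUnits hK (mul_mem_leftIdeal hK.proper (star b) hbu) hstar u
    rw [star_mul_ofUnits_mul_self]
    simpa only [_root_.mul_assoc] using hfix.symm
  have hsq : ψ.gnsNorm (b * ofUnits u) ^ 2 ≤ ψ.gnsNorm b * ψ.gnsNorm (b * ofUnits u) := by
    calc ψ.gnsNorm (b * ofUnits u) ^ 2
        = ‖ψ.functional hK.proper (star (b * ofUnits u) * (b * ofUnits u))‖ := by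
          rw [functional_star_mul_self hK.proper hbu, Complex.norm_real, gnsNorm_sq,
            Real.norm_of_nonneg ENNReal.toReal_nonneg]
      _ ≤ ψ.gnsNorm b * ψ.gnsNorm (b * ofUnits u * ofUnits u) := by
          rw [hcomm]
          exact norm_functional_star_mul_le hK.proper hb hbuu
      _ ≤ _ := mul_le_mul_of_nonneg_left hanti (gnsNorm_nonneg b)
  by_contra! hlt
  rw [pow_two] at hsq
  exact hlt.not_ge (le_of_mul_le_mul_right hsq ((gnsNorm_nonneg b).trans_lt hlt))

theorem normSq_mul_ofUnits_le (hK : ψ.IsKMS (sigma c) β)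
    (hm : ∀ f : C_c(G, ℂ), ψ.functional hK.proper (ofCc f) = ∫ x : unitSpace G, f x ∂m)
    (b : ReducedCStarAlgebra G) {u : C_c(unitSpace G, ℝ)} (hu : ∀ x, u x ∈ Icc (0 : ℝ) 1) :
    ψ.normSq (b * ofUnits u) ≤ ψ.normSq b := by
  rcases eq_or_ne (ψ.normSq b) ∞ with htop | hfin
  · exact htop ▸ le_top
  have hbu := mul_mem_leftIdeal hK.proper b (ofUnits_mem_leftIdeal hK u)
  rw [← ENNReal.toReal_le_toReal (mem_leftIdeal_iff.1 hbu).ne hfin, ← gnsNorm_sq, ← gnsNorm_sq]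
  exact pow_le_pow_left₀ (gnsNorm_nonneg _)
    (gnsNorm_mul_ofUnits_le hK hm (mem_leftIdeal_iff.2 hfin.lt_top) hu) 2

theorem apply_eq_phi (hK : ψ.IsKMS (sigma c) β)
    (hm : ∀ f : C_c(G, ℂ), ψ.functional hK.proper (ofCc f) = ∫ x : unitSpace G, f x ∂m)
    (a : {a : ReducedCStarAlgebra G // 0 ≤ a}) : ψ a = phi m a := by
  obtain ⟨a, ha⟩ := a
  obtain ⟨b, rfl⟩ := CStarAlgebra.nonneg_iff_eq_star_mul_self.1 ha
  obtain ⟨u, hu, hlim⟩ := exists_tendsto_mul_ofUnits b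
  apply le_antisymm
  · refine normSq_le_of_tendsto hK.proper hlim (Eventually.of_forall fun n => ?_)
    rw [normSq_mul_ofUnits hK hm]
    exact phi_mul_ofUnits_le b (hu n)
  · refine phi_le_of_tendsto ha (fun n => star_mul_self_nonneg (b * ofUnits (u n)))
      (hlim.star.mul hlim) fun n => ?_
    rw [← normSq_mul_ofUnits hK hm]
    exact normSq_mul_ofUnits_le hK hm b (hu n)

end ReducedCStarAlgebra

end EtaleGroupoid

theorem theorem2p2_general {G : Type*} [TopologicalSpace G] [EtaleGroupoid G] [T2Space G]
    [LocallyCompactSpace G] [MeasurableSpace G] [BorelSpace G]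
    (c₀ c : EtaleGroupoid.RealHom G)
    (hiso : ∀ x ∈ EtaleGroupoid.unitSpace G, EtaleGroupoid.isotropy x ∩ c₀.ker = {x})
    (hopen : IsOpen c₀.ker)
    (β : ℝ) (ψ : CStarWeight (EtaleGroupoid.ReducedCStarAlgebra G))
    (hKMS : ψ.IsKMS (EtaleGroupoid.ReducedCStarAlgebra.sigma c) β)
    (hinv : ∀ t : ℝ, ψ.IsInvariantUnder (EtaleGroupoid.ReducedCStarAlgebra.sigma c₀ t)) :
    ∃ m : MeasureTheory.Measure (EtaleGroupoid.unitSpace G), m.Regular ∧ m ≠ 0 ∧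
      ∀ a : {a : EtaleGroupoid.ReducedCStarAlgebra G // 0 ≤ a},
        ψ a = EtaleGroupoid.ReducedCStarAlgebra.phi m a := by
  have hphi := EtaleGroupoid.ReducedCStarAlgebra.apply_eq_phi hKMS
    (EtaleGroupoid.ReducedCStarAlgebra.functional_ofCc_eq_integral hiso hopen hKMS hinv)
  refine ⟨EtaleGroupoid.ReducedCStarAlgebra.kmsMeasure hKMS, inferInstance, fun hzero => ?_, hphi⟩
  obtain ⟨a, ha⟩ := hKMS.proper.ne_zero
  apply ha
  rw [hphi, hzero, EtaleGroupoid.ReducedCStarAlgebra.phi, MeasureTheory.lintegral_zero_measure]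

theorem theorem2p2 {G : Type*} [TopologicalSpace G] [EtaleGroupoid G] [T2Space G]
    [LocallyCompactSpace G] [SecondCountableTopology G] [MeasurableSpace G] [BorelSpace G]
    (c₀ c : EtaleGroupoid.RealHom G)
    (hiso : ∀ x ∈ EtaleGroupoid.unitSpace G, EtaleGroupoid.isotropy x ∩ c₀.ker = {x})
    (hopen : IsOpen c₀.ker)
    (β : ℝ) (ψ : CStarWeight (EtaleGroupoid.ReducedCStarAlgebra G))
    (hKMS : ψ.IsKMS (EtaleGroupoid.ReducedCStarAlgebra.sigma c) β)
    (hinv : ∀ t : ℝ, ψ.IsInvariantUnder (EtaleGroupoid.ReducedCStarAlgebra.sigma c₀ t)) :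
    ∃ m : MeasureTheory.Measure (EtaleGroupoid.unitSpace G), m.Regular ∧ m ≠ 0 ∧
      ∀ a : {a : EtaleGroupoid.ReducedCStarAlgebra G // 0 ≤ a},
        ψ a = EtaleGroupoid.ReducedCStarAlgebra.phi m a :=
  theorem2p2_general c₀ c hiso hopen β ψ hKMS hinv
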